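/- Let $H\in(0,1)$, $c_H=\frac{\Gamma(2H+1)\sin(\pi H)}{2\pi}$ and $\mu_H(d\xi)=c_H|\xi|^{1-2H}d\xi$. Write $\mathcal F\varphi(t,\cdot)(\xi)=\int_{\mathbb R}e^{-i\xi x}\varphi(t,x)\,dx$ for the Fourier transform in space, and let $\mathcal H_H$ be the real Hilbert space obtained by completing $C_0^\infty(\mathbb R_+\times\mathbb R)$ for $$\langle\varphi,\psi\rangle_H=\int_0^\infty\!\!\int_{\mathbb R}\mathcal F\varphi(t,\cdot)(\xi)\,\overline{\mathcal F\psi(t,\cdot)(\xi)}\,\mu_H(d\xi)\,dt .$$ The Fourier transform extends by linearity and continuity to $\mathcal H_H$ and to the Hilbert tensor power $\mathcal H_H^{\otimes n}$, where $\mathcal F[f(t_1,\cdot,\dots,t_n,\cdot)](\xi_1,\dots,\xi_n)\in L^2\big((dt\,\mu_H(d\xi))^{\otimes n};\mathbb C\big)$. On a probability space, let $\tilde W=\tilde W_1+i\tilde W_2$ be a complex Gaussian white measure on the bounded Borel subsets of $\mathbb R_+\times\mathbb R$, with the Hermitian symmetry $\tilde W(A^-)=\overline{\tilde W(A)}$ a.s.,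 where $A^-=\{(t,-x):(t,x)\in A\}$; that is, $\tilde W_1,\tilde W_2$ are independent centered real Gaussian families with $$E[\tilde W_1(A)\tilde W_1(B)]=\tfrac12\big(|A\cap B|+|A\cap B^-|\big),\qquad E[\tilde W_2(A)\tilde W_2(B)]=\tfrac12\big(|A\cap B|-|A\cap B^-|\big).$$ (In particular $E[\tilde W(A)\overline{\tilde W(B)}]=|A\cap B|$, and $E[\tilde W_j(A)\tilde W_j(B)]=|A\cap B|/2$ for $A,B\subset\mathbb R_+\times(0,\infty)$.) For $g\in L^2((\mathbb R_+\times\mathbb R)^n;\mathbb C)$, let $\tilde I_n(g)$ be the multiple Wiener integral of $g$ with respect to $\tilde W$, i.e. the continuous complex linear extension to $L^2$ of $\tilde I_n(1_{A_1\times\cdots\times A_n})=\tilde W(A_1)\cdots\tilde W(A_n)$, where $A_i\cap A_j=A_i\cap A_j^-=\emptyset$ for $i\ne j$. Let $W^H=\{W^H(\varphi),\varphi\in\mathcal H_H\}$ be the real isonormal Gaussian process on $\mathcal H_H$, defined on the same probability space, such that for all $t\ge 0$ and $x\in\mathbb R$, a.s., $$W^H(1_{[0,t]\times[0,x]})=\sqrt{c_H}\int_0^t\!\int_{\mathbb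 R}\mathcal F[1_{[0,x]}](\xi)\,|\xi|^{\frac12-H}\,\tilde W(ds,d\xi)$$ (with $1_{[0,x]}:=-1_{[x,0]}$ if $x<0$). Let $(e_k)$ be an orthonormal basis of $\mathcal H_H$, and let $I_n^H$ be the multiple Wiener integral with respect to $W^H$, i.e. the continuous linear map $\mathcal H_H^{\otimes n}\to L^2(\Omega)$ with $$I_n^H(e_{i_1}\otimes\cdots\otimes e_{i_n})=P_{k_1}(W^H(e_{j_1}))\cdots P_{k_m}(W^H(e_{j_m})),$$ where $j_1,\dots,j_m$ are the distinct values among $i_1,\dots,i_n$, $k_1,\dots,k_m$ are their multiplicities, and $P_k$ is the $k$-th Hermite polynomial (of the standard normal law) with leading coefficient $1$. Let $n\ge1$, $f\in\mathcal H_H^{\otimes n}$ and $$\hat f(t_1,\xi_1,\dots,t_n,\xi_n)=c_H^{n/2}\,\mathcal F[f(t_1,\cdot,\dots,t_n,\cdot)](\xi_1,\dots,\xi_n)\,|\xi_1|^{\frac12-H}\cdots|\xi_n|^{\frac12-H}.$$ Then $I_n^H(f)$ and $\tilde I_n(\hat f)$ are well defined, and $I_n^H(f)=\tilde I_n(\hat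 f)$ almost surely. -/

import Mathlib

noncomputable section

namespace SpectralWiener

open MeasureTheory ProbabilityTheory Set

/-! ### The covariance measure and the spatial Fourier transform -/

/-- The constant `c_H = Γ(2H+1) sin(πH) / (2π)`. -/
def cH (H : Ioo (0 : ℝ) 1) : ℝ :=
  Real.Gamma (2 * (H : ℝ) + 1) * Real.sin (Real.pi * (H : ℝ)) / (2 * Real.pi)

/-- The spatial spectral measure `μ_H(dξ) = c_H |ξ|^{1-2H} dξ` on `ℝ`. -/
def muH (H : Ioo (0 : ℝ) 1) : Measure ℝ :=
  volume.withDensity (fun ξ : ℝ => ENNReal.ofReal (cH H * |ξ| ^ (1 - 2 * (H : ℝ))))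

/-- The measure `dt μ_H(dξ)` on `ℝ₊ × ℝ` (a measure on `ℝ × ℝ` carried by `[0,∞) × ℝ`). -/
def nuH (H : Ioo (0 : ℝ) 1) : Measure (ℝ × ℝ) :=
  (volume.restrict (Ici (0 : ℝ))).prod (muH H)

/-- Lebesgue measure `dt dx` on `ℝ₊ × ℝ` (a measure on `ℝ × ℝ` carried by `[0,∞) × ℝ`). -/
def lebHalf : Measure (ℝ × ℝ) :=
  (volume.restrict (Ici (0 : ℝ))).prod (volume : Measure ℝ)

/-- The Fourier transform in the space variable,
`𝓕 φ(t,·)(ξ) = ∫ e^{-iξx} φ(t,x) dx`, at the point `z = (t, ξ)`. -/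
def spaceFourier (φ : ℝ × ℝ → ℝ) (z : ℝ × ℝ) : ℂ :=
  ∫ x : ℝ, Complex.exp (-(Complex.I * (z.2 : ℂ) * (x : ℂ))) * (φ (z.1, x) : ℂ)

instance (H : Ioo (0 : ℝ) 1) : SigmaFinite (muH H) := by
  unfold muH
  exact SigmaFinite.withDensity_of_ne_top' (fun _ => ENNReal.ofReal_ne_top)

instance (H : Ioo (0 : ℝ) 1) : SigmaFinite (nuH H) := by
  unfold nuH; infer_instance

instance : SigmaFinite lebHalf := by
  unfold lebHalf; infer_instance

/-! ### Test functions -/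

/-- Smooth compactly supported real functions on the plane. Their restrictions to `ℝ₊ × ℝ` are the
elements of `C_0^∞(ℝ₊ × ℝ)`. -/
def testSubmodule : Submodule ℝ (ℝ × ℝ → ℝ) where
  carrier := {φ | ContDiff ℝ (⊤ : ℕ∞) φ ∧ HasCompactSupport φ}
  add_mem' := fun ha hb => ⟨ha.1.add hb.1, ha.2.add hb.2⟩
  zero_mem' := ⟨contDiff_const, HasCompactSupport.zero⟩
  smul_mem' := fun c _ ha => ⟨contDiff_const.smul ha.1, ha.2.smul_left (f := fun _ => c)⟩

theorem cH_pos (H : Ioo (0 : ℝ) 1) : 0 < cH H := by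
  have h0 := H.2.1
  have h1 := H.2.2
  unfold cH
  have : 0 < Real.sin (Real.pi * (H : ℝ)) :=
    Real.sin_pos_of_pos_of_lt_pi (by positivity) (by nlinarith [Real.pi_pos])
  have := Real.Gamma_pos_of_pos (s := 2 * (H : ℝ) + 1) (by linarith)
  positivity

theorem continuous_spaceFourier {φ : ℝ × ℝ → ℝ} (h : Continuous φ) (hc : HasCompactSupport φ) :
    Continuous (spaceFourier φ) := by
  have hK : IsCompact (Prod.snd '' tsupport φ) := hc.isCompact.image continuous_snd
  have : spaceFourier φ = fun z : ℝ × ℝ => ∫ x in Prod.snd '' tsupport φ,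
      Complex.exp (-(Complex.I * (z.2 : ℂ) * (x : ℂ))) * (φ (z.1, x) : ℂ) := by
    funext z
    rw [setIntegral_eq_integral_of_forall_compl_eq_zero]
    · rfl
    · intro x hx
      have : (z.1, x) ∉ tsupport φ := fun hz => hx ⟨_, hz, rfl⟩
      simp [image_eq_zero_of_notMem_tsupport this]
  rw [this]
  refine continuous_parametric_integral_of_continuous
    (f := fun (z : ℝ × ℝ) (x : ℝ) =>
      Complex.exp (-(Complex.I * (z.2 : ℂ) * (x : ℂ))) * (φ (z.1, x) : ℂ)) ?_ hK
  unfold Function.uncurry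
  fun_prop

theorem norm_spaceFourier_le {φ : ℝ × ℝ → ℝ} (h : Continuous φ) (hc : HasCompactSupport φ) :
    ∃ C : ℝ, ∀ z, ‖spaceFourier φ z‖ ≤ C := by
  obtain ⟨B, hB⟩ := hc.exists_bound_of_continuous h
  obtain ⟨R, hR⟩ := hc.isCompact.isBounded.subset_closedBall (0 : ℝ × ℝ)
  refine ⟨∫ x : ℝ, (Icc (-R) R).indicator (fun _ => B) x, fun z => ?_⟩
  refine norm_integral_le_of_norm_le
    ((integrable_indicator_iff measurableSet_Icc).2 (by simp)) (Filter.Eventually.of_forall ?_)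
  intro x
  have he : ‖Complex.exp (-(Complex.I * (z.2 : ℂ) * (x : ℂ)))‖ = 1 := by
    rw [Complex.norm_exp]; simp
  rw [norm_mul, he, one_mul, Complex.norm_real]
  by_cases hx : x ∈ Icc (-R) R
  · rw [indicator_of_mem hx]; exact hB _
  · rw [indicator_of_notMem hx]
    have : (z.1, x) ∉ tsupport φ := by
      intro hz
      have := hR hz
      rw [mem_closedBall_zero_iff] at this
      exact hx (abs_le.1 ((norm_snd_le (z.1, x)).trans this))
    simp [image_eq_zero_of_notMem_tsupport this]

theorem spaceFourier_deriv {φ : ℝ × ℝ → ℝ} (h : ContDiff ℝ (⊤ : ℕ∞) φ) (hc : HasCompactSupport φ)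
    (z : ℝ × ℝ) :
    spaceFourier (fun y => fderiv ℝ φ y (0, 1)) z = (Complex.I * (z.2 : ℂ)) * spaceFourier φ z := by
  obtain ⟨t, ξ⟩ := z
  have hd : Differentiable ℝ φ := h.differentiable (by simp)
  have hemb : Topology.IsClosedEmbedding (fun x : ℝ => (t, x)) :=
    Topology.IsClosedEmbedding.of_continuous_injective_isClosedMap (by fun_prop)
      (fun a b hab => by simpa using hab) (isClosedMap_prodMk_left t)
  have hc1 : HasCompactSupport (fun x : ℝ => ((φ (t, x) : ℝ) : ℂ)) :=
    (hc.comp_isClosedEmbedding hemb).comp_left (g := fun r : ℝ => (r : ℂ)) (by simp)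
  have hf' : Continuous (fun y => fderiv ℝ φ y (0, 1)) :=
    (h.continuous_fderiv (by simp)).clm_apply continuous_const
  have hc' : HasCompactSupport (fun y => fderiv ℝ φ y (0, 1)) :=
    (hc.fderiv ℝ).comp_left (g := fun L : ℝ × ℝ →L[ℝ] ℝ => L (0, 1)) (by simp)
  have hc2 : HasCompactSupport (fun x : ℝ => ((fderiv ℝ φ (t, x) (0, 1) : ℝ) : ℂ)) :=
    (hc'.comp_isClosedEmbedding hemb).comp_left (g := fun r : ℝ => (r : ℂ)) (by simp)
  have hu : ∀ x : ℝ, HasDerivAt (fun x : ℝ => ((φ (t, x) : ℝ) : ℂ))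
      ((fderiv ℝ φ (t, x) (0, 1) : ℝ) : ℂ) x := by
    intro x
    have h1 : HasDerivAt (fun x : ℝ => (t, x)) ((0 : ℝ), (1 : ℝ)) x :=
      (hasDerivAt_const x t).prodMk (hasDerivAt_id x)
    exact ((hd (t, x)).hasFDerivAt.comp_hasDerivAt x h1).ofReal_comp
  have hv : ∀ x : ℝ, HasDerivAt (fun x : ℝ => Complex.exp (-(Complex.I * (ξ : ℂ) * (x : ℂ))))
      (-(Complex.I * (ξ : ℂ)) * Complex.exp (-(Complex.I * (ξ : ℂ) * (x : ℂ)))) x := by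
    intro x
    have h1 : HasDerivAt (fun x : ℝ => -(Complex.I * (ξ : ℂ) * (x : ℂ)))
        (-(Complex.I * (ξ : ℂ))) x := by
      have h2 := ((Complex.ofRealCLM.hasDerivAt (x := x)).const_mul (Complex.I * (ξ : ℂ))).neg
      simp only [Complex.ofRealCLM_apply, Complex.ofReal_one, mul_one] at h2
      exact h2
    simpa [mul_comm] using h1.cexp
  have hcphi : Continuous fun x : ℝ => ((φ (t, x) : ℝ) : ℂ) := by
    have := h.continuous; fun_prop
  have hcder : Continuous fun x : ℝ => ((fderiv ℝ φ (t, x) (0, 1) : ℝ) : ℂ) :=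
    Complex.continuous_ofReal.comp (hf'.comp (by fun_prop))
  have key := integral_mul_deriv_eq_deriv_mul_of_integrable
    (u := fun x : ℝ => ((φ (t, x) : ℝ) : ℂ))
    (v := fun x : ℝ => Complex.exp (-(Complex.I * (ξ : ℂ) * (x : ℂ))))
    (fun x _ => hu x) (fun x _ => hv x)
    ((hcphi.mul (by fun_prop)).integrable_of_hasCompactSupport hc1.mul_right)
    ((hcder.mul (by fun_prop)).integrable_of_hasCompactSupport hc2.mul_right)
    ((hcphi.mul (by fun_prop)).integrable_of_hasCompactSupport hc1.mul_right)
  unfold spaceFourier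
  dsimp only
  rw [← integral_const_mul]
  have e1 : ∫ x : ℝ, Complex.exp (-(Complex.I * (ξ : ℂ) * (x : ℂ))) *
      ((fderiv ℝ φ (t, x) (0, 1) : ℝ) : ℂ) =
      ∫ x : ℝ, ((fderiv ℝ φ (t, x) (0, 1) : ℝ) : ℂ) *
        Complex.exp (-(Complex.I * (ξ : ℂ) * (x : ℂ))) := by
    congr 1; funext x; ring
  rw [e1, ← neg_eq_iff_eq_neg.2 key, ← integral_neg]
  congr 1; funext x; ring

theorem integrable_muH_density (H : Ioo (0 : ℝ) 1) :
    Integrable (fun ξ : ℝ => (1 + ξ ^ 2)⁻¹) (muH H) := by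
  have h0 := H.2.1
  have h1 := H.2.2
  unfold muH
  rw [integrable_withDensity_iff_integrable_smul' (by fun_prop) (by simp)]
  have hc := cH_pos H
  have hpos : IntegrableOn (fun ξ : ℝ => (ENNReal.ofReal (cH H * |ξ| ^ (1 - 2 * (H : ℝ)))).toReal •
      (1 + ξ ^ 2)⁻¹) (Ioi 0) := by
    have e : Ioi (0 : ℝ) = Ioc 0 1 ∪ Ioi 1 := by rw [Ioc_union_Ioi_eq_Ioi zero_le_one]
    have hm : Measurable (fun ξ : ℝ => (ENNReal.ofReal (cH H * |ξ| ^ (1 - 2 * (H : ℝ)))).toReal •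
      (1 + ξ ^ 2)⁻¹) := by fun_prop
    rw [e]
    refine IntegrableOn.union ?_ ?_
    · have hi : IntegrableOn (fun ξ : ℝ => cH H * ξ ^ (1 - 2 * (H : ℝ))) (Ioc 0 1) :=
        (((intervalIntegrable_iff_integrableOn_Ioc_of_le zero_le_one).1
          (intervalIntegral.intervalIntegrable_rpow' (by linarith))).const_mul _)
      refine hi.mono' hm.aestronglyMeasurable ?_
      filter_upwards [ae_restrict_mem measurableSet_Ioc] with ξ hξ
      have hξ0 : 0 < ξ := hξ.1
      rw [abs_of_pos hξ0, ENNReal.toReal_ofReal (by positivity), smul_eq_mul,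
        Real.norm_of_nonneg (by positivity)]
      exact mul_le_of_le_one_right (by positivity) (inv_le_one_of_one_le₀ (by nlinarith))
    · have hi : IntegrableOn (fun ξ : ℝ => cH H * ξ ^ (-1 - 2 * (H : ℝ))) (Ioi 1) :=
        (integrableOn_Ioi_rpow_of_lt (by linarith) one_pos).const_mul _
      refine hi.mono' hm.aestronglyMeasurable ?_
      filter_upwards [ae_restrict_mem measurableSet_Ioi] with ξ hξ
      have hξ0 : 0 < ξ := lt_trans one_pos hξ
      rw [abs_of_pos hξ0, ENNReal.toReal_ofReal (by positivity), smul_eq_mul,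
        Real.norm_of_nonneg (by positivity)]
      have : ξ ^ (-1 - 2 * (H : ℝ)) = ξ ^ (1 - 2 * (H : ℝ)) * (ξ ^ 2)⁻¹ := by
        rw [← Real.rpow_natCast, ← Real.rpow_neg hξ0.le, ← Real.rpow_add hξ0]
        congr 1; push_cast; ring
      rw [this, ← mul_assoc]
      refine mul_le_mul_of_nonneg_left ?_ (by positivity)
      exact inv_anti₀ (by positivity) (by linarith)
  have hneg : IntegrableOn (fun ξ : ℝ => (ENNReal.ofReal (cH H * |ξ| ^ (1 - 2 * (H : ℝ)))).toReal •
      (1 + ξ ^ 2)⁻¹) (Iio 0) := by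
    have := (Measure.measurePreserving_neg (volume : Measure ℝ)).integrableOn_comp_preimage
      (MeasurableEquiv.neg ℝ).measurableEmbedding
      (f := fun ξ : ℝ => (ENNReal.ofReal (cH H * |ξ| ^ (1 - 2 * (H : ℝ)))).toReal •
        (1 + ξ ^ 2)⁻¹) (s := Ioi 0)
    have h2 := this.2 hpos
    simpa [Function.comp_def] using h2
  have : IntegrableOn (fun ξ : ℝ => (ENNReal.ofReal (cH H * |ξ| ^ (1 - 2 * (H : ℝ)))).toReal •
      (1 + ξ ^ 2)⁻¹) (Iio 0 ∪ Ici 0) :=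
    hneg.union ((integrableOn_Ici_iff_integrableOn_Ioi).2 hpos)
  rwa [Iio_union_Ici, integrableOn_univ] at this

/-- The spatial Fourier transform of a test function is square integrable for `dt μ_H(dξ)`. -/
theorem memLp_spaceFourier (H : Ioo (0 : ℝ) 1) {φ : ℝ × ℝ → ℝ} (h : φ ∈ testSubmodule) :
    MemLp (spaceFourier φ) 2 (nuH H) := by
  obtain ⟨hs, hc⟩ := h
  have hcont := continuous_spaceFourier hs.continuous hc
  refine (memLp_two_iff_integrable_sq_norm hcont.aestronglyMeasurable).2 ?_
  have hf' : Continuous (fun y => fderiv ℝ φ y (0, 1)) :=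
    (hs.continuous_fderiv (by simp)).clm_apply continuous_const
  have hc' : HasCompactSupport (fun y => fderiv ℝ φ y (0, 1)) :=
    (hc.fderiv ℝ).comp_left (g := fun L : ℝ × ℝ →L[ℝ] ℝ => L (0, 1)) (by simp)
  obtain ⟨A, hA⟩ := norm_spaceFourier_le hs.continuous hc
  obtain ⟨B, hB⟩ := norm_spaceFourier_le hf' hc'
  obtain ⟨R, hR⟩ := hc.isCompact.isBounded.subset_closedBall (0 : ℝ × ℝ)
  have hint : Integrable (fun z : ℝ × ℝ =>
      (Icc (-R) R).indicator (fun _ => A ^ 2 + B ^ 2) z.1 * (1 + z.2 ^ 2)⁻¹) (nuH H) := by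
    unfold nuH
    refine Integrable.mul_prod ?_ (integrable_muH_density H)
    refine Integrable.restrict ?_
    exact (integrable_indicator_iff measurableSet_Icc).2 (by simp)
  refine hint.mono' (by fun_prop) (Filter.Eventually.of_forall fun z => ?_)
  rw [Real.norm_of_nonneg (by positivity)]
  by_cases hz : z.1 ∈ Icc (-R) R
  · rw [indicator_of_mem hz, ← div_eq_mul_inv, le_div_iff₀ (by positivity)]
    have h1 := hA z
    have h2 := hB z
    rw [spaceFourier_deriv hs hc] at h2
    simp only [norm_mul, Complex.norm_I, one_mul, Complex.norm_real, Real.norm_eq_abs] at h2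
    have h3 : ‖spaceFourier φ z‖ ^ 2 ≤ A ^ 2 := pow_le_pow_left₀ (norm_nonneg _) h1 2
    have h4 : (|z.2| * ‖spaceFourier φ z‖) ^ 2 ≤ B ^ 2 := pow_le_pow_left₀ (by positivity) h2 2
    rw [mul_pow, sq_abs] at h4
    nlinarith
  · rw [indicator_of_notMem hz, zero_mul]
    have : spaceFourier φ z = 0 := by
      unfold spaceFourier
      refine integral_eq_zero_of_ae (Filter.Eventually.of_forall fun x => ?_)
      have : (z.1, x) ∉ tsupport φ := by
        intro h'
        have := hR h'
        rw [mem_closedBall_zero_iff] at this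
        exact hz (abs_le.1 ((norm_fst_le (z.1, x)).trans this))
      simp [image_eq_zero_of_notMem_tsupport this]
    simp [this]

theorem integrable_spaceFourier_integrand {φ : ℝ × ℝ → ℝ} (h : φ ∈ testSubmodule) (z : ℝ × ℝ) :
    Integrable (fun x : ℝ =>
      Complex.exp (-(Complex.I * (z.2 : ℂ) * (x : ℂ))) * (φ (z.1, x) : ℂ)) := by
  have hemb : Topology.IsClosedEmbedding (fun x : ℝ => (z.1, x)) :=
    Topology.IsClosedEmbedding.of_continuous_injective_isClosedMap (by fun_prop)
      (fun a b hab => by simpa using hab) (isClosedMap_prodMk_left z.1)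
  have hc1 : HasCompactSupport (fun x : ℝ => ((φ (z.1, x) : ℝ) : ℂ)) :=
    (h.2.comp_isClosedEmbedding hemb).comp_left (g := fun r : ℝ => (r : ℂ)) (by simp)
  have := h.1.continuous
  exact Continuous.integrable_of_hasCompactSupport (by fun_prop) hc1.mul_left

/-- The space `C_0^∞(ℝ₊ × ℝ)`, carrying (below) the semi-inner product `⟨·,·⟩_H`. -/
def TestFunction (_H : Ioo (0 : ℝ) 1) : Type := testSubmodule

instance (H : Ioo (0 : ℝ) 1) : AddCommGroup (TestFunction H) :=
  inferInstanceAs (AddCommGroup testSubmodule)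

instance (H : Ioo (0 : ℝ) 1) : Module ℝ (TestFunction H) :=
  inferInstanceAs (Module ℝ testSubmodule)

/-- The underlying function of a test function. -/
def TestFunction.fn {H : Ioo (0 : ℝ) 1} (φ : TestFunction H) : ℝ × ℝ → ℝ := φ.1

theorem TestFunction.mem {H : Ioo (0 : ℝ) 1} (φ : TestFunction H) : φ.fn ∈ testSubmodule := φ.2

/-- The spatial Fourier transform as a linear map from test functions to `L²(dt μ_H(dξ); ℂ)`. -/
def testFourier (H : Ioo (0 : ℝ) 1) : TestFunction H →ₗ[ℝ] Lp ℂ 2 (nuH H) where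
  toFun φ := (memLp_spaceFourier H φ.mem).toLp (spaceFourier φ.fn)
  map_add' φ ψ := by
    rw [← MemLp.toLp_add]
    refine MemLp.toLp_congr _ _ (Filter.Eventually.of_forall fun z => ?_)
    simp only [spaceFourier, Pi.add_apply]
    rw [← integral_add (integrable_spaceFourier_integrand φ.mem z)
      (integrable_spaceFourier_integrand ψ.mem z)]
    congr 1; funext x
    have : (φ + ψ).fn (z.1, x) = φ.fn (z.1, x) + ψ.fn (z.1, x) := rfl
    rw [this]; push_cast; ring
  map_smul' c φ := by
    rw [RingHom.id_apply, ← MemLp.toLp_const_smul]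
    refine MemLp.toLp_congr _ _ (Filter.Eventually.of_forall fun z => ?_)
    simp only [spaceFourier, Pi.smul_apply, Complex.real_smul]
    rw [← integral_const_mul]
    congr 1; funext x
    have : (c • φ).fn (z.1, x) = c * φ.fn (z.1, x) := rfl
    rw [this]; push_cast; ring

/-! ### The Hilbert space `ℋ_H` -/

/-- The real inner product `Re ⟨·,·⟩` on a complex `L²` space. -/
abbrev realInnerLp {α : Type*} [MeasurableSpace α] (m : Measure α) :
    InnerProductSpace ℝ (Lp ℂ 2 m) := InnerProductSpace.rclikeToReal ℂ (Lp ℂ 2 m)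

instance (H : Ioo (0 : ℝ) 1) : SeminormedAddCommGroup (TestFunction H) :=
  SeminormedAddCommGroup.induced (TestFunction H) (Lp ℂ 2 (nuH H)) (testFourier H)

instance (H : Ioo (0 : ℝ) 1) : InnerProductSpace ℝ (TestFunction H) :=
  letI := realInnerLp (nuH H)
  InnerProductSpace.induced (testFourier H)

/-- The Hilbert space `ℋ_H`: the completion of `C_0^∞(ℝ₊ × ℝ)` for `⟨·,·⟩_H`. -/
abbrev HilbertH (H : Ioo (0 : ℝ) 1) : Type := UniformSpace.Completion (TestFunction H)

/-- The spatial Fourier transform on `ℋ_H`: the extension of `φ ↦ 𝓕 φ(t,·)(ξ)` by continuity. -/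
def fourierH (H : Ioo (0 : ℝ) 1) : HilbertH H →L[ℝ] Lp ℂ 2 (nuH H) :=
  ContinuousLinearMap.extend
    ((testFourier H).mkContinuous 1 (fun φ => by rw [one_mul]; exact le_of_eq rfl))
    (UniformSpace.Completion.toComplL (𝕜 := ℝ) (E := TestFunction H))

theorem isUniformInducing_toComplL (H : Ioo (0 : ℝ) 1) :
    IsUniformInducing (UniformSpace.Completion.toComplL (𝕜 := ℝ) (E := TestFunction H)) :=
  UniformSpace.Completion.isUniformInducing_coe _

theorem fourierH_coe (H : Ioo (0 : ℝ) 1) (φ : TestFunction H) :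
    fourierH H (φ : HilbertH H) = testFourier H φ :=
  ContinuousLinearMap.extend_eq _ UniformSpace.Completion.denseRange_coe
    (UniformSpace.Completion.isUniformInducing_coe _) φ

/-- The inner product of `ℋ_H` on test functions is
`⟨φ, ψ⟩_H = ∫ 𝓕φ(t,·)(ξ) conj(𝓕ψ(t,·)(ξ)) μ_H(dξ) dt`. -/
theorem inner_eq_re (H : Ioo (0 : ℝ) 1) (φ ψ : TestFunction H) :
    inner ℝ (φ : HilbertH H) (ψ : HilbertH H) =
      (∫ z, spaceFourier φ.fn z * (starRingEnd ℂ) (spaceFourier ψ.fn z) ∂(nuH H)).re := by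
  rw [UniformSpace.Completion.inner_coe, real_inner_comm]
  change (inner ℂ (testFourier H ψ) (testFourier H φ)).re = _
  rw [L2.inner_def]
  congr 1
  refine integral_congr_ae ?_
  filter_upwards [(memLp_spaceFourier H φ.mem).coeFn_toLp,
    (memLp_spaceFourier H ψ.mem).coeFn_toLp] with z h1 h2
  have h1' : (testFourier H φ : ℝ × ℝ → ℂ) z = spaceFourier φ.fn z := h1
  have h2' : (testFourier H ψ : ℝ × ℝ → ℂ) z = spaceFourier ψ.fn z := h2
  rw [h1', h2']
  rfl

theorem measurePreserving_reflect (H : Ioo (0 : ℝ) 1) :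
    MeasurePreserving (Prod.map id Neg.neg : ℝ × ℝ → ℝ × ℝ) (nuH H) (nuH H) := by
  unfold nuH
  refine (MeasurePreserving.id _).prod ⟨measurable_neg, ?_⟩
  ext s hs
  rw [Measure.map_apply measurable_neg hs]
  unfold muH
  rw [withDensity_apply _ (measurable_neg hs), withDensity_apply _ hs,
    ← (Measure.measurePreserving_neg (volume : Measure ℝ)).setLIntegral_comp_preimage hs
      (by fun_prop)]
  simp

/-- The complex `L²` inner product of Fourier transforms of elements of `ℋ_H` is real, and it is
the inner product of `ℋ_H`. -/
theorem inner_fourierH (H : Ioo (0 : ℝ) 1) (x y : HilbertH H) :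
    inner ℂ (fourierH H x) (fourierH H y) = ((inner ℝ x y : ℝ) : ℂ) := by
  induction x, y using UniformSpace.Completion.induction_on₂ with
  | hp =>
    refine isClosed_eq ?_ ?_
    · exact ((fourierH H).continuous.comp continuous_fst).inner
        ((fourierH H).continuous.comp continuous_snd)
    · exact Complex.continuous_ofReal.comp (continuous_fst.inner continuous_snd)
  | ih φ ψ =>
    rw [UniformSpace.Completion.inner_coe, fourierH_coe, fourierH_coe]
    change _ = (((inner ℂ (testFourier H φ) (testFourier H ψ)).re : ℝ) : ℂ)
    have hI : inner ℂ (testFourier H φ) (testFourier H ψ) =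
        ∫ z, (starRingEnd ℂ) (spaceFourier φ.fn z) * spaceFourier ψ.fn z ∂(nuH H) := by
      rw [L2.inner_def]
      refine integral_congr_ae ?_
      filter_upwards [(memLp_spaceFourier H φ.mem).coeFn_toLp,
        (memLp_spaceFourier H ψ.mem).coeFn_toLp] with z h1 h2
      have h1' : (testFourier H φ : ℝ × ℝ → ℂ) z = spaceFourier φ.fn z := h1
      have h2' : (testFourier H ψ : ℝ × ℝ → ℂ) z = spaceFourier ψ.fn z := h2
      rw [h1', h2', RCLike.inner_apply, mul_comm]
    have hconj : ∀ (f : ℝ × ℝ → ℝ) (z : ℝ × ℝ),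
        spaceFourier f (Prod.map id Neg.neg z) = (starRingEnd ℂ) (spaceFourier f z) := by
      intro f z
      unfold spaceFourier
      rw [← integral_conj]
      congr 1; funext x
      simp [← Complex.exp_conj]
    rw [eq_comm, ← Complex.conj_eq_iff_re, hI, ← integral_conj]
    rw [← (measurePreserving_reflect H).integral_comp
      ((MeasurableEquiv.refl ℝ).prodCongr (MeasurableEquiv.neg ℝ)).measurableEmbedding]
    simp_rw [hconj]
    simp

theorem norm_fourierH (H : Ioo (0 : ℝ) 1) (x : HilbertH H) : ‖fourierH H x‖ = ‖x‖ := by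
  have h := inner_fourierH H x x
  rw [inner_self_eq_norm_sq_to_K, real_inner_self_eq_norm_sq] at h
  have h' : ‖fourierH H x‖ ^ 2 = ‖x‖ ^ 2 := Complex.ofReal_injective (by push_cast; simpa using h)
  exact (pow_left_inj₀ (norm_nonneg _) (norm_nonneg _) two_ne_zero).1 h'

/-! ### The Hilbert tensor power `ℋ_H^{⊗n}` -/

theorem memLp_prod (H : Ioo (0 : ℝ) 1) (n : ℕ) (g : Fin n → Lp ℂ 2 (nuH H)) :
    MemLp (fun z : Fin n → ℝ × ℝ => ∏ i, g i (z i)) 2 (Measure.pi fun _ => nuH H) := by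
  have hm : AEStronglyMeasurable (fun z : Fin n → ℝ × ℝ => ∏ i, g i (z i))
      (Measure.pi fun _ => nuH H) :=
    Finset.aestronglyMeasurable_fun_prod _ fun i _ =>
      (Lp.aestronglyMeasurable (g i)).comp_quasiMeasurePreserving
        (Measure.quasiMeasurePreserving_eval _ i)
  refine (memLp_two_iff_integrable_sq_norm hm).2 ?_
  simp_rw [norm_prod, ← Finset.prod_pow]
  exact Integrable.fintype_prod (f := fun i z => ‖g i z‖ ^ 2)
    (fun i => (memLp_two_iff_integrable_sq_norm (Lp.aestronglyMeasurable (g i))).1 (Lp.memLp (g i)))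

theorem eval_ae (H : Ioo (0 : ℝ) 1) (n : ℕ) (i : Fin n) {p : ℝ × ℝ → Prop}
    (h : ∀ᵐ z ∂(nuH H), p z) : ∀ᵐ z ∂(Measure.pi fun _ : Fin n => nuH H), p (z i) :=
  (Measure.quasiMeasurePreserving_eval (fun _ : Fin n => nuH H) i).ae h

/-- The map `(g_1,…,g_n) ↦ g_1(z_1)⋯g_n(z_n)` from `L²(dt μ_H)^n` to `L²((dt μ_H)^n)`. -/
def tensorL2 (H : Ioo (0 : ℝ) 1) (n : ℕ) :
    MultilinearMap ℝ (fun _ : Fin n => Lp ℂ 2 (nuH H))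
      (Lp ℂ 2 (Measure.pi fun _ : Fin n => nuH H)) where
  toFun g := (memLp_prod H n g).toLp _
  map_update_add' g i x y := by
    rw [← MemLp.toLp_add]
    refine MemLp.toLp_congr _ _ ?_
    filter_upwards [eval_ae H n i (Lp.coeFn_add x y)] with z hz
    simp only [Pi.add_apply]
    rw [← Finset.mul_prod_erase _ _ (Finset.mem_univ i),
      ← Finset.mul_prod_erase _ _ (Finset.mem_univ i),
      ← Finset.mul_prod_erase _ _ (Finset.mem_univ i)]
    simp only [Function.update_self]
    rw [hz, Pi.add_apply, add_mul]
    congr 1 <;> congr 1 <;> refine Finset.prod_congr rfl fun j hj => ?_ <;>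
      simp [Function.update_of_ne (Finset.ne_of_mem_erase hj)]
  map_update_smul' g i c x := by
    rw [← MemLp.toLp_const_smul]
    refine MemLp.toLp_congr _ _ ?_
    filter_upwards [eval_ae H n i (Lp.coeFn_smul c x)] with z hz
    simp only [Pi.smul_apply]
    rw [← Finset.mul_prod_erase _ _ (Finset.mem_univ i),
      ← Finset.mul_prod_erase _ _ (Finset.mem_univ i)]
    simp only [Function.update_self]
    rw [hz, Pi.smul_apply, smul_mul_assoc]
    congr 2; refine Finset.prod_congr rfl fun j hj => ?_
    simp [Function.update_of_ne (Finset.ne_of_mem_erase hj)]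

/-- The algebraic tensor power of `ℋ_H`, carrying (below) its Hilbert space tensor product inner
product. -/
def AlgTensorH (H : Ioo (0 : ℝ) 1) (n : ℕ) : Type :=
  PiTensorProduct ℝ (fun _ : Fin n => HilbertH H)

instance (H : Ioo (0 : ℝ) 1) (n : ℕ) : AddCommGroup (AlgTensorH H n) :=
  inferInstanceAs (AddCommGroup (PiTensorProduct ℝ (fun _ : Fin n => HilbertH H)))

instance (H : Ioo (0 : ℝ) 1) (n : ℕ) : Module ℝ (AlgTensorH H n) :=
  inferInstanceAs (Module ℝ (PiTensorProduct ℝ (fun _ : Fin n => HilbertH H)))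

/-- The algebraic elementary tensor `x_1 ⊗ ⋯ ⊗ x_n`. -/
def algTensor {H : Ioo (0 : ℝ) 1} {n : ℕ} (x : Fin n → HilbertH H) : AlgTensorH H n :=
  PiTensorProduct.tprod ℝ x

/-- The spatial Fourier transform on the algebraic tensor power: the linear map with
`𝓕(x_1 ⊗ ⋯ ⊗ x_n) = 𝓕x_1(z_1)⋯𝓕x_n(z_n)`, `z_i = (t_i, ξ_i)`. -/
def algFourier (H : Ioo (0 : ℝ) 1) (n : ℕ) :
    AlgTensorH H n →ₗ[ℝ] Lp ℂ 2 (Measure.pi fun _ : Fin n => nuH H) :=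
  PiTensorProduct.lift
    ((tensorL2 H n).compLinearMap (fun _ => (fourierH H : HilbertH H →ₗ[ℝ] Lp ℂ 2 (nuH H))))

instance (H : Ioo (0 : ℝ) 1) (n : ℕ) : SeminormedAddCommGroup (AlgTensorH H n) :=
  SeminormedAddCommGroup.induced (AlgTensorH H n)
    (Lp ℂ 2 (Measure.pi fun _ : Fin n => nuH H)) (algFourier H n)

/-- The inner product of the algebraic tensor power; it is the standard one, with
`⟨x_1 ⊗ ⋯ ⊗ x_n, y_1 ⊗ ⋯ ⊗ y_n⟩ = ∏ ⟨x_i, y_i⟩_H`, by `inner_tensorH` below. -/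
instance (H : Ioo (0 : ℝ) 1) (n : ℕ) : InnerProductSpace ℝ (AlgTensorH H n) :=
  letI := realInnerLp (Measure.pi fun _ : Fin n => nuH H)
  InnerProductSpace.induced (algFourier H n)

/-- The Hilbert tensor power `ℋ_H^{⊗n}`. -/
abbrev TensorH (H : Ioo (0 : ℝ) 1) (n : ℕ) : Type := UniformSpace.Completion (AlgTensorH H n)

/-- The elementary tensor `x_1 ⊗ ⋯ ⊗ x_n` in `ℋ_H^{⊗n}`. -/
def tensorH {H : Ioo (0 : ℝ) 1} {n : ℕ} (x : Fin n → HilbertH H) : TensorH H n :=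
  ((algTensor x : AlgTensorH H n) : UniformSpace.Completion (AlgTensorH H n))

theorem inner_tensorH {H : Ioo (0 : ℝ) 1} {n : ℕ} (x y : Fin n → HilbertH H) :
    inner ℝ (tensorH x) (tensorH y) = ∏ i, inner ℝ (x i) (y i) := by
  unfold tensorH
  rw [UniformSpace.Completion.inner_coe]
  change (inner ℂ (algFourier H n (algTensor x)) (algFourier H n (algTensor y))).re = _
  have hx : ∀ x : Fin n → HilbertH H, algFourier H n (algTensor x) =
      (memLp_prod H n (fun i => fourierH H (x i))).toLp _ := fun x =>
    PiTensorProduct.lift.tprod (R := ℝ) x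
  rw [hx, hx, L2.inner_def]
  have : ∫ z, inner ℂ ((memLp_prod H n (fun i => fourierH H (x i))).toLp _ z)
        ((memLp_prod H n (fun i => fourierH H (y i))).toLp _ z)
        ∂(Measure.pi fun _ : Fin n => nuH H) =
      ∫ z, ∏ i, inner ℂ (fourierH H (x i) (z i)) (fourierH H (y i) (z i))
        ∂(Measure.pi fun _ : Fin n => nuH H) := by
    refine integral_congr_ae ?_
    filter_upwards [(memLp_prod H n (fun i => fourierH H (x i))).coeFn_toLp,
      (memLp_prod H n (fun i => fourierH H (y i))).coeFn_toLp] with z h1 h2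
    rw [h1, h2]
    simp only [RCLike.inner_apply, map_prod, Finset.prod_mul_distrib]
  rw [this, integral_fintype_prod_eq_prod (𝕜 := ℂ)
    (fun i (z : ℝ × ℝ) => inner ℂ (fourierH H (x i) z) (fourierH H (y i) z))]
  have h2 : ∀ i, ∫ z, inner ℂ (fourierH H (x i) z) (fourierH H (y i) z) ∂(nuH H) =
      ((inner ℝ (x i) (y i) : ℝ) : ℂ) := fun i => by
    rw [← inner_fourierH, L2.inner_def]
  simp_rw [h2]
  rw [← Complex.ofReal_prod, Complex.ofReal_re]

/-- The spatial Fourier transform `f ↦ 𝓕[f(t_1,·,…,t_n,·)](ξ_1,…,ξ_n)` on `ℋ_H^{⊗n}`, extended by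
continuity from the algebraic tensor power. -/
def fourierTensor (H : Ioo (0 : ℝ) 1) (n : ℕ) :
    TensorH H n →L[ℝ] Lp ℂ 2 (Measure.pi fun _ : Fin n => nuH H) :=
  ContinuousLinearMap.extend
    ((algFourier H n).mkContinuous 1 (fun φ => by rw [one_mul]; exact le_of_eq rfl))
    (UniformSpace.Completion.toComplL (𝕜 := ℝ) (E := AlgTensorH H n))

theorem fourierTensor_tensorH {H : Ioo (0 : ℝ) 1} {n : ℕ} (x : Fin n → HilbertH H) :
    fourierTensor H n (tensorH x) =ᵐ[Measure.pi fun _ : Fin n => nuH H]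
      fun z => ∏ i, fourierH H (x i) (z i) := by
  have h : fourierTensor H n (tensorH x) = algFourier H n (algTensor x) :=
    ContinuousLinearMap.extend_eq _ UniformSpace.Completion.denseRange_coe
      (UniformSpace.Completion.isUniformInducing_coe _) (algTensor x)
  have h2 : algFourier H n (algTensor x) =
      (memLp_prod H n (fun i => fourierH H (x i))).toLp _ :=
    PiTensorProduct.lift.tprod (R := ℝ) x
  rw [h, h2]
  exact MemLp.coeFn_toLp _

/-- The kernel
`f̂(t_1,ξ_1,…,t_n,ξ_n) = c_H^{n/2} 𝓕[f(t_1,·,…,t_n,·)](ξ_1,…,ξ_n) |ξ_1|^{1/2-H}⋯|ξ_n|^{1/2-H}`. -/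
def hatKernel {H : Ioo (0 : ℝ) 1} {n : ℕ} (f : TensorH H n) (z : Fin n → ℝ × ℝ) : ℂ :=
  ((cH H ^ ((n : ℝ) / 2) : ℝ) : ℂ) * fourierTensor H n f z *
    ∏ i, ((|(z i).2| ^ (1 / 2 - (H : ℝ)) : ℝ) : ℂ)

/-! ### Gaussian objects -/

/-- The bounded Borel subsets of `ℝ₊ × ℝ`. -/
def BoundedBorel : Type :=
  {A : Set (ℝ × ℝ) // MeasurableSet A ∧ Bornology.IsBounded A ∧ A ⊆ Ici (0 : ℝ) ×ˢ univ}

/-- The reflection `{(t, -x) : (t, x) ∈ A}` of a set in the space variable. -/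
def reflectSet (A : Set (ℝ × ℝ)) : Set (ℝ × ℝ) := {z | (z.1, -z.2) ∈ A}

/-- The complex Gaussian white (spectral) measure `W̃ = W̃₁ + i W̃₂` on `ℝ₊ × ℝ`, with control
measure `dt dx` and Hermitian symmetry in the space variable: `W̃₁` and `W̃₂` are independent centered
real Gaussian families with `E[W̃₁(A) W̃₁(B)] = (|A ∩ B| + |A ∩ B⁻|)/2` and
`E[W̃₂(A) W̃₂(B)] = (|A ∩ B| - |A ∩ B⁻|)/2`, where `B⁻ = {(t,-x) : (t,x) ∈ B}`. -/
structure IsComplexGaussianMeasure {Ω : Type*} [MeasurableSpace Ω] (P : Measure Ω)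
    (Wt : BoundedBorel → Ω → ℂ) : Prop where
  measurable : ∀ A, Measurable (Wt A)
  gaussian_re : IsGaussianProcess (fun A ω => (Wt A ω).re) P
  gaussian_im : IsGaussianProcess (fun A ω => (Wt A ω).im) P
  indep : IndepFun (fun ω A => (Wt A ω).re) (fun ω A => (Wt A ω).im) P
  mean_re : ∀ A, ∫ ω, (Wt A ω).re ∂P = 0
  mean_im : ∀ A, ∫ ω, (Wt A ω).im ∂P = 0
  cov_re : ∀ A B, ∫ ω, (Wt A ω).re * (Wt B ω).re ∂P =
    (volume.real (A.1 ∩ B.1) + volume.real (A.1 ∩ reflectSet B.1)) / 2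
  cov_im : ∀ A B, ∫ ω, (Wt A ω).im * (Wt B ω).im ∂P =
    (volume.real (A.1 ∩ B.1) - volume.real (A.1 ∩ reflectSet B.1)) / 2

/-- Pairs `(1_{A_1 × ⋯ × A_n}, W̃(A_1)⋯W̃(A_n))`, for bounded Borel sets with `A_i` disjoint from
`A_j` and from the reflection of `A_j` whenever `i ≠ j`. -/
def spectralGenerators {Ω : Type*} [MeasurableSpace Ω] (P : Measure Ω)
    (Wt : BoundedBorel → Ω → ℂ) (n : ℕ) :
    Set (Lp ℂ 2 (Measure.pi fun _ : Fin n => lebHalf) × Lp ℂ 2 P) :=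
  {p | ∃ A : Fin n → BoundedBorel,
    (∀ i j, i ≠ j → Disjoint (A i).1 (A j).1 ∧ Disjoint (A i).1 (reflectSet (A j).1)) ∧
    p.1 =ᵐ[Measure.pi fun _ : Fin n => lebHalf]
      (univ.pi fun i => (A i).1).indicator (fun _ => (1 : ℂ)) ∧
    p.2 =ᵐ[P] fun ω => ∏ i, Wt (A i) ω}

/-- `Y = Ĩ_n(g)`: the `n`-th order multiple Wiener integral with respect to `W̃` of the (square
integrable) kernel `g`. It is given by `Ĩ_n(1_{A_1 × ⋯ × A_n}) = W̃(A_1)⋯W̃(A_n)` on off-diagonal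
rectangles, and extended by complex linearity and then by continuity, from `L²((ℝ₊ × ℝ)^n; ℂ)` to
`L²(Ω; ℂ)`; that is, `(g, Y)` lies in the closure of the linear span of the generating pairs. -/
def IsSpectralIntegral {Ω : Type*} [MeasurableSpace Ω] (P : Measure Ω)
    (Wt : BoundedBorel → Ω → ℂ) (n : ℕ) (g : (Fin n → ℝ × ℝ) → ℂ) (Y : Lp ℂ 2 P) : Prop :=
  ∃ hg : MemLp g 2 (Measure.pi fun _ : Fin n => lebHalf),
    (hg.toLp g, Y) ∈ (Submodule.span ℂ (spectralGenerators P Wt n)).topologicalClosure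

/-- `W` is an isonormal Gaussian process on `ℋ_H`. -/
structure IsIsonormal {Ω : Type*} [MeasurableSpace Ω] (P : Measure Ω) {H : Ioo (0 : ℝ) 1}
    (W : HilbertH H → Ω → ℝ) : Prop where
  gaussian : IsGaussianProcess W P
  mean : ∀ φ, ∫ ω, W φ ω ∂P = 0
  cov : ∀ φ ψ, ∫ ω, W φ ω * W ψ ω ∂P = inner ℝ φ ψ

/-- The Fourier transform `𝓕[1_{[0,x]}](ξ) = ∫_0^x e^{-iξy} dy` of the (oriented) indicator function
of `[0,x]`, i.e. of `-1_{[x,0]}` if `x < 0`. -/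
def fourierInterval (x ξ : ℝ) : ℂ :=
  ∫ y in (0 : ℝ)..x, Complex.exp (-(Complex.I * (ξ : ℂ) * (y : ℂ)))

/-- `h ∈ ℋ_H` is the (oriented) indicator function `1_{[0,t] × [0,x]}`. -/
def IsRectangle {H : Ioo (0 : ℝ) 1} (t x : ℝ) (h : HilbertH H) : Prop :=
  fourierH H h =ᵐ[nuH H] fun z => (Icc 0 t).indicator (fun _ => fourierInterval x z.2) z.1

/-- `W` is represented on rectangles through the spectral measure `W̃`:
`W(1_{[0,t]×[0,x]}) = √c_H ∫_0^t ∫_ℝ 𝓕[1_{[0,x]}](ξ) |ξ|^{1/2-H} W̃(ds,dξ)` a.s. -/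
def IsSpectrallyRepresented {Ω : Type*} [MeasurableSpace Ω] (P : Measure Ω) {H : Ioo (0 : ℝ) 1}
    (Wt : BoundedBorel → Ω → ℂ) (W : HilbertH H → Ω → ℝ) : Prop :=
  ∀ (t x : ℝ), 0 ≤ t → ∀ h : HilbertH H, IsRectangle t x h →
    ∀ Y : Lp ℂ 2 P,
      IsSpectralIntegral P Wt 1 (fun z => (Icc 0 t).indicator
        (fun _ => ((Real.sqrt (cH H) : ℝ) : ℂ) * fourierInterval x (z 0).2 *
          ((|(z 0).2| ^ (1 / 2 - (H : ℝ)) : ℝ) : ℂ)) (z 0).1) Y →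
      ∀ᵐ ω ∂P, ((W h ω : ℝ) : ℂ) = Y ω

open Classical in
/-- Pairs `(e_{i_1} ⊗ ⋯ ⊗ e_{i_n}, P_{k_1}(W(e_{j_1}))⋯P_{k_m}(W(e_{j_m})))`, where `j_1,…,j_m` are the
distinct values of `i`, `k_l` is the multiplicity of `j_l`, and `P_k` is the `k`-th Hermite polynomial
with leading coefficient one. -/
def wienerGenerators {Ω : Type*} [MeasurableSpace Ω] (P : Measure Ω) {H : Ioo (0 : ℝ) 1}
    (W : HilbertH H → Ω → ℝ) {ι : Type*} (e : HilbertBasis ι ℝ (HilbertH H)) (n : ℕ) :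
    Set (TensorH H n × Lp ℝ 2 P) :=
  {p | ∃ i : Fin n → ι, p.1 = tensorH (fun l => e (i l)) ∧
    p.2 =ᵐ[P] fun ω => ∏ j ∈ Finset.univ.image i,
      Polynomial.aeval (W (e j) ω) (Polynomial.hermite (Finset.univ.filter fun l => i l = j).card)}

/-- `X = I_n^H(f)`: the `n`-th order multiple Wiener integral of `f ∈ ℋ_H^{⊗n}` with respect to `W`.
It is given by products of Hermite polynomials on tensor products of vectors of the orthonormal basis
`e` (the value does not depend on the order of the factors), and extended by linearity and then by
continuity from `ℋ_H^{⊗n}` to `L²(Ω)`; that is, `(f, X)` lies in the closure of the linear span of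
the generating pairs. -/
def IsWienerIntegral {Ω : Type*} [MeasurableSpace Ω] (P : Measure Ω) {H : Ioo (0 : ℝ) 1}
    (W : HilbertH H → Ω → ℝ) {ι : Type*} (e : HilbertBasis ι ℝ (HilbertH H)) (n : ℕ)
    (f : TensorH H n) (X : Lp ℝ 2 P) : Prop :=
  (f, X) ∈ (Submodule.span ℝ (wienerGenerators P W e n)).topologicalClosure

end SpectralWiener

end

/-!
Both multiple integrals are realised inside one Gaussian Hilbert space, and their coincidence is
read off from inner products.

*The common Gaussian space.* The closed real span in `L²(P)` of the real and imaginary parts of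
`W̃` consists of jointly Gaussian variables, since the form of the characteristic function of a
centred Gaussian variable survives limits in `L²` (`IsGaussianSpace.topologicalClosure`). On
polynomials in the elements of such a space, Gaussian integration by parts
(`IsGaussianSpace.expectation_X_mul`) says that multiplication by `X` and the derivation
`D_X` have the same expectation. Hence the Wick products, built by the creation operators
`p ↦ X p - D_X p`, satisfy `E[:y_1⋯y_n: :z_1⋯z_n:] = ∑_σ ∏_l E[y_l z_{σ(l)}]`
(`IsGaussianSpace.integral_gaussWick_mul_gaussWick`). A Wick product of variables with vanishing
mutual covariances is their ordinary product (`gaussWick_eq_prod`), and one of orthonormal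
variables is a product of Hermite polynomials (`wick_eq_prod_hermite`). So the generators of both
integrals are Wick products: `E[W̃(A_i) W̃(A_j)] = |A_i ∩ A_j⁻|` vanishes off the diagonal.

*First order.* The map `g ↦ Ĩ_1(g)` is an isometry, and `W(φ) = Ĩ_1(φ̂)` holds on rectangles by
hypothesis. It holds for every `φ ∈ ℋ_H` because rectangles belong to `ℋ_H`, by mollification
(`exists_isRectangle`), and are total in it, by writing a test function as a superposition of
rectangles weighted by its mixed second derivative (`topologicalClosure_span_rectangles`). In
particular each `W(φ)` belongs to the Gaussian space of `W̃`.

*Higher order.* Consider all pairs `(g_1 ⊗ ⋯ ⊗ g_n, :Ĩ_1(g_1)⋯Ĩ_1(g_n):)`. The covariance formula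
reads `⟨I(g), I(h)⟩ = ∑_σ ⟨g ∘ σ, h⟩` on them, and extends to their closed span
(`IsGaussianSpace.inner_of_mem_closure`); it gives `‖I(g)‖² ≤ n! ‖g‖²`, so this closed span is
the graph of a single-valued map. It contains the graph of `Ĩ_n` and, as `f ↦ f̂` is a continuous
linear map which sends `e_{i_1} ⊗ ⋯ ⊗ e_{i_n}` to `ê_{i_1} ⊗ ⋯ ⊗ ê_{i_n}`, also all pairs
`(f̂, I_n^H(f))`. This proves uniqueness and the equality. Existence follows from the bound and the
density of the two domains: the off-diagonal rectangles (`topologicalClosure_span_rectLp`) and the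
tensor products of basis vectors (`topologicalClosure_span_tensorH`).
-/

noncomputable section

namespace SpectralWiener

open MeasureTheory ProbabilityTheory Set

/-! ### Wick products in an algebra with annihilation operators -/

/-- Expansion of the permanent of a matrix along its first row. -/
theorem sum_perm_prod_succ {R : Type*} [CommSemiring R] {n : ℕ}
    (M : Fin (n + 1) → Fin (n + 1) → R) :
    ∑ σ : Equiv.Perm (Fin (n + 1)), ∏ l, M l (σ l) =
      ∑ p, M 0 p * ∑ τ : Equiv.Perm (Fin n), ∏ k : Fin n, M k.succ (p.succAbove (τ k)) := by
  let f : Fin (n + 1) × Equiv.Perm (Fin n) → Equiv.Perm (Fin (n + 1)) := fun x =>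
    (Equiv.Perm.decomposeFin.symm (0, x.2)).trans x.1.cycleRange.symm
  have h0 : ∀ x, f x 0 = x.1 := fun x => by simp [f]
  have hs : ∀ x k, f x (Fin.succ k) = x.1.succAbove (x.2 k) := fun x k => by simp [f]
  have hinj : Function.Injective f := by
    rintro ⟨p, τ⟩ ⟨p', τ'⟩ h
    have hp : p = p' := (h0 (p, τ)).symm.trans ((congrArg (fun g => g 0) h).trans (h0 (p', τ')))
    subst hp
    refine Prod.ext rfl (Equiv.ext fun k => Fin.succAbove_right_injective (p := p) ?_)
    exact (hs (p, τ) k).symm.trans ((congrArg (fun g => g k.succ) h).trans (hs (p, τ') k))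
  have hbij : Function.Bijective f := (Fintype.bijective_iff_injective_and_card f).2
    ⟨hinj, by simp [Fintype.card_perm, Nat.factorial_succ]⟩
  rw [← Fintype.sum_bijective f hbij (fun x => M 0 x.1 * ∏ k : Fin n, M k.succ
    (x.1.succAbove (x.2 k))) _ (fun x => by rw [Fin.prod_univ_succ, h0]; simp_rw [hs]),
    Fintype.sum_prod_type]
  simp_rw [Finset.mul_sum]

section Wick

variable {A V : Type*} [CommRing A] [Algebra ℂ A]

theorem derivation_prod_eq_zero {κ : Type*} (d : Derivation ℂ A A) (s : Finset κ) (f : κ → A)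
    (h : ∀ j ∈ s, d (f j) = 0) : d (∏ j ∈ s, f j) = 0 := by
  classical
  induction s using Finset.induction_on with
  | empty => simp
  | insert a s ha ih =>
    rw [Finset.prod_insert ha, Derivation.leibniz, h a (Finset.mem_insert_self a s),
      ih fun j hj => h j (Finset.mem_insert_of_mem hj), smul_zero, smul_zero, add_zero]

/-- The Wick product `:ℓ(y₀)⋯ℓ(y_{n-1}):`, obtained by applying to `1` the creation operators
`p ↦ ℓ(y) p - D_y p`, where `D_y` is the annihilation operator (a derivation) attached to `y`. -/
def wick (ℓ : V → A) (D : V → Derivation ℂ A A) : (n : ℕ) → (Fin n → V) → A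
  | 0, _ => 1
  | n + 1, y => ℓ (y 0) * wick ℓ D n (Fin.tail y) - D (y 0) (wick ℓ D n (Fin.tail y))

variable {ℓ : V → A} {D : V → Derivation ℂ A A} {b : V → V → ℂ}

/-- Annihilation operators act on a Wick product as on an ordinary product: this is the
canonical commutation relation. -/
theorem derivation_wick (hb : ∀ y z, D y (ℓ z) = algebraMap ℂ A (b y z))
    (hD : ∀ y z p, D y (D z p) = D z (D y p)) (z : V) :
    ∀ (n : ℕ) (y : Fin (n + 1) → V), D z (wick ℓ D (n + 1) y) =
      ∑ l, b z (y l) • wick ℓ D n (l.removeNth y)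
  | 0, y => by
    simp [wick, hb, Algebra.smul_def]
  | n + 1, y => by
    have ih := derivation_wick hb hD z n (Fin.tail y)
    rw [wick, map_sub, Derivation.leibniz, hD, ih, hb, Fin.sum_univ_succ (n := n + 1)]
    have key : ∀ l : Fin (n + 1), wick ℓ D (n + 1) (l.succ.removeNth y) =
        ℓ (y 0) * wick ℓ D n (l.removeNth (Fin.tail y)) -
          D (y 0) (wick ℓ D n (l.removeNth (Fin.tail y))) := by
      intro l
      rw [wick]
      have h1 : l.succ.removeNth y 0 = y 0 := by
        change y (l.succ.succAbove 0) = y 0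
        rw [Fin.succ_succAbove_zero]
      have h2 : Fin.tail (l.succ.removeNth y) = l.removeNth (Fin.tail y) := by
        funext k
        change y (l.succ.succAbove k.succ) = y (l.succAbove k).succ
        rw [Fin.succ_succAbove_succ]
      rw [h1, h2]
    simp_rw [key]
    rw [map_sum, smul_eq_mul, smul_eq_mul, Finset.mul_sum]
    have h0 : (0 : Fin (n + 2)).removeNth y = Fin.tail y := by
      funext k
      change y (Fin.succAbove 0 k) = y k.succ
      rw [Fin.succAbove_zero]
    rw [h0]
    have hlhs : ∀ l : Fin (n + 1), D (y 0) (b z (Fin.tail y l) • wick ℓ D n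
        (l.removeNth (Fin.tail y))) = b z (y l.succ) • D (y 0) (wick ℓ D n
        (l.removeNth (Fin.tail y))) := fun l => Derivation.map_smul _ _ _
    simp_rw [hlhs, smul_sub, Finset.sum_sub_distrib, mul_smul_comm, Fin.tail]
    rw [Algebra.smul_def (b z (y 0))]
    ring

/-- The inner product formula for Wick products: it holds for every linear functional `E` obeying
the Gaussian integration by parts formula `E[ℓ(y) p] = E[D_y p]`. -/
theorem expectation_wick_mul_wick (hb : ∀ y z, D y (ℓ z) = algebraMap ℂ A (b y z))
    (hD : ∀ y z p, D y (D z p) = D z (D y p)) (E : A →ₗ[ℂ] ℂ) (h1 : E 1 = 1)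
    (hE : ∀ y p, E (ℓ y * p) = E (D y p)) :
    ∀ (n : ℕ) (y z : Fin n → V), E (wick ℓ D n y * wick ℓ D n z) =
      ∑ σ : Equiv.Perm (Fin n), ∏ l, b (y l) (z (σ l))
  | 0, y, z => by simp [wick, h1]
  | n + 1, y, z => by
    have h : E (wick ℓ D (n + 1) y * wick ℓ D (n + 1) z) =
        E (wick ℓ D n (Fin.tail y) * D (y 0) (wick ℓ D (n + 1) z)) := by
      rw [wick, sub_mul, map_sub, mul_assoc, hE, Derivation.leibniz, map_add, smul_eq_mul,
        smul_eq_mul, mul_comm (wick ℓ D (n + 1) z), add_sub_cancel_right]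
    rw [h, derivation_wick hb hD, Finset.mul_sum, map_sum,
      sum_perm_prod_succ (fun l k => b (y l) (z k))]
    refine Finset.sum_congr rfl fun p _ => ?_
    rw [mul_smul_comm, map_smul, expectation_wick_mul_wick hb hD E h1 hE n, smul_eq_mul]
    rfl

/-- The Wick product of mutually uncorrelated linear forms is their ordinary product. -/
theorem wick_eq_prod (hb : ∀ y z, D y (ℓ z) = algebraMap ℂ A (b y z)) :
    ∀ (n : ℕ) (y : Fin n → V), (∀ i j, i ≠ j → b (y i) (y j) = 0) →
      wick ℓ D n y = ∏ l, ℓ (y l)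
  | 0, y, _ => by simp [wick]
  | n + 1, y, h => by
    have ih := wick_eq_prod hb n (Fin.tail y) fun i j hij => h _ _ (by simpa using hij)
    have hz : D (y 0) (∏ l, ℓ (Fin.tail y l)) = 0 := by
      refine derivation_prod_eq_zero _ _ _ fun l _ => ?_
      rw [hb, show b (y 0) (Fin.tail y l) = 0 from h _ _ (Fin.succ_ne_zero l).symm]
      simp
    rw [wick, ih, hz, sub_zero, Fin.prod_univ_succ]
    rfl

end Wick

section Hermite

variable {A V ι : Type*} [CommRing A] [Algebra ℂ A]
  {ℓ : V → A} {D : V → Derivation ℂ A A} {b : V → V → ℂ}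

theorem derivation_aeval_int (d : Derivation ℂ A A) (q : Polynomial ℤ) (x : A) :
    d (Polynomial.aeval x q) = Polynomial.aeval x (Polynomial.derivative q) * d x := by
  have h := Derivation.leibniz_pow (d.restrictScalars ℤ) x
  induction q using Polynomial.induction_on' with
  | add p q hp hq => simp [hp, hq, add_mul]
  | monomial k c =>
    rw [Polynomial.derivative_monomial, Polynomial.aeval_monomial, Polynomial.aeval_monomial,
      Derivation.leibniz, Derivation.leibniz_pow]
    have : d (algebraMap ℤ A c) = 0 := by simp
    rw [this]
    simp
    ring

open Classical in
/-- The Wick product of orthonormal linear forms is a product of Hermite polynomials, of the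
multiplicities of the forms. -/
theorem wick_eq_prod_hermite (hb : ∀ y z, D y (ℓ z) = algebraMap ℂ A (b y z)) (w : ι → V)
    (hw : ∀ j j', b (w j) (w j') = if j = j' then 1 else 0) :
    ∀ (n : ℕ) (i : Fin n → ι), wick ℓ D n (fun l => w (i l)) =
      ∏ j ∈ Finset.univ.image i, Polynomial.aeval (ℓ (w j))
        (Polynomial.hermite (Finset.univ.filter fun l => i l = j).card)
  | 0, i => by simp [wick]
  | n + 1, i => by
    have ih := wick_eq_prod_hermite hb w hw n (Fin.tail i)
    -- Enlarging the product by indices of multiplicity zero does not change it.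
    have hext : ∏ j ∈ Finset.univ.image (Fin.tail i), Polynomial.aeval (ℓ (w j))
          (Polynomial.hermite (Finset.univ.filter fun l => Fin.tail i l = j).card) =
        ∏ j ∈ Finset.univ.image i, Polynomial.aeval (ℓ (w j))
          (Polynomial.hermite (Finset.univ.filter fun l => Fin.tail i l = j).card) := by
      refine Finset.prod_subset ?_ ?_
      · intro j hj
        obtain ⟨l, -, rfl⟩ := Finset.mem_image.1 hj
        exact Finset.mem_image.2 ⟨l.succ, Finset.mem_univ _, rfl⟩
      · intro j _ hj
        have : (Finset.univ.filter fun l => Fin.tail i l = j) = ∅ :=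
          Finset.filter_eq_empty_iff.2 fun l _ hl =>
            hj (Finset.mem_image.2 ⟨l, Finset.mem_univ _, hl⟩)
        simp [this]
    have h0 : i 0 ∈ Finset.univ.image i := Finset.mem_image_of_mem _ (Finset.mem_univ _)
    have hcount : ∀ j, (Finset.univ.filter fun l => i l = j).card =
        (if i 0 = j then 1 else 0) + (Finset.univ.filter fun l => Fin.tail i l = j).card := by
      intro j
      simp only [Finset.card_filter, Fin.sum_univ_succ]
      rfl
    have hrest : ∏ j ∈ (Finset.univ.image i).erase (i 0), Polynomial.aeval (ℓ (w j))
          (Polynomial.hermite (Finset.univ.filter fun l => i l = j).card) =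
        ∏ j ∈ (Finset.univ.image i).erase (i 0), Polynomial.aeval (ℓ (w j))
          (Polynomial.hermite (Finset.univ.filter fun l => Fin.tail i l = j).card) := by
      refine Finset.prod_congr rfl fun j hj => ?_
      rw [hcount, if_neg (Finset.ne_of_mem_erase hj).symm, zero_add]
    have hd : D (w (i 0)) (∏ j ∈ (Finset.univ.image i).erase (i 0), Polynomial.aeval (ℓ (w j))
          (Polynomial.hermite (Finset.univ.filter fun l => Fin.tail i l = j).card)) = 0 := by
      refine derivation_prod_eq_zero _ _ _ fun j hj => ?_
      rw [derivation_aeval_int, hb, hw, if_neg (Finset.ne_of_mem_erase hj).symm]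
      simp
    rw [wick]
    change ℓ (w (i 0)) * wick ℓ D n (fun l => w (Fin.tail i l)) -
      D (w (i 0)) (wick ℓ D n (fun l => w (Fin.tail i l))) = _
    rw [ih, hext, ← Finset.mul_prod_erase _ _ h0, ← Finset.mul_prod_erase _ _ h0, hrest,
      Derivation.leibniz, hd, hcount (i 0), if_pos rfl, add_comm 1, Polynomial.hermite_succ,
      derivation_aeval_int, hb, hw, if_pos rfl]
    simp
    ring

end Hermite

/-! ### Gaussian Hilbert spaces -/

section GaussianSpace

variable {Ω : Type*} [MeasurableSpace Ω] {P : Measure Ω}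

/-- Independent Gaussian processes are jointly Gaussian. -/
theorem isGaussianProcess_sumElim {S T : Type*} {X : S → Ω → ℝ} {Y : T → Ω → ℝ}
    (hX : IsGaussianProcess X P) (hY : IsGaussianProcess Y P)
    (h : IndepFun (fun ω s => X s ω) (fun ω t => Y t ω) P) :
    IsGaussianProcess (Sum.elim X Y) P where
  hasGaussianLaw I := by
    have hind : IndepFun (fun ω => I.toLeft.restrict (X · ω)) (fun ω => I.toRight.restrict (Y · ω))
        P := h.comp (Finset.measurable_restrict _) (Finset.measurable_restrict _)
    have hj := hind.hasGaussianLaw (hX.hasGaussianLaw I.toLeft) (hY.hasGaussianLaw I.toRight)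
    let L : (I.toLeft → ℝ) × (I.toRight → ℝ) →L[ℝ] (I → ℝ) := ContinuousLinearMap.pi fun i =>
      match i with
      | ⟨Sum.inl s, hs⟩ => (ContinuousLinearMap.proj ⟨s, Finset.mem_toLeft.2 hs⟩).comp
          (ContinuousLinearMap.fst ℝ _ _)
      | ⟨Sum.inr t, ht⟩ => (ContinuousLinearMap.proj ⟨t, Finset.mem_toRight.2 ht⟩).comp
          (ContinuousLinearMap.snd ℝ _ _)
    have hL : (fun ω => I.restrict (Sum.elim X Y · ω)) = fun ω =>
        L (I.toLeft.restrict (X · ω), I.toRight.restrict (Y · ω)) := by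
      funext ω i
      rcases i with ⟨s | t, hi⟩ <;> rfl
    rw [hL]
    exact hj.map_fun L

/-- A subspace of `L²(P)` is a (centred) Gaussian space if each of its elements is a centred
Gaussian variable; this is expressed through the characteristic functions. -/
def IsGaussianSpace (G : Submodule ℝ (Lp ℝ 2 P)) : Prop :=
  ∀ X ∈ G, ∫ ω, Complex.exp (Complex.I * (X ω : ℂ)) ∂P = Complex.exp (-((‖X‖ : ℂ) ^ 2 / 2))

theorem continuous_integral_cexp [IsProbabilityMeasure P] :
    Continuous fun X : Lp ℝ 2 P => ∫ ω, Complex.exp (Complex.I * (X ω : ℂ)) ∂P := by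
  have hint : ∀ X : Lp ℝ 2 P, Integrable (fun ω => Complex.exp (Complex.I * (X ω : ℂ))) P := by
    intro X
    refine Integrable.of_bound (C := 1) ?_ (Filter.Eventually.of_forall fun ω => ?_)
    · have := Lp.aestronglyMeasurable X
      exact Complex.continuous_exp.comp_aestronglyMeasurable
        ((Complex.continuous_ofReal.comp_aestronglyMeasurable this).const_mul _)
    · rw [mul_comm, Complex.norm_exp_ofReal_mul_I]
  refine (LipschitzWith.of_dist_le_mul (K := 1) fun X Y => ?_).continuous
  rw [NNReal.coe_one, one_mul, dist_eq_norm, dist_eq_norm, ← integral_sub (hint X) (hint Y)]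
  have hXY : Integrable (fun ω => ‖X ω - Y ω‖) P :=
    ((Lp.memLp X).integrable (by norm_num)).sub ((Lp.memLp Y).integrable (by norm_num)) |>.norm
  calc ‖∫ ω, Complex.exp (Complex.I * (X ω : ℂ)) - Complex.exp (Complex.I * (Y ω : ℂ)) ∂P‖
      ≤ ∫ ω, ‖X ω - Y ω‖ ∂P := by
        refine norm_integral_le_of_norm_le hXY (Filter.Eventually.of_forall fun ω => ?_)
        have h1 : Complex.exp (Complex.I * (X ω : ℂ)) - Complex.exp (Complex.I * (Y ω : ℂ)) =
            Complex.exp (Complex.I * (Y ω : ℂ)) *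
              (Complex.exp (Complex.I * ((X ω - Y ω : ℝ) : ℂ)) - 1) := by
          rw [mul_sub, ← Complex.exp_add]; push_cast; ring_nf
        rw [h1, norm_mul, mul_comm Complex.I, Complex.norm_exp_ofReal_mul_I, one_mul]
        exact Real.norm_exp_I_mul_ofReal_sub_one_le
    _ = (eLpNorm (X - Y : Lp ℝ 2 P) 1 P).toReal := by
        rw [eLpNorm_congr_ae (Lp.coeFn_sub X Y), eLpNorm_one_eq_lintegral_enorm]
        exact integral_norm_eq_lintegral_enorm
          ((Lp.aestronglyMeasurable X).sub (Lp.aestronglyMeasurable Y))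
    _ ≤ ‖X - Y‖ := by
        rw [Lp.norm_def]
        exact ENNReal.toReal_mono (Lp.eLpNorm_ne_top _)
          (eLpNorm_le_eLpNorm_of_exponent_le (by norm_num) (Lp.aestronglyMeasurable _))

/-- Gaussian spaces are closed under `L²` limits: both sides of the formula for the characteristic
function are continuous. -/
theorem IsGaussianSpace.topologicalClosure [IsProbabilityMeasure P]
    {G : Submodule ℝ (Lp ℝ 2 P)} (hG : IsGaussianSpace G) :
    IsGaussianSpace G.topologicalClosure := by
  intro X hX
  have hcl : IsClosed {X : Lp ℝ 2 P | ∫ ω, Complex.exp (Complex.I * (X ω : ℂ)) ∂P =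
      Complex.exp (-((‖X‖ : ℂ) ^ 2 / 2))} :=
    isClosed_eq continuous_integral_cexp (by fun_prop)
  exact closure_minimal (fun Y hY => hG Y hY) hcl hX

theorem integral_sq_eq_norm_sq (X : Lp ℝ 2 P) : ∫ ω, X ω ^ 2 ∂P = ‖X‖ ^ 2 := by
  rw [← real_inner_self_eq_norm_sq, L2.inner_def]
  simp [sq]

theorem IsGaussianSpace.map_eq [IsProbabilityMeasure P] {G : Submodule ℝ (Lp ℝ 2 P)}
    (hG : IsGaussianSpace G) {X : Lp ℝ 2 P} (hX : X ∈ G) :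
    P.map X = gaussianReal 0 (‖X‖ ^ 2).toNNReal := by
  have hm : AEMeasurable X P := (Lp.aestronglyMeasurable X).aemeasurable
  refine Measure.ext_of_charFun (funext fun t => ?_)
  rw [charFun_apply_real, integral_map hm (by fun_prop), charFun_gaussianReal]
  have h := hG (t • X) (G.smul_mem t hX)
  have h2 : ∫ ω, Complex.exp (Complex.I * ((t • X : Lp ℝ 2 P) ω : ℂ)) ∂P =
      ∫ ω, Complex.exp (t * (X ω : ℂ) * Complex.I) ∂P := by
    refine integral_congr_ae ?_
    filter_upwards [Lp.coeFn_smul t X] with ω hω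
    rw [hω]; simp [mul_comm]
  rw [← h2, h, norm_smul, NNReal.coe_inj.2 rfl, Real.coe_toNNReal _ (by positivity)]
  congr 1
  push_cast
  rw [mul_pow, ← Complex.ofReal_pow, Real.norm_eq_abs, sq_abs]
  push_cast
  ring

theorem IsGaussianSpace.hasGaussianLaw [IsProbabilityMeasure P] {G : Submodule ℝ (Lp ℝ 2 P)}
    (hG : IsGaussianSpace G) {X : Lp ℝ 2 P} (hX : X ∈ G) : HasGaussianLaw X P :=
  ⟨by rw [hG.map_eq hX]; infer_instance⟩

theorem IsGaussianSpace.integral_eq_zero [IsProbabilityMeasure P] {G : Submodule ℝ (Lp ℝ 2 P)}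
    (hG : IsGaussianSpace G) {X : Lp ℝ 2 P} (hX : X ∈ G) : ∫ ω, X ω ∂P = 0 := by
  have hm : AEMeasurable X P := (Lp.aestronglyMeasurable X).aemeasurable
  have : ∫ x, x ∂(P.map X) = 0 := by rw [hG.map_eq hX, integral_id_gaussianReal]
  rwa [integral_map hm (by fun_prop)] at this

theorem coeFn_sum_smul {κ : Type*} (s : Finset κ) (c : κ → ℝ) (X : κ → Lp ℝ 2 P) :
    ((∑ k ∈ s, c k • X k : Lp ℝ 2 P) : Ω → ℝ) =ᵐ[P] fun ω => ∑ k ∈ s, c k * X k ω := by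
  classical
  induction s using Finset.induction_on with
  | empty =>
    filter_upwards [Lp.coeFn_zero ℝ 2 P] with ω hω
    simpa using hω
  | insert a s ha ih =>
    rw [Finset.sum_insert ha]
    filter_upwards [ih, Lp.coeFn_add (c a • X a) (∑ k ∈ s, c k • X k),
      Lp.coeFn_smul (c a) (X a)] with ω h1 h2 h3
    rw [h2, Pi.add_apply, h1, h3, Finset.sum_insert ha]
    rfl

/-- The elements of a Gaussian space are jointly Gaussian. -/
theorem IsGaussianSpace.isGaussianProcess [IsProbabilityMeasure P] {G : Submodule ℝ (Lp ℝ 2 P)}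
    (hG : IsGaussianSpace G) {κ : Type*} (X : κ → Lp ℝ 2 P) (hX : ∀ k, X k ∈ G) :
    IsGaussianProcess (fun k => (X k : Ω → ℝ)) P where
  hasGaussianLaw I := by
    classical
    have hm : ∀ k, Measurable (X k) := fun k => (Lp.stronglyMeasurable (X k)).measurable
    have hmI : Measurable fun ω => I.restrict fun k => X k ω :=
      measurable_pi_lambda _ fun k => hm k
    refine ⟨isGaussian_of_map_eq_gaussianReal fun L => ?_⟩
    let c : I → ℝ := fun k => L fun j => if k = j then 1 else 0
    refine ⟨0, (‖(∑ k : I, c k • X k : Lp ℝ 2 P)‖ ^ 2).toNNReal, ?_⟩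
    have hL : (L ∘ fun ω => I.restrict fun k => X k ω) =ᵐ[P]
        ((∑ k : I, c k • X k : Lp ℝ 2 P) : Ω → ℝ) := by
      filter_upwards [coeFn_sum_smul Finset.univ c (fun k : I => X k)] with ω hω
      rw [hω]
      refine (LinearMap.pi_apply_eq_sum_univ (L : (I → ℝ) →ₗ[ℝ] ℝ) _).trans ?_
      exact Finset.sum_congr rfl fun k _ => mul_comm _ _
    have hmL : Measurable L := L.measurable
    rw [Measure.map_map hmL hmI, Measure.map_congr hL]
    exact hG.map_eq (G.sum_mem fun k _ => G.smul_mem _ (hX k))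

/-- The span in `L²(P)` of a centred Gaussian process is a Gaussian space. -/
theorem isGaussianSpace_span [IsProbabilityMeasure P] {T : Type*} {X : T → Ω → ℝ}
    (hX : IsGaussianProcess X P) (h0 : ∀ t, ∫ ω, X t ω ∂P = 0) (Y : T → Lp ℝ 2 P)
    (hY : ∀ t, Y t =ᵐ[P] X t) : IsGaussianSpace (Submodule.span ℝ (range Y)) := by
  intro Z hZ
  obtain ⟨c, rfl⟩ := (Finsupp.mem_span_range_iff_exists_finsupp).1 hZ
  have hproc : IsGaussianProcess (fun t => (Y t : Ω → ℝ)) P := hX.congr fun t => (hY t).symm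
  have hsum := coeFn_sum_smul c.support c Y
  have hlaw : HasGaussianLaw ((∑ t ∈ c.support, c t • Y t : Lp ℝ 2 P) : Ω → ℝ) P :=
    ((hproc.smul c).hasGaussianLaw_fun_sum (I := c.support)).congr hsum.symm
  have hmean : ∫ ω, (∑ t ∈ c.support, c t • Y t : Lp ℝ 2 P) ω ∂P = 0 := by
    rw [integral_congr_ae hsum, integral_finsetSum _ fun t _ =>
      ((Lp.memLp (Y t)).integrable (by norm_num)).const_mul _]
    refine Finset.sum_eq_zero fun t _ => ?_
    rw [integral_const_mul, integral_congr_ae (hY t), h0, mul_zero]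
  change ∫ ω, Complex.exp (Complex.I * ((∑ t ∈ c.support, c t • Y t : Lp ℝ 2 P) ω : ℂ)) ∂P =
    Complex.exp (-((‖(∑ t ∈ c.support, c t • Y t : Lp ℝ 2 P)‖ : ℂ) ^ 2 / 2))
  generalize (∑ t ∈ c.support, c t • Y t : Lp ℝ 2 P) = Z at hlaw hmean
  have h := hlaw.charFun_map_eq 1
  rw [charFun_apply_real, integral_map hlaw.aemeasurable (by fun_prop)] at h
  have hvar : Var[fun ω => inner ℝ (1 : ℝ) (Z ω); P] = ‖Z‖ ^ 2 := by
    rw [variance_of_integral_eq_zero]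
    · simpa using integral_sq_eq_norm_sq Z
    · simpa using hlaw.aemeasurable
    · simpa using hmean
  rw [hvar] at h
  simp only [Complex.ofReal_one, one_mul] at h
  simp_rw [mul_comm Complex.I]
  rw [h]
  simp [hmean]

end GaussianSpace

/-! ### Gaussian integration by parts -/

theorem integrable_polynomial_gaussianReal (v : NNReal) (q : Polynomial ℂ) :
    Integrable (fun z : ℝ => q.eval (z : ℂ)) (gaussianReal 0 v) := by
  induction q using Polynomial.induction_on' with
  | add p q hp hq =>
    simp only [Polynomial.eval_add]
    exact hp.add hq
  | monomial k c =>
    simp only [Polynomial.eval_monomial]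
    refine Integrable.const_mul ?_ c
    have h := ((memLp_id_gaussianReal (μ := 0) (v := v) k).integrable_norm_pow' (p := k))
    refine h.mono' (by fun_prop) (Filter.Eventually.of_forall fun z => ?_)
    simp

/-- Stein's identity in dimension one, for polynomials. -/
theorem stein_gaussianReal {v : NNReal} (hv : v ≠ 0) (q : Polynomial ℂ) :
    ∫ z : ℝ, (z : ℂ) * q.eval (z : ℂ) ∂(gaussianReal 0 v) =
      (v : ℂ) * ∫ z : ℝ, (Polynomial.derivative q).eval (z : ℂ) ∂(gaussianReal 0 v) := by
  have hint : ∀ r : Polynomial ℂ, Integrable fun z : ℝ =>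
      r.eval (z : ℂ) * ((gaussianPDFReal 0 v z : ℝ) : ℂ) := by
    intro r
    have h := integrable_polynomial_gaussianReal v r
    rw [gaussianReal_of_var_ne_zero _ hv, integrable_withDensity_iff_integrable_smul'
      (measurable_gaussianPDF _ _) (Filter.Eventually.of_forall fun _ => gaussianPDF_lt_top)] at h
    refine h.congr (Filter.Eventually.of_forall fun z => ?_)
    simp only [toReal_gaussianPDF, Complex.real_smul]
    ring
  have hu : ∀ z : ℝ, HasDerivAt (fun z : ℝ => q.eval (z : ℂ))
      ((Polynomial.derivative q).eval (z : ℂ)) z := fun z =>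
    (q.hasDerivAt (z : ℂ)).comp_ofReal
  have hv' : (v : ℝ) ≠ 0 := by exact_mod_cast hv
  have hpdf : ∀ z : ℝ, HasDerivAt (fun z : ℝ => ((gaussianPDFReal 0 v z : ℝ) : ℂ))
      (((-(z / v) * gaussianPDFReal 0 v z : ℝ)) : ℂ) z := by
    intro z
    refine HasDerivAt.ofReal_comp ?_
    have h1 : HasDerivAt (fun z : ℝ => -(z - 0) ^ 2 / (2 * v)) (-(z / v)) z := by
      have h2 := (((hasDerivAt_id z).sub_const 0).pow 2).neg.div_const (2 * (v : ℝ))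
      refine h2.congr_deriv ?_
      simp
      field_simp
    have h3 := h1.exp.const_mul (Real.sqrt (2 * Real.pi * v))⁻¹
    refine h3.congr_deriv ?_
    rw [gaussianPDFReal]
    ring
  have e : ∀ z : ℝ, q.eval (z : ℂ) * (((-(z / v) * gaussianPDFReal 0 v z : ℝ)) : ℂ) =
      (-(v : ℂ)⁻¹) * ((Polynomial.X * q).eval (z : ℂ) * ((gaussianPDFReal 0 v z : ℝ) : ℂ)) := by
    intro z
    simp
    ring
  have key := integral_mul_deriv_eq_deriv_mul_of_integrable
    (u := fun z : ℝ => q.eval (z : ℂ)) (v := fun z : ℝ => ((gaussianPDFReal 0 v z : ℝ) : ℂ))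
    (fun z _ => hu z) (fun z _ => hpdf z)
    (((hint (Polynomial.X * q)).const_mul (-(v : ℂ)⁻¹)).congr
      (Filter.Eventually.of_forall fun z => (e z).symm))
    (hint (Polynomial.derivative q)) (hint q)
  simp_rw [e] at key
  rw [integral_const_mul] at key
  rw [integral_gaussianReal_eq_integral_smul hv, integral_gaussianReal_eq_integral_smul hv]
  have hv'' : (v : ℂ) ≠ 0 := by exact_mod_cast hv
  have e1 : ∫ z : ℝ, gaussianPDFReal 0 v z • ((z : ℂ) * q.eval (z : ℂ)) =
      ∫ z : ℝ, (Polynomial.X * q).eval (z : ℂ) * ((gaussianPDFReal 0 v z : ℝ) : ℂ) := by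
    refine integral_congr_ae (Filter.Eventually.of_forall fun z => ?_)
    simp; ring
  have e2 : ∫ z : ℝ, gaussianPDFReal 0 v z • (Polynomial.derivative q).eval (z : ℂ) =
      ∫ z : ℝ, (Polynomial.derivative q).eval (z : ℂ) * ((gaussianPDFReal 0 v z : ℝ) : ℂ) := by
    refine integral_congr_ae (Filter.Eventually.of_forall fun z => ?_)
    simp; ring
  rw [e1, e2]
  field_simp at key
  linear_combination -key

section Polynomials

variable {Ω : Type*} [MeasurableSpace Ω] {P : Measure Ω} {G : Submodule ℝ (Lp ℝ 2 P)}

/-- The random variable obtained by evaluating a polynomial at the elements of a Gaussian space. -/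
def evalGauss (p : MvPolynomial G ℂ) (ω : Ω) : ℂ :=
  MvPolynomial.eval (fun X : G => (((X : Lp ℝ 2 P) ω : ℝ) : ℂ)) p

/-- Polynomials in Gaussian variables have moments of all orders. -/
theorem IsGaussianSpace.memLp_evalGauss [IsProbabilityMeasure P] (hG : IsGaussianSpace G)
    (p : MvPolynomial G ℂ) : ∀ r : NNReal, MemLp (evalGauss p) r P := by
  induction p using MvPolynomial.induction_on with
  | C c =>
    intro r
    refine (memLp_const (μ := P) c).ae_eq (Filter.Eventually.of_forall fun ω => ?_)
    simp [evalGauss]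
  | add p q hp hq =>
    intro r
    have := (hp r).add (hq r)
    refine this.ae_eq (Filter.Eventually.of_forall fun ω => ?_)
    simp [evalGauss]
  | mul_X p X hp =>
    intro r
    have h1 : MemLp (fun ω => (((X : Lp ℝ 2 P) ω : ℝ) : ℂ)) (2 * r : NNReal) P :=
      ((hG.hasGaussianLaw X.2).memLp ENNReal.coe_ne_top).ofReal
    have : ENNReal.HolderTriple ((2 * r : NNReal) : ENNReal) ((2 * r : NNReal) : ENNReal) r :=
      ⟨by
        rcases eq_or_ne r 0 with rfl | hr
        · simp
        · rw [ENNReal.coe_mul, ENNReal.mul_inv (by simp) (by simp), ← add_mul]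
          simp [ENNReal.inv_two_add_inv_two]⟩
    have := h1.mul (r := (r : ENNReal)) (hp (2 * r))
    refine this.ae_eq (Filter.Eventually.of_forall fun ω => ?_)
    simp [evalGauss]

theorem IsGaussianSpace.integrable_evalGauss [IsProbabilityMeasure P] (hG : IsGaussianSpace G)
    (p : MvPolynomial G ℂ) : Integrable (evalGauss p) P :=
  memLp_one_iff_integrable.1 (by simpa using hG.memLp_evalGauss p 1)

/-- The expectation of a polynomial in the elements of a Gaussian space. -/
def IsGaussianSpace.expectation [IsProbabilityMeasure P] (hG : IsGaussianSpace G) :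
    MvPolynomial G ℂ →ₗ[ℂ] ℂ where
  toFun p := ∫ ω, evalGauss p ω ∂P
  map_add' p q := by
    rw [← integral_add (hG.integrable_evalGauss p) (hG.integrable_evalGauss q)]
    simp [evalGauss]
  map_smul' c p := by
    rw [RingHom.id_apply, smul_eq_mul, ← integral_const_mul]
    simp [evalGauss]

/-- The derivative of polynomials in the elements of a Gaussian space in the direction `X`, for
which the derivative of the variable `Y` is the covariance of `X` and `Y`. -/
def gaussDeriv (X : G) : Derivation ℂ (MvPolynomial G ℂ) (MvPolynomial G ℂ) :=
  MvPolynomial.mkDerivation ℂ fun Y => MvPolynomial.C ((inner ℝ X Y : ℝ) : ℂ)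

theorem gaussDeriv_X (X Y : G) :
    gaussDeriv X (MvPolynomial.X Y) = MvPolynomial.C ((inner ℝ X Y : ℝ) : ℂ) :=
  MvPolynomial.mkDerivation_X _ _ _

/-- Substitution of the affine functions `z ↦ a Y z + r Y` for the variables. -/
def substAffine (a : G → ℝ) (r : G → ℝ) : MvPolynomial G ℂ →ₐ[ℂ] Polynomial ℂ :=
  MvPolynomial.aeval fun Y => Polynomial.C (a Y : ℂ) * Polynomial.X + Polynomial.C (r Y : ℂ)

/-- If `X` has variance `v` and `a Y` is the regression coefficient of `Y` on `X`, then the affine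
substitution turns the derivation `D_X` into `v d/dz`. -/
theorem derivative_substAffine (a r : G → ℝ) (X : G) (v : ℝ)
    (ha : ∀ Y : G, v * a Y = inner ℝ X Y) (p : MvPolynomial G ℂ) :
    Polynomial.C (v : ℂ) * Polynomial.derivative (substAffine a r p) =
      substAffine a r (gaussDeriv X p) := by
  induction p using MvPolynomial.induction_on with
  | C c => simp [substAffine]
  | add p q hp hq => simp [mul_add, hp, hq]
  | mul_X p Y hp =>
    have h1 : substAffine a r (MvPolynomial.X Y) =
        Polynomial.C (a Y : ℂ) * Polynomial.X + Polynomial.C (r Y : ℂ) :=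
      MvPolynomial.aeval_X _ _
    rw [map_mul, Polynomial.derivative_mul, mul_add, ← mul_assoc, hp, Derivation.leibniz, map_add,
      smul_eq_mul, smul_eq_mul, map_mul, map_mul, gaussDeriv_X, h1]
    have h2 : substAffine a r (MvPolynomial.C ((inner ℝ X Y : ℝ) : ℂ)) =
        Polynomial.C (v : ℂ) * Polynomial.C (a Y : ℂ) := by
      rw [← Polynomial.C_mul, ← Complex.ofReal_mul, ha]
      exact MvPolynomial.aeval_C _ _
    rw [h2]
    simp
    ring

theorem measurable_eval_substAffine (a : G → ℝ) (p : MvPolynomial G ℂ) :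
    Measurable fun x : ℝ × (G → ℝ) => (substAffine a x.2 p).eval (x.1 : ℂ) := by
  induction p using MvPolynomial.induction_on with
  | C c => simp [substAffine]
  | add p q hp hq =>
    simp only [map_add, Polynomial.eval_add]
    exact hp.add hq
  | mul_X p Y hp =>
    have : Measurable fun x : ℝ × (G → ℝ) => ((a Y : ℂ) * (x.1 : ℂ) + ((x.2 Y : ℝ) : ℂ)) := by
      have : Measurable fun x : ℝ × (G → ℝ) => x.2 Y := (measurable_pi_apply Y).comp measurable_snd
      fun_prop
    have h := hp.mul this
    convert! h using 1
    funext x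
    simp [substAffine]

/-- Gaussian integration by parts. -/
theorem IsGaussianSpace.expectation_X_mul [IsProbabilityMeasure P] (hG : IsGaussianSpace G)
    (X : G) (p : MvPolynomial G ℂ) :
    hG.expectation (MvPolynomial.X X * p) = hG.expectation (gaussDeriv X p) := by
  rcases eq_or_ne X 0 with rfl | hX0
  · have h1 : gaussDeriv (0 : G) p = 0 := by
      have : gaussDeriv (0 : G) = 0 := MvPolynomial.derivation_ext fun Y => by
        rw [gaussDeriv_X]; simp
      rw [this]; rfl
    rw [h1, map_zero]
    refine integral_eq_zero_of_ae ?_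
    filter_upwards [Lp.coeFn_zero ℝ 2 P] with ω hω
    have : (((0 : G) : Lp ℝ 2 P) : Ω → ℝ) ω = 0 := hω
    simp [evalGauss]
  -- Each variable `Y` is the sum of a multiple of `X` and of a variable `R Y` independent of `X`.
  set v : ℝ := ‖X‖ ^ 2 with hv
  have hvpos : 0 < v := by have := norm_pos_iff.2 hX0; positivity
  let a : G → ℝ := fun Y => inner ℝ X Y / v
  have ha : ∀ Y, v * a Y = inner ℝ X Y := fun Y => by
    simp only [a]; field_simp
  let R : G → G := fun Y => Y - a Y • X
  have hm : ∀ Y : G, Measurable (Y : Lp ℝ 2 P) := fun Y =>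
    (Lp.stronglyMeasurable (Y : Lp ℝ 2 P)).measurable
  let S : Ω → G → ℝ := fun ω Y => (R Y : Lp ℝ 2 P) ω
  have hSm : Measurable S := measurable_pi_lambda _ fun Y => hm (R Y)
  have hind : IndepFun (X : Lp ℝ 2 P) S P := by
    have hproc : IsGaussianProcess (Sum.elim (fun _ : Unit => ((X : Lp ℝ 2 P) : Ω → ℝ))
        (fun Y : G => ((R Y : Lp ℝ 2 P) : Ω → ℝ))) P := by
      have := hG.isGaussianProcess (Sum.elim (fun _ : Unit => (X : Lp ℝ 2 P))
        (fun Y : G => (R Y : Lp ℝ 2 P))) (by rintro (_ | Y); exacts [X.2, (R Y).2])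
      convert! this using 1
      funext k
      rcases k with _ | Y <;> rfl
    have := hproc.indepFun_of_covariance_eq_zero (fun _ => (hm X).aemeasurable)
      (fun Y => (hm (R Y)).aemeasurable) (fun _ Y => by
        rw [covariance_eq_sub (Lp.memLp _) (Lp.memLp _), hG.integral_eq_zero X.2, zero_mul,
          sub_zero]
        have h1 : inner ℝ X (R Y) = 0 := by
          simp only [R, a]
          have h0 : ∀ c : ℝ, inner ℝ X (c • X) = c * inner ℝ X X := fun c =>
            real_inner_smul_right (X : Lp ℝ 2 P) (X : Lp ℝ 2 P) c
          rw [inner_sub_right, h0, real_inner_self_eq_norm_sq, ← hv]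
          field_simp
          ring
        rw [← h1]
        change _ = inner ℝ (X : Lp ℝ 2 P) (R Y : Lp ℝ 2 P)
        rw [L2.inner_def]
        refine integral_congr_ae (Filter.Eventually.of_forall fun ω => ?_)
        simp [mul_comm])
    exact this.comp (measurable_pi_apply ()) measurable_id
  have hlaw : P.map (fun ω => ((X : Lp ℝ 2 P) ω, S ω)) =
      (gaussianReal 0 v.toNNReal).prod (P.map S) := by
    rw [(indepFun_iff_map_prod_eq_prod_map_map (hm X).aemeasurable hSm.aemeasurable).1 hind,
      hG.map_eq X.2]
    rfl
  have : IsProbabilityMeasure (P.map S) := Measure.isProbabilityMeasure_map hSm.aemeasurable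
  have hpair : Measurable fun ω => ((X : Lp ℝ 2 P) ω, S ω) := (hm X).prodMk hSm
  have hev : ∀ q : MvPolynomial G ℂ, evalGauss q =ᵐ[P] fun ω =>
      (substAffine a (S ω) q).eval (((X : Lp ℝ 2 P) ω : ℝ) : ℂ) := by
    intro q
    induction q using MvPolynomial.induction_on with
    | C c => exact Filter.Eventually.of_forall fun ω => by simp [evalGauss, substAffine]
    | add p q hp hq =>
      filter_upwards [hp, hq] with ω h1 h2
      simp only [evalGauss, map_add, Polynomial.eval_add] at h1 h2 ⊢
      rw [h1, h2]
    | mul_X p Y hp =>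
      filter_upwards [hp, Lp.coeFn_sub (Y : Lp ℝ 2 P) (a Y • (X : Lp ℝ 2 P)),
        Lp.coeFn_smul (a Y) (X : Lp ℝ 2 P)] with ω h1 h2 h3
      have h4 : S ω Y = (Y : Lp ℝ 2 P) ω - a Y * (X : Lp ℝ 2 P) ω := by
        rw [Pi.sub_apply, h3] at h2
        exact h2
      simp only [evalGauss, map_mul, Polynomial.eval_mul] at h1 ⊢
      rw [h1]
      simp [substAffine, h4]
  -- Expectations are computed by integrating first over `X`, for a fixed value `s` of the `R Y`.
  have htrans : ∀ q : MvPolynomial G ℂ, hG.expectation q =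
      ∫ s, ∫ z, (substAffine a s q).eval (z : ℂ) ∂(gaussianReal 0 v.toNNReal) ∂(P.map S) := by
    intro q
    have hq := measurable_eval_substAffine a q
    have hi : Integrable (fun x : ℝ × (G → ℝ) => (substAffine a x.2 q).eval (x.1 : ℂ))
        ((gaussianReal 0 v.toNNReal).prod (P.map S)) := by
      rw [← hlaw, integrable_map_measure hq.aestronglyMeasurable hpair.aemeasurable]
      exact (hG.integrable_evalGauss q).congr (hev q)
    rw [← integral_prod_symm _ hi, ← hlaw,
      integral_map hpair.aemeasurable hq.aestronglyMeasurable]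
    exact integral_congr_ae (hev q)
  have hXa : a X = 1 := by
    simp only [a]; rw [real_inner_self_eq_norm_sq, ← hv]; field_simp
  have hSX : ∀ᵐ s ∂(P.map S), s X = 0 := by
    rw [ae_map_iff hSm.aemeasurable (measurableSet_eq_fun (measurable_pi_apply X)
      measurable_const)]
    have : R X = 0 := by simp [R, hXa]
    filter_upwards [Lp.coeFn_zero ℝ 2 P] with ω hω
    change (R X : Lp ℝ 2 P) ω = 0
    rw [this]; exact hω
  rw [htrans, htrans]
  refine integral_congr_ae ?_
  filter_upwards [hSX] with s hs
  have hv0 : v.toNNReal ≠ 0 := by simpa using hvpos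
  have h1 := stein_gaussianReal hv0 (substAffine a s p)
  have h2 : ∀ z : ℝ, (substAffine a s (MvPolynomial.X X * p)).eval (z : ℂ) =
      (z : ℂ) * (substAffine a s p).eval (z : ℂ) := by
    intro z
    rw [map_mul, Polynomial.eval_mul]
    simp [substAffine, hXa, hs]
  simp_rw [h2, h1, ← derivative_substAffine a s X v ha p, Polynomial.eval_mul, Polynomial.eval_C,
    integral_const_mul]
  rw [show ((v.toNNReal : NNReal) : ℂ) = (v : ℂ) by
    rw [← NNReal.coe_toRealHom]; simp [Real.coe_toNNReal _ hvpos.le]]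

end Polynomials

/-! ### Wick products in a Gaussian space -/

section Forms

variable {Ω : Type*} [MeasurableSpace Ω] {P : Measure Ω} {G : Submodule ℝ (Lp ℝ 2 P)}

/-- The linear form `X + cY` attached to a triple `(X, Y, c)` of two elements of a Gaussian space
and a complex coefficient. -/
def gaussForm (y : G × G × ℂ) : MvPolynomial G ℂ :=
  MvPolynomial.X y.1 + MvPolynomial.C y.2.2 * MvPolynomial.X y.2.1

/-- The annihilation operator attached to the complex Gaussian variable `X + cY`. -/
def formDeriv (y : G × G × ℂ) : Derivation ℂ (MvPolynomial G ℂ) (MvPolynomial G ℂ) :=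
  gaussDeriv y.1 + y.2.2 • gaussDeriv y.2.1

/-- The complex bilinear covariance `E[(X + cY)(X' + c'Y')]`. -/
def formCov (y z : G × G × ℂ) : ℂ :=
  (inner ℝ y.1 z.1 : ℝ) + z.2.2 * (inner ℝ y.1 z.2.1 : ℝ) + y.2.2 * (inner ℝ y.2.1 z.1 : ℝ) +
    y.2.2 * z.2.2 * (inner ℝ y.2.1 z.2.1 : ℝ)

theorem formDeriv_gaussForm (y z : G × G × ℂ) :
    formDeriv y (gaussForm z) = algebraMap ℂ (MvPolynomial G ℂ) (formCov y z) := by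
  simp only [formDeriv, gaussForm, Derivation.add_apply, Derivation.smul_apply, map_add,
    Derivation.leibniz, gaussDeriv_X, MvPolynomial.derivation_C, MvPolynomial.smul_eq_C_mul,
    smul_eq_mul, formCov, MvPolynomial.algebraMap_eq, map_mul]
  ring

theorem formDeriv_comm (y z : G × G × ℂ) (p : MvPolynomial G ℂ) :
    formDeriv y (formDeriv z p) = formDeriv z (formDeriv y p) := by
  have h : ⁅formDeriv y, formDeriv z⁆ = 0 := MvPolynomial.derivation_ext fun X => by
    have hX : ∀ y : G × G × ℂ, ∃ c : ℂ, formDeriv y (MvPolynomial.X X) = MvPolynomial.C c :=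
      fun y => ⟨(inner ℝ y.1 X : ℝ) + y.2.2 * (inner ℝ y.2.1 X : ℝ), by
        simp [formDeriv, gaussDeriv_X, MvPolynomial.smul_eq_C_mul]⟩
    obtain ⟨c, hc⟩ := hX y
    obtain ⟨d, hd⟩ := hX z
    rw [Derivation.commutator_apply, hc, hd]
    simp
  have := congrArg (fun d : Derivation ℂ (MvPolynomial G ℂ) (MvPolynomial G ℂ) => d p) h
  rw [Derivation.commutator_apply] at this
  exact sub_eq_zero.1 this

/-- The value of the Wick product `:y₀⋯y_{n-1}:` of linear combinations of elements of a Gaussian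
space. -/
def gaussWick {n : ℕ} (y : Fin n → G × G × ℂ) : Ω → ℂ :=
  evalGauss (wick gaussForm formDeriv n y)

theorem gaussWick_eq_prod {n : ℕ} (y : Fin n → G × G × ℂ)
    (h : ∀ i j, i ≠ j → formCov (y i) (y j) = 0) (ω : Ω) :
    gaussWick y ω = ∏ l, ((((y l).1 : Lp ℝ 2 P) ω : ℂ) +
      (y l).2.2 * (((y l).2.1 : Lp ℝ 2 P) ω : ℂ)) := by
  rw [gaussWick, wick_eq_prod formDeriv_gaussForm n y h]
  simp [evalGauss, gaussForm, map_prod]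

variable [IsProbabilityMeasure P]

theorem IsGaussianSpace.expectation_gaussForm_mul (hG : IsGaussianSpace G) (y : G × G × ℂ)
    (p : MvPolynomial G ℂ) :
    hG.expectation (gaussForm y * p) = hG.expectation (formDeriv y p) := by
  rw [gaussForm, add_mul, map_add, hG.expectation_X_mul, mul_assoc, ← MvPolynomial.smul_eq_C_mul,
    map_smul, hG.expectation_X_mul, formDeriv, Derivation.add_apply, Derivation.smul_apply,
    map_add, map_smul]

theorem IsGaussianSpace.memLp_gaussWick (hG : IsGaussianSpace G) {n : ℕ} (y : Fin n → G × G × ℂ) :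
    MemLp (gaussWick y) 2 P := by
  exact_mod_cast hG.memLp_evalGauss (wick gaussForm formDeriv n y) 2

theorem IsGaussianSpace.integral_gaussWick_mul_gaussWick (hG : IsGaussianSpace G) {n : ℕ}
    (y z : Fin n → G × G × ℂ) : ∫ ω, gaussWick y ω * gaussWick z ω ∂P =
      ∑ σ : Equiv.Perm (Fin n), ∏ l, formCov (y l) (z (σ l)) := by
  have h1 : hG.expectation 1 = 1 := by
    simp [IsGaussianSpace.expectation, evalGauss]
  rw [← expectation_wick_mul_wick formDeriv_gaussForm formDeriv_comm hG.expectation h1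
    hG.expectation_gaussForm_mul]
  simp [IsGaussianSpace.expectation, gaussWick, evalGauss]

end Forms

/-! ### Elementary tensors and coordinate permutations in `L²` of a product measure -/

section ProductMeasure

variable {α : Type*} [MeasurableSpace α] {m : Measure α} [SigmaFinite m] {n : ℕ}

theorem ae_pi_of_ae {p : α → Prop} (h : ∀ᵐ z ∂m, p z) :
    ∀ᵐ z ∂(Measure.pi fun _ : Fin n => m), ∀ i, p (z i) :=
  ae_all_iff.2 fun i => (Measure.quasiMeasurePreserving_eval (fun _ : Fin n => m) i).ae h

theorem memLp_pi_prod (g : Fin n → Lp ℂ 2 m) :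
    MemLp (fun z : Fin n → α => ∏ i, g i (z i)) 2 (Measure.pi fun _ => m) := by
  have hm : AEStronglyMeasurable (fun z : Fin n → α => ∏ i, g i (z i))
      (Measure.pi fun _ => m) :=
    Finset.aestronglyMeasurable_fun_prod _ fun i _ =>
      (Lp.aestronglyMeasurable (g i)).comp_quasiMeasurePreserving
        (Measure.quasiMeasurePreserving_eval _ i)
  refine (memLp_two_iff_integrable_sq_norm hm).2 ?_
  simp_rw [norm_prod, ← Finset.prod_pow]
  exact Integrable.fintype_prod (f := fun i z => ‖g i z‖ ^ 2)
    (fun i => (memLp_two_iff_integrable_sq_norm (Lp.aestronglyMeasurable (g i))).1 (Lp.memLp (g i)))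

/-- The elementary tensor `(z_1,…,z_n) ↦ g_1(z_1)⋯g_n(z_n)` in `L²` of a product measure. -/
def prodLp (g : Fin n → Lp ℂ 2 m) : Lp ℂ 2 (Measure.pi fun _ : Fin n => m) :=
  (memLp_pi_prod g).toLp _

theorem coeFn_prodLp (g : Fin n → Lp ℂ 2 m) :
    prodLp g =ᵐ[Measure.pi fun _ : Fin n => m] fun z => ∏ i, g i (z i) :=
  MemLp.coeFn_toLp _

theorem inner_prodLp (g h : Fin n → Lp ℂ 2 m) :
    inner ℂ (prodLp g) (prodLp h) = ∏ i, inner ℂ (g i) (h i) := by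
  rw [L2.inner_def]
  have : ∫ z, inner ℂ (prodLp g z) (prodLp h z) ∂(Measure.pi fun _ : Fin n => m) =
      ∫ z, ∏ i, inner ℂ (g i (z i)) (h i (z i)) ∂(Measure.pi fun _ : Fin n => m) := by
    refine integral_congr_ae ?_
    filter_upwards [coeFn_prodLp g, coeFn_prodLp h] with z h1 h2
    rw [h1, h2]
    simp only [RCLike.inner_apply, map_prod, Finset.prod_mul_distrib]
  rw [this, integral_fintype_prod_eq_prod (𝕜 := ℂ) (fun i z => inner ℂ (g i z) (h i z))]
  exact Finset.prod_congr rfl fun i _ => (L2.inner_def _ _).symm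

theorem measurePreserving_comp_perm (σ : Equiv.Perm (Fin n)) :
    MeasurePreserving (fun (z : Fin n → α) i => z (σ i)) (Measure.pi fun _ => m)
      (Measure.pi fun _ => m) := by
  have hmeas : Measurable fun (z : Fin n → α) i => z (σ i) :=
    measurable_pi_lambda _ fun i => measurable_pi_apply _
  refine ⟨hmeas, (Measure.pi_eq fun s hs => ?_).symm⟩
  rw [Measure.map_apply hmeas (MeasurableSet.univ_pi hs)]
  have : (fun (z : Fin n → α) i => z (σ i)) ⁻¹' univ.pi s = univ.pi fun i => s (σ.symm i) := by
    ext z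
    simp only [mem_preimage, mem_univ_pi]
    exact ⟨fun h i => by simpa using h (σ.symm i), fun h i => by simpa using h (σ i)⟩
  rw [this, Measure.pi_pi]
  exact Equiv.prod_comp σ.symm fun i => m (s i)

/-- The action of a permutation of the coordinates on `L²` of a power of a measure. -/
def permLp (m : Measure α) [SigmaFinite m] (σ : Equiv.Perm (Fin n)) :
    Lp ℂ 2 (Measure.pi fun _ : Fin n => m) →ₗᵢ[ℂ] Lp ℂ 2 (Measure.pi fun _ : Fin n => m) :=
  Lp.compMeasurePreservingₗᵢ ℂ _ (measurePreserving_comp_perm σ)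

theorem permLp_prodLp (σ : Equiv.Perm (Fin n)) (g : Fin n → Lp ℂ 2 m) :
    permLp m σ (prodLp g) = prodLp fun i => g (σ.symm i) := by
  refine Lp.ext ?_
  filter_upwards [Lp.coeFn_compMeasurePreserving (prodLp g) (measurePreserving_comp_perm σ),
    (measurePreserving_comp_perm (m := m) σ).quasiMeasurePreserving.ae (coeFn_prodLp g),
    coeFn_prodLp fun i => g (σ.symm i)] with z h1 h2 h3
  rw [h3]
  refine h1.trans (h2.trans ?_)
  rw [← Equiv.prod_comp σ fun i => g (σ.symm i) (z i)]
  simp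

theorem lintegral_pi_prod : ∀ (n : ℕ) (f : Fin n → α → ENNReal), (∀ i, Measurable (f i)) →
    ∫⁻ z, ∏ i, f i (z i) ∂(Measure.pi fun _ : Fin n => m) = ∏ i, ∫⁻ x, f i x ∂m
  | 0, f, _ => by simp
  | n + 1, f, hf => by
    have ih := lintegral_pi_prod n (fun i => f i.succ) fun i => hf _
    have hmp := (measurePreserving_piFinSuccAbove (fun _ : Fin (n + 1) => m) 0).symm
    rw [Fin.prod_univ_succ, ← ih, ← lintegral_prod_mul (hf 0).aemeasurable
      (Finset.measurable_fun_prod _ fun i _ =>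
        (hf i.succ).comp (measurable_pi_apply i)).aemeasurable,
      ← hmp.lintegral_comp_emb (MeasurableEquiv.measurableEmbedding _)]
    refine lintegral_congr fun z => ?_
    rw [Fin.prod_univ_succ]
    rfl

theorem pi_withDensity (ρ : α → ENNReal) (hρ : Measurable ρ) [SigmaFinite (m.withDensity ρ)] :
    (Measure.pi fun _ : Fin n => m.withDensity ρ) =
      (Measure.pi fun _ : Fin n => m).withDensity fun z => ∏ i, ρ (z i) := by
  refine Measure.pi_eq fun s hs => ?_
  rw [withDensity_apply _ (MeasurableSet.univ_pi hs), ← lintegral_indicator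
    (MeasurableSet.univ_pi hs)]
  have : ∀ z : Fin n → α, (univ.pi s).indicator (fun z => ∏ i, ρ (z i)) z =
      ∏ i, (s i).indicator ρ (z i) := by
    intro z
    by_cases hz : z ∈ univ.pi s
    · rw [indicator_of_mem hz]
      exact Finset.prod_congr rfl fun i _ => (indicator_of_mem (hz i (mem_univ i)) _).symm
    · rw [indicator_of_notMem hz]
      simp only [mem_univ_pi, not_forall] at hz
      obtain ⟨i, hi⟩ := hz
      exact (Finset.prod_eq_zero (Finset.mem_univ i) (indicator_of_notMem hi _)).symm
  simp_rw [this]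
  rw [lintegral_pi_prod n _ fun i => hρ.indicator (hs i)]
  exact Finset.prod_congr rfl fun i _ => by
    rw [withDensity_apply _ (hs i), lintegral_indicator (hs i)]

end ProductMeasure

/-! ### Multiplication by the square root of a density -/

section Density

variable {α : Type*} [MeasurableSpace α] {m m' : Measure α} {w : α → ℝ}

theorem ae_mul_eq_of_ae_withDensity (hw : Measurable w)
    (hm : m' = m.withDensity fun x => ENNReal.ofReal (w x ^ 2)) {f g : α → ℂ}
    (h : f =ᵐ[m'] g) : (fun x => (w x : ℂ) * f x) =ᵐ[m] fun x => (w x : ℂ) * g x := by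
  rw [hm] at h
  have h2 := (ae_withDensity_iff (by fun_prop)).1 h
  filter_upwards [h2] with x hx
  rcases eq_or_ne (w x) 0 with h0 | h0
  · simp [h0]
  · rw [hx (by positivity)]

theorem integral_eq_of_withDensity (hw : Measurable w)
    (hm : m' = m.withDensity fun x => ENNReal.ofReal (w x ^ 2)) (f : α → ℂ) :
    ∫ x, f x ∂m' = ∫ x, ((w x ^ 2 : ℝ) : ℂ) * f x ∂m := by
  rw [hm, integral_withDensity_eq_integral_toReal_smul (by fun_prop)
    (Filter.Eventually.of_forall fun _ => ENNReal.ofReal_lt_top)]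
  refine integral_congr_ae (Filter.Eventually.of_forall fun x => ?_)
  simp only
  rw [ENNReal.toReal_ofReal (sq_nonneg _), Complex.real_smul]

theorem memLp_mul_of_withDensity (hw : Measurable w)
    (hm : m' = m.withDensity fun x => ENNReal.ofReal (w x ^ 2)) {f : α → ℂ}
    (hf : MemLp f 2 m') : MemLp (fun x => (w x : ℂ) * f x) 2 m := by
  obtain ⟨g, hg, hfg⟩ := hf.1
  have hgL : MemLp g 2 m' := hf.ae_eq hfg
  have hgm : AEStronglyMeasurable (fun x => (w x : ℂ) * g x) m :=
    ((Complex.measurable_ofReal.comp hw).mul hg.measurable).aestronglyMeasurable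
  refine MemLp.ae_eq (ae_mul_eq_of_ae_withDensity hw hm hfg).symm ?_
  refine (memLp_two_iff_integrable_sq_norm hgm).2 ?_
  have h := (memLp_two_iff_integrable_sq_norm hgL.1).1 hgL
  rw [hm, integrable_withDensity_iff_integrable_smul' (by fun_prop)
    (Filter.Eventually.of_forall fun _ => ENNReal.ofReal_lt_top)] at h
  refine h.congr (Filter.Eventually.of_forall fun x => ?_)
  simp only
  rw [ENNReal.toReal_ofReal (sq_nonneg _), norm_mul, mul_pow, Complex.norm_real, Real.norm_eq_abs,
    sq_abs, smul_eq_mul]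

/-- Multiplication by `w`, as a map from `L²(w² m)` to `L²(m)`. -/
def mulLp (hw : Measurable w) (hm : m' = m.withDensity fun x => ENNReal.ofReal (w x ^ 2)) :
    Lp ℂ 2 m' →ₗ[ℂ] Lp ℂ 2 m where
  toFun f := (memLp_mul_of_withDensity hw hm (Lp.memLp f)).toLp _
  map_add' f g := by
    rw [← MemLp.toLp_add]
    refine MemLp.toLp_congr _ _ ?_
    filter_upwards [ae_mul_eq_of_ae_withDensity hw hm (Lp.coeFn_add f g)] with x hx
    rw [hx, Pi.add_apply, Pi.add_apply, mul_add]
  map_smul' c f := by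
    rw [RingHom.id_apply, ← MemLp.toLp_const_smul]
    refine MemLp.toLp_congr _ _ ?_
    filter_upwards [ae_mul_eq_of_ae_withDensity hw hm (Lp.coeFn_smul c f)] with x hx
    rw [hx, Pi.smul_apply, Pi.smul_apply, mul_smul_comm]

theorem coeFn_mulLp (hw : Measurable w)
    (hm : m' = m.withDensity fun x => ENNReal.ofReal (w x ^ 2)) (f : Lp ℂ 2 m') :
    mulLp hw hm f =ᵐ[m] fun x => (w x : ℂ) * f x :=
  MemLp.coeFn_toLp (memLp_mul_of_withDensity hw hm (Lp.memLp f))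

theorem inner_mulLp (hw : Measurable w)
    (hm : m' = m.withDensity fun x => ENNReal.ofReal (w x ^ 2)) (f g : Lp ℂ 2 m') :
    inner ℂ (mulLp hw hm f) (mulLp hw hm g) = inner ℂ f g := by
  rw [L2.inner_def, L2.inner_def, integral_eq_of_withDensity hw hm]
  refine integral_congr_ae ?_
  filter_upwards [coeFn_mulLp hw hm f, coeFn_mulLp hw hm g] with x h1 h2
  rw [h1, h2]
  simp only [RCLike.inner_apply, map_mul, Complex.conj_ofReal]
  push_cast
  ring

theorem norm_mulLp (hw : Measurable w)
    (hm : m' = m.withDensity fun x => ENNReal.ofReal (w x ^ 2)) (f : Lp ℂ 2 m') :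
    ‖mulLp hw hm f‖ = ‖f‖ := by
  rw [norm_eq_sqrt_re_inner (𝕜 := ℂ), inner_mulLp, ← norm_eq_sqrt_re_inner]

end Density

/-! ### The kernels `f̂` -/

section Hat

/-- The weight `√c_H |ξ|^{1/2-H}` at `z = (t, ξ)`, the square root of the density of
`dt μ_H(dξ)`. -/
def sqrtWeight (H : Ioo (0 : ℝ) 1) (z : ℝ × ℝ) : ℝ :=
  Real.sqrt (cH H) * |z.2| ^ (1 / 2 - (H : ℝ))

theorem measurable_sqrtWeight (H : Ioo (0 : ℝ) 1) : Measurable (sqrtWeight H) := by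
  unfold sqrtWeight; fun_prop

theorem sqrtWeight_sq (H : Ioo (0 : ℝ) 1) (z : ℝ × ℝ) :
    sqrtWeight H z ^ 2 = cH H * |z.2| ^ (1 - 2 * (H : ℝ)) := by
  rw [sqrtWeight, mul_pow, Real.sq_sqrt (cH_pos H).le, ← Real.rpow_natCast (|z.2| ^ _),
    ← Real.rpow_mul (abs_nonneg _)]
  congr 2
  push_cast
  ring

theorem nuH_eq_withDensity (H : Ioo (0 : ℝ) 1) :
    nuH H = lebHalf.withDensity fun z => ENNReal.ofReal (sqrtWeight H z ^ 2) := by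
  have h : Measurable fun ξ : ℝ => ENNReal.ofReal (cH H * |ξ| ^ (1 - 2 * (H : ℝ))) := by fun_prop
  rw [nuH, muH, prod_withDensity_right h]
  simp_rw [sqrtWeight_sq]
  rfl

theorem pi_nuH_eq_withDensity (H : Ioo (0 : ℝ) 1) (n : ℕ) :
    (Measure.pi fun _ : Fin n => nuH H) = (Measure.pi fun _ : Fin n => lebHalf).withDensity
      fun z => ENNReal.ofReal ((∏ i, sqrtWeight H (z i)) ^ 2) := by
  have : SigmaFinite (lebHalf.withDensity fun z => ENNReal.ofReal (sqrtWeight H z ^ 2)) := by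
    rw [← nuH_eq_withDensity]; infer_instance
  have hm := measurable_sqrtWeight H
  simp_rw [nuH_eq_withDensity H]
  rw [pi_withDensity _ (by fun_prop)]
  congr 1
  funext z
  rw [← Finset.prod_pow, ENNReal.ofReal_prod_of_nonneg fun i _ => sq_nonneg _]

theorem measurable_prod_sqrtWeight (H : Ioo (0 : ℝ) 1) (n : ℕ) :
    Measurable fun z : Fin n → ℝ × ℝ => ∏ i, sqrtWeight H (z i) :=
  Finset.measurable_fun_prod _ fun i _ => (measurable_sqrtWeight H).comp (measurable_pi_apply i)

/-- Multiplication by the square root of the density, from `L²(dt μ_H)` to `L²(dt dξ)`. -/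
def hatOne (H : Ioo (0 : ℝ) 1) : Lp ℂ 2 (nuH H) →ₗ[ℂ] Lp ℂ 2 lebHalf :=
  mulLp (measurable_sqrtWeight H) (nuH_eq_withDensity H)

/-- The kernel `f̂`, as an element of `L²((dt dξ)^n)`. -/
def hatLp {H : Ioo (0 : ℝ) 1} {n : ℕ} (f : TensorH H n) :
    Lp ℂ 2 (Measure.pi fun _ : Fin n => lebHalf) :=
  mulLp (measurable_prod_sqrtWeight H n) (pi_nuH_eq_withDensity H n) (fourierTensor H n f)

theorem hatKernel_eq {H : Ioo (0 : ℝ) 1} {n : ℕ} (f : TensorH H n) (z : Fin n → ℝ × ℝ) :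
    hatKernel f z = ((∏ i, sqrtWeight H (z i) : ℝ) : ℂ) * fourierTensor H n f z := by
  have h : cH H ^ ((n : ℝ) / 2) = Real.sqrt (cH H) ^ n := by
    rw [Real.sqrt_eq_rpow, ← Real.rpow_natCast, ← Real.rpow_mul (cH_pos H).le]
    congr 1
    ring
  simp only [hatKernel, sqrtWeight, Finset.prod_mul_distrib, h]
  simp
  ring

theorem memLp_hatKernel {H : Ioo (0 : ℝ) 1} {n : ℕ} (f : TensorH H n) :
    MemLp (hatKernel f) 2 (Measure.pi fun _ : Fin n => lebHalf) := by
  have := memLp_mul_of_withDensity (measurable_prod_sqrtWeight H n) (pi_nuH_eq_withDensity H n)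
    (Lp.memLp (fourierTensor H n f))
  exact this.ae_eq (Filter.Eventually.of_forall fun z => (hatKernel_eq f z).symm)

theorem toLp_hatKernel {H : Ioo (0 : ℝ) 1} {n : ℕ} (f : TensorH H n)
    (h : MemLp (hatKernel f) 2 (Measure.pi fun _ : Fin n => lebHalf)) :
    h.toLp _ = hatLp f :=
  MemLp.toLp_congr h (memLp_mul_of_withDensity (measurable_prod_sqrtWeight H n)
    (pi_nuH_eq_withDensity H n) (Lp.memLp (fourierTensor H n f)))
    (Filter.Eventually.of_forall fun z => hatKernel_eq f z)

theorem norm_fourierTensor {H : Ioo (0 : ℝ) 1} {n : ℕ} (f : TensorH H n) :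
    ‖fourierTensor H n f‖ = ‖f‖ := by
  induction f using UniformSpace.Completion.induction_on with
  | hp => exact isClosed_eq (fourierTensor H n).continuous.norm continuous_norm
  | ih x =>
    have h : fourierTensor H n (x : TensorH H n) = algFourier H n x :=
      ContinuousLinearMap.extend_eq _ UniformSpace.Completion.denseRange_coe
        (UniformSpace.Completion.isUniformInducing_coe _) x
    rw [h, UniformSpace.Completion.norm_coe]
    rfl

theorem norm_hatLp {H : Ioo (0 : ℝ) 1} {n : ℕ} (f : TensorH H n) : ‖hatLp f‖ = ‖f‖ := by
  rw [hatLp, norm_mulLp, norm_fourierTensor]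

/-- `f ↦ f̂` as a continuous real linear map. -/
def hatCLM (H : Ioo (0 : ℝ) 1) (n : ℕ) :
    TensorH H n →L[ℝ] Lp ℂ 2 (Measure.pi fun _ : Fin n => lebHalf) :=
  LinearMap.mkContinuous
    { toFun := hatLp
      map_add' := fun f g => by simp [hatLp]
      map_smul' := fun c f => by
        simp only [hatLp, map_smul, RingHom.id_apply]
        exact ((mulLp (measurable_prod_sqrtWeight H n)
          (pi_nuH_eq_withDensity H n)).restrictScalars ℝ).map_smul c _ }
    1 fun f => by rw [one_mul]; exact (norm_hatLp f).le

theorem hatLp_tensorH {H : Ioo (0 : ℝ) 1} {n : ℕ} (x : Fin n → HilbertH H) :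
    hatLp (tensorH x) = prodLp fun i => hatOne H (fourierH H (x i)) := by
  refine Lp.ext ?_
  have h3 : ∀ᵐ z ∂(Measure.pi fun _ : Fin n => lebHalf), ∀ j, ∀ i,
      hatOne H (fourierH H (x j)) (z i) = (sqrtWeight H (z i) : ℂ) * fourierH H (x j) (z i) :=
    ae_all_iff.2 fun j => ae_pi_of_ae (coeFn_mulLp (measurable_sqrtWeight H)
      (nuH_eq_withDensity H) (fourierH H (x j)))
  filter_upwards [coeFn_mulLp (measurable_prod_sqrtWeight H n) (pi_nuH_eq_withDensity H n)
    (fourierTensor H n (tensorH x)), ae_mul_eq_of_ae_withDensity (measurable_prod_sqrtWeight H n)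
    (pi_nuH_eq_withDensity H n) (fourierTensor_tensorH x),
    coeFn_prodLp fun i => hatOne H (fourierH H (x i)), h3] with z h1 h2 h4 h3
  rw [h4]
  refine h1.trans (h2.trans ?_)
  simp_rw [h3]
  rw [Finset.prod_mul_distrib]
  push_cast
  rfl

end Hat

/-! ### Continuous extension of a bounded linear relation -/

section Extension

variable {𝕜 E F : Type*} [RCLike 𝕜] [NormedAddCommGroup E] [NormedSpace 𝕜 E]
  [NormedAddCommGroup F] [NormedSpace 𝕜 F]

/-- A linear relation that is bounded and whose domain is dense has an everywhere defined
closure. -/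
theorem exists_mem_topologicalClosure_span [CompleteSpace F] {S : Set (E × F)} {C : ℝ}
    (hC : ∀ p ∈ Submodule.span 𝕜 S, ‖p.2‖ ≤ C * ‖p.1‖)
    (hd : (Submodule.span 𝕜 (Prod.fst '' S)).topologicalClosure = ⊤) (x : E) :
    ∃ y, (x, y) ∈ (Submodule.span 𝕜 S).topologicalClosure := by
  have hx : x ∈ closure (Prod.fst '' (Submodule.span 𝕜 S : Set (E × F))) := by
    have h1 : Submodule.span 𝕜 (Prod.fst '' S) =
        (Submodule.span 𝕜 S).map (LinearMap.fst 𝕜 E F) := by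
      rw [Submodule.map_span]; rfl
    have h2 : x ∈ (Submodule.span 𝕜 (Prod.fst '' S)).topologicalClosure := by rw [hd]; trivial
    rw [h1] at h2
    exact h2
  obtain ⟨a, ha, hax⟩ := mem_closure_iff_seq_limit.1 hx
  choose u hu hua using ha
  have hcau : CauchySeq fun k => (u k).2 := by
    have h1 : CauchySeq a := hax.cauchySeq
    have hC' : ∀ k l, dist (u k).2 (u l).2 ≤ |C| * dist (a k) (a l) := by
      intro k l
      have := hC (u k - u l) (Submodule.sub_mem _ (hu k) (hu l))
      rw [dist_eq_norm, dist_eq_norm, ← hua, ← hua]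
      exact this.trans (mul_le_mul_of_nonneg_right (le_abs_self C) (norm_nonneg _))
    rw [Metric.cauchySeq_iff] at h1 ⊢
    intro ε hε
    obtain ⟨N, hN⟩ := h1 (ε / (|C| + 1)) (by positivity)
    refine ⟨N, fun k hk l hl => (hC' k l).trans_lt ?_⟩
    have h2 := hN k hk l hl
    rw [lt_div_iff₀ (by positivity)] at h2
    nlinarith [dist_nonneg (x := a k) (y := a l)]
  obtain ⟨y, hy⟩ := cauchySeq_tendsto_of_complete hcau
  refine ⟨y, ?_⟩
  have hlim : Filter.Tendsto u Filter.atTop (nhds (x, y)) := by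
    have h1 : Filter.Tendsto (fun k => (u k).1) Filter.atTop (nhds x) := by simpa [hua] using hax
    exact h1.prodMk_nhds hy
  exact mem_closure_of_tendsto hlim (Filter.Eventually.of_forall hu)

/-- Two continuous linear maps that agree on a set agree on its closed span. -/
theorem eq_of_mem_topologicalClosure_span {S : Set E} (A B : E →L[𝕜] F)
    (h : ∀ p ∈ S, A p = B p) {p : E} (hp : p ∈ (Submodule.span 𝕜 S).topologicalClosure) :
    A p = B p :=
  ContinuousLinearMap.eqOn_closure_span (fun p hp => h p hp) hp

end Extension

/-! ### Density of off-diagonal rectangles -/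

section OffDiagonal

variable {n : ℕ}

theorem lebHalf_eq_restrict :
    lebHalf = (volume : Measure (ℝ × ℝ)).restrict (Ici 0 ×ˢ univ) := by
  rw [lebHalf, Measure.volume_eq_prod, ← Measure.prod_restrict, Measure.restrict_univ]

theorem lebHalf_fst_eq (c : ℝ) : lebHalf {z | z.1 = c} = 0 := by
  have : {z : ℝ × ℝ | z.1 = c} = {c} ×ˢ univ := by ext z; simp
  rw [this, lebHalf, Measure.prod_prod]
  have : (volume.restrict (Ici (0 : ℝ))) {c} = 0 := by simp
  rw [this, zero_mul]

theorem ae_lebHalf_nonneg : ∀ᵐ z ∂lebHalf, 0 ≤ z.1 :=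
  Measure.quasiMeasurePreserving_fst.ae (ae_restrict_mem measurableSet_Ici)

/-- Almost every point of `(ℝ₊ × ℝ)^n` has distinct time coordinates. -/
theorem ae_fst_ne (i j : Fin n) (hij : i ≠ j) :
    ∀ᵐ z ∂(Measure.pi fun _ : Fin n => lebHalf), (z i).1 ≠ (z j).1 := by
  cases n with
  | zero => exact i.elim0
  | succ n =>
    obtain ⟨j', rfl⟩ := Fin.exists_succAbove_eq hij.symm
    have hmp := measurePreserving_piFinSuccAbove (fun _ : Fin (n + 1) => lebHalf) i
    have hmeas : MeasurableSet {x : (ℝ × ℝ) × (Fin n → ℝ × ℝ) | x.1.1 = (x.2 j').1} :=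
      measurableSet_eq_fun (by fun_prop)
        (measurable_fst.comp ((measurable_pi_apply j').comp measurable_snd))
    have hnull : (lebHalf.prod (Measure.pi fun _ : Fin n => lebHalf))
        {x : (ℝ × ℝ) × (Fin n → ℝ × ℝ) | x.1.1 = (x.2 j').1} = 0 := by
      rw [Measure.prod_apply_symm hmeas]
      refine lintegral_eq_zero_of_ae_eq_zero (Filter.Eventually.of_forall fun f => ?_)
      exact lebHalf_fst_eq (f j').1
    have h2 : ∀ᵐ x ∂(lebHalf.prod (Measure.pi fun _ : Fin n => lebHalf)),
        x.1.1 ≠ (x.2 j').1 := by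
      rw [ae_iff]; simpa using hnull
    exact hmp.quasiMeasurePreserving.ae h2

theorem measure_lebHalf_lt_top {A : Set (ℝ × ℝ)} (hA : Bornology.IsBounded A) :
    lebHalf A < ⊤ := by
  refine lt_of_le_of_lt ?_ (hA.measure_lt_top (μ := (volume : Measure (ℝ × ℝ))))
  rw [lebHalf_eq_restrict]
  exact Measure.restrict_apply_le _ _

theorem measurableSet_pi_bounded (A : Fin n → BoundedBorel) :
    MeasurableSet (univ.pi fun i => (A i).1) := MeasurableSet.univ_pi fun i => (A i).2.1

theorem measure_pi_bounded_ne_top (A : Fin n → BoundedBorel) :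
    (Measure.pi fun _ : Fin n => lebHalf) (univ.pi fun i => (A i).1) ≠ ⊤ := by
  rw [Measure.pi_pi]
  exact ENNReal.prod_ne_top fun i _ => (measure_lebHalf_lt_top (A i).2.2.1).ne

/-- The off-diagonal condition on the sets `A_1,…,A_n`. -/
def OffDiagonal (A : Fin n → BoundedBorel) : Prop :=
  ∀ i j, i ≠ j → Disjoint (A i).1 (A j).1 ∧ Disjoint (A i).1 (reflectSet (A j).1)

/-- The indicator function `1_{A_1 × ⋯ × A_n}` in `L²`. -/
def rectLp (A : Fin n → BoundedBorel) : Lp ℂ 2 (Measure.pi fun _ : Fin n => lebHalf) :=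
  indicatorConstLp 2 (measurableSet_pi_bounded A) (measure_pi_bounded_ne_top A) 1

/-- The set of the points `(t, x)` of `ℝ₊ × ℝ` with `t, |x| ≤ M` and `⌊N t⌋ = k_i`. -/
def timeBox (N M : ℕ) (k : Fin n → ℤ) (i : Fin n) : Set (ℝ × ℝ) :=
  {z | ⌊(N : ℝ) * z.1⌋ = k i} ∩ (Ici 0 ×ˢ univ) ∩ Metric.closedBall 0 M

theorem measurableSet_timeBox (N M : ℕ) (k : Fin n → ℤ) (i : Fin n) :
    MeasurableSet (timeBox N M k i) := by
  refine MeasurableSet.inter (MeasurableSet.inter ?_ (measurableSet_Ici.prod MeasurableSet.univ))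
    Metric.isClosed_closedBall.measurableSet
  exact measurableSet_eq_fun (Int.measurable_floor.comp (by fun_prop)) measurable_const

/-- Every measurable rectangle inside a product of time boxes with distinct time intervals is
off-diagonal, so that orthogonality to rectangles passes to all measurable subsets by a `π`-`λ`
argument. -/
theorem ae_eq_zero_on_timeBox_of_rect {g : (Fin n → ℝ × ℝ) → ℂ}
    (hg : MemLp g 2 (Measure.pi fun _ : Fin n => lebHalf))
    (h : ∀ A : Fin n → BoundedBorel, OffDiagonal A →
      ∫ z in univ.pi fun i => (A i).1, g z ∂(Measure.pi fun _ : Fin n => lebHalf) = 0)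
    (N M : ℕ) {k : Fin n → ℤ} (hk : Function.Injective k) :
    ∀ᵐ z ∂(Measure.pi fun _ : Fin n => lebHalf), z ∈ univ.pi (timeBox N M k) → g z = 0 := by
  set μ := Measure.pi fun _ : Fin n => lebHalf
  set B := univ.pi (timeBox N M k) with hB
  have hBm : MeasurableSet B := MeasurableSet.univ_pi (measurableSet_timeBox N M k)
  have hsub : ∀ i, timeBox N M k i ⊆ Metric.closedBall 0 M := fun i z hz => hz.2
  have hBfin : μ B < ⊤ := by
    rw [hB, Measure.pi_pi]
    exact ENNReal.prod_lt_top fun i _ =>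
      measure_lebHalf_lt_top (Metric.isBounded_closedBall.subset (hsub i))
  have hint : IntegrableOn g B μ := by
    have : IsFiniteMeasure (μ.restrict B) := ⟨by simpa using hBfin⟩
    exact (hg.restrict B).integrable (by norm_num)
  have hrect : ∀ s : Fin n → Set (ℝ × ℝ), (∀ i, MeasurableSet (s i)) →
      ∫ z in univ.pi s ∩ B, g z ∂μ = 0 := by
    intro s hs
    rw [hB, ← pi_inter_distrib]
    refine h (fun i => ⟨s i ∩ timeBox N M k i, (hs i).inter (measurableSet_timeBox N M k i),
      Metric.isBounded_closedBall.subset (inter_subset_right.trans (hsub i)),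
      fun z hz => hz.2.1.2⟩) fun i j hij => ?_
    have hd : ∀ z w : ℝ × ℝ, z ∈ timeBox N M k i → w ∈ timeBox N M k j → z.1 ≠ w.1 := by
      intro z w hz hw hzw
      have h1 : ⌊(N : ℝ) * z.1⌋ = k i := hz.1.1
      have h2 : ⌊(N : ℝ) * w.1⌋ = k j := hw.1.1
      exact hij (hk (by rw [← h1, ← h2, hzw]))
    exact ⟨disjoint_left.2 fun z hz hz' => hd z z hz.2 hz'.2 rfl,
      disjoint_left.2 fun z hz hz' => hd z (z.1, -z.2) hz.2 hz'.2 rfl⟩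
  have hall : ∀ S, MeasurableSet S → ∫ z in S ∩ B, g z ∂μ = 0 := by
    intro S hS
    induction S, hS using MeasurableSpace.induction_on_inter
      (generateFrom_pi (α := fun _ : Fin n => ℝ × ℝ)).symm isPiSystem_pi with
    | empty => simp
    | basic S hS =>
      obtain ⟨s, hs, rfl⟩ := hS
      exact hrect s fun i => hs i (mem_univ i)
    | compl S hS ih =>
      have h2 : ∫ z in B, g z ∂μ = 0 := by
        simpa using hrect (fun _ => univ) fun _ => MeasurableSet.univ
      have h3 := integral_add_compl hS hint
      rw [Measure.restrict_restrict hS, Measure.restrict_restrict hS.compl, ih, h2, zero_add] at h3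
      exact h3
    | iUnion f hd hf ih =>
      rw [iUnion_inter, integral_iUnion (fun i => (hf i).inter hBm)
        (fun i j hij => (hd hij).mono inter_subset_left inter_subset_left)
        (hint.mono_set (iUnion_subset fun i => inter_subset_right))]
      simp [ih]
  have hz : g =ᵐ[μ.restrict B] 0 :=
    hint.ae_eq_zero_of_forall_setIntegral_eq_zero fun S hS _ => by
      rw [Measure.restrict_restrict hS]; exact hall S hS
  exact (ae_restrict_iff' hBm).1 hz

/-- A square integrable function orthogonal to all off-diagonal rectangles vanishes: off the null
set where two time coordinates agree, `(ℝ₊ × ℝ)^n` is a countable union of off-diagonal boxes. -/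
theorem ae_eq_zero_of_rect {g : (Fin n → ℝ × ℝ) → ℂ}
    (hg : MemLp g 2 (Measure.pi fun _ : Fin n => lebHalf))
    (h : ∀ A : Fin n → BoundedBorel, OffDiagonal A →
      ∫ z in univ.pi fun i => (A i).1, g z ∂(Measure.pi fun _ : Fin n => lebHalf) = 0) :
    g =ᵐ[Measure.pi fun _ : Fin n => lebHalf] 0 := by
  have h1 : ∀ᵐ z ∂(Measure.pi fun _ : Fin n => lebHalf), ∀ N M : ℕ, ∀ k : Fin n → ℤ,
      Function.Injective k → z ∈ univ.pi (timeBox N M k) → g z = 0 :=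
    ae_all_iff.2 fun N => ae_all_iff.2 fun M => ae_all_iff.2 fun k => by
      by_cases hk : Function.Injective k
      · filter_upwards [ae_eq_zero_on_timeBox_of_rect hg h N M hk] with z hz _
        exact hz
      · exact Filter.Eventually.of_forall fun z hk' => absurd hk' hk
  have h2 : ∀ᵐ z ∂(Measure.pi fun _ : Fin n => lebHalf), ∀ i j, i ≠ j → (z i).1 ≠ (z j).1 :=
    ae_all_iff.2 fun i => ae_all_iff.2 fun j => by
      by_cases hij : i = j
      · exact Filter.Eventually.of_forall fun z hij' => absurd hij hij'
      · filter_upwards [ae_fst_ne i j hij] with z hz _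
        exact hz
  filter_upwards [h1, h2, ae_pi_of_ae (n := n) ae_lebHalf_nonneg] with z h1 h2 h3
  -- For large `N`, distinct times have distinct integer parts `⌊N t⌋`.
  have hN : ∀ᶠ N : ℕ in Filter.atTop, ∀ i j, i ≠ j →
      ⌊(N : ℝ) * (z i).1⌋ ≠ ⌊(N : ℝ) * (z j).1⌋ := by
    refine Filter.eventually_all.2 fun i => Filter.eventually_all.2 fun j => ?_
    by_cases hij : i = j
    · exact Filter.Eventually.of_forall fun N hij' => absurd hij hij'
    · have hpos : 0 < |(z i).1 - (z j).1| := abs_pos.2 (sub_ne_zero.2 (h2 i j hij))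
      obtain ⟨N₀, hN₀⟩ := exists_nat_gt (1 / |(z i).1 - (z j).1|)
      filter_upwards [Filter.eventually_ge_atTop N₀] with N hN _ hfl
      have h4 := Int.abs_sub_lt_one_of_floor_eq_floor hfl
      rw [← mul_sub, abs_mul, Nat.abs_cast] at h4
      rw [div_lt_iff₀ hpos] at hN₀
      have : (N₀ : ℝ) ≤ N := by exact_mod_cast hN
      nlinarith
  obtain ⟨N, hN⟩ := hN.exists
  obtain ⟨M, hM⟩ := exists_nat_ge ‖z‖
  refine h1 N M (fun i => ⌊(N : ℝ) * (z i).1⌋) (fun i j hij => ?_)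
    fun i _ => ⟨⟨rfl, h3 i, trivial⟩, ?_⟩
  · by_contra hne
    exact hN i j hne hij
  · rw [mem_closedBall_zero_iff]
    exact (norm_le_pi_norm z i).trans hM

/-- The indicator functions of off-diagonal rectangles are total. -/
theorem topologicalClosure_span_rectLp :
    (Submodule.span ℂ {g | ∃ A : Fin n → BoundedBorel, OffDiagonal A ∧ g = rectLp A}
      ).topologicalClosure = ⊤ := by
  rw [Submodule.topologicalClosure_eq_top_iff, Submodule.eq_bot_iff]
  intro g hg
  have : g =ᵐ[Measure.pi fun _ : Fin n => lebHalf] 0 := by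
    refine ae_eq_zero_of_rect (Lp.memLp g) fun A hA => ?_
    rw [← L2.inner_indicatorConstLp_one (𝕜 := ℂ) (measurableSet_pi_bounded A)
      (measure_pi_bounded_ne_top A) g]
    exact (Submodule.mem_orthogonal _ _).1 hg _ (Submodule.subset_span ⟨A, hA, rfl⟩)
  exact (Lp.eq_zero_iff_ae_eq_zero).2 this

end OffDiagonal

/-! ### Indicator functions of rectangles in `ℋ_H` -/

section Rectangles

/-- The spatial Fourier transform of the indicator function of `[0,t] × [0,x]`, `w = (t, x)`. -/
def rectFourier (w z : ℝ × ℝ) : ℂ :=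
  (Icc 0 w.1).indicator (fun _ => fourierInterval w.2 z.2) z.1

theorem continuous_fourierInterval : Continuous fun p : ℝ × ℝ => fourierInterval p.1 p.2 := by
  unfold fourierInterval
  exact intervalIntegral.continuous_parametric_intervalIntegral_of_continuous
    (f := fun (p : ℝ × ℝ) (y : ℝ) => Complex.exp (-(Complex.I * (p.2 : ℂ) * (y : ℂ))))
    (by fun_prop) continuous_fst

theorem norm_cexp_neg_I_mul (ξ y : ℝ) :
    ‖Complex.exp (-(Complex.I * (ξ : ℂ) * (y : ℂ)))‖ = 1 := by
  rw [Complex.norm_exp]; simp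

theorem hasDerivAt_fourierInterval (ξ y : ℝ) : HasDerivAt (fun y => fourierInterval y ξ)
    (Complex.exp (-(Complex.I * (ξ : ℂ) * (y : ℂ)))) y := by
  have hc : Continuous fun y : ℝ => Complex.exp (-(Complex.I * (ξ : ℂ) * (y : ℂ))) := by fun_prop
  exact intervalIntegral.integral_hasDerivAt_right (hc.intervalIntegrable _ _)
    (hc.stronglyMeasurableAtFilter _ _) hc.continuousAt

theorem hasDerivAt_cexp_neg_I_mul (ξ y : ℝ) :
    HasDerivAt (fun y : ℝ => Complex.exp (-(Complex.I * (ξ : ℂ) * (y : ℂ))))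
      (-(Complex.I * (ξ : ℂ)) * Complex.exp (-(Complex.I * (ξ : ℂ) * (y : ℂ)))) y := by
  have h1 : HasDerivAt (fun y : ℝ => -(Complex.I * (ξ : ℂ) * (y : ℂ)))
      (-(Complex.I * (ξ : ℂ))) y := by
    have h2 := ((Complex.ofRealCLM.hasDerivAt (x := y)).const_mul (Complex.I * (ξ : ℂ))).neg
    simp only [Complex.ofRealCLM_apply, Complex.ofReal_one, mul_one] at h2
    exact h2
  simpa [mul_comm] using h1.cexp

theorem I_mul_fourierInterval (x ξ : ℝ) : Complex.I * (ξ : ℂ) * fourierInterval x ξ =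
    1 - Complex.exp (-(Complex.I * (ξ : ℂ) * (x : ℂ))) := by
  have h := intervalIntegral.integral_eq_sub_of_hasDerivAt
    (fun y _ => hasDerivAt_cexp_neg_I_mul ξ y) (a := 0) (b := x)
    (Continuous.intervalIntegrable (by fun_prop) _ _)
  rw [intervalIntegral.integral_const_mul] at h
  simp only [Complex.ofReal_zero, mul_zero, neg_zero, Complex.exp_zero] at h
  rw [fourierInterval]
  linear_combination -h

/-- A bound with the decay that makes rectangles square integrable for `μ_H`, from
`|𝓕1_{[0,x]}(ξ)| ≤ |x|` and `|ξ 𝓕1_{[0,x]}(ξ)| ≤ 2`. -/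
theorem norm_fourierInterval_sq_le (x ξ : ℝ) :
    ‖fourierInterval x ξ‖ ^ 2 ≤ (x ^ 2 + 4) * (1 + ξ ^ 2)⁻¹ := by
  have h1 : ‖fourierInterval x ξ‖ ≤ |x| := by
    have := intervalIntegral.norm_integral_le_of_norm_le_const (a := 0) (b := x) (C := 1)
      (f := fun y : ℝ => Complex.exp (-(Complex.I * (ξ : ℂ) * (y : ℂ))))
      fun y _ => (norm_cexp_neg_I_mul ξ y).le
    simpa [fourierInterval] using this
  have h2 : |ξ| * ‖fourierInterval x ξ‖ ≤ 2 := by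
    have h3 := congrArg norm (I_mul_fourierInterval x ξ)
    rw [norm_mul, norm_mul, Complex.norm_I, one_mul, Complex.norm_real, Real.norm_eq_abs] at h3
    rw [h3]
    refine (norm_sub_le _ _).trans ?_
    rw [norm_cexp_neg_I_mul, norm_one]
    norm_num
  have h3 : ‖fourierInterval x ξ‖ ^ 2 ≤ x ^ 2 := by
    rw [← sq_abs x]; exact pow_le_pow_left₀ (norm_nonneg _) h1 2
  have h4 : (|ξ| * ‖fourierInterval x ξ‖) ^ 2 ≤ 2 ^ 2 := pow_le_pow_left₀ (by positivity) h2 2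
  rw [mul_pow, sq_abs] at h4
  rw [← div_eq_mul_inv, le_div_iff₀ (by positivity)]
  nlinarith

theorem integrable_nuH_bound (H : Ioo (0 : ℝ) 1) (a b C : ℝ) :
    Integrable (fun z : ℝ × ℝ => (Icc a b).indicator (fun _ => C) z.1 * (1 + z.2 ^ 2)⁻¹)
      (nuH H) := by
  unfold nuH
  refine Integrable.mul_prod ?_ (integrable_muH_density H)
  exact ((integrable_indicator_iff measurableSet_Icc).2 (by simp)).restrict

theorem measurable_rectFourier (w : ℝ × ℝ) : Measurable (rectFourier w) := by
  have h : Measurable fun z : ℝ × ℝ => fourierInterval w.2 z.2 :=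
    (continuous_fourierInterval.comp (continuous_const.prodMk continuous_snd)).measurable
  have : rectFourier w = (Prod.fst ⁻¹' Icc (0 : ℝ) w.1).indicator
      fun z => fourierInterval w.2 z.2 := by
    funext z
    simp only [rectFourier, indicator, mem_preimage]
  rw [this]
  exact h.indicator (measurable_fst measurableSet_Icc)

theorem norm_rectFourier_sq_le {w : ℝ × ℝ} {M : ℝ} (hw : ‖w‖ ≤ M) (z : ℝ × ℝ) :
    ‖rectFourier w z‖ ^ 2 ≤ (Icc 0 M).indicator (fun _ => M ^ 2 + 4) z.1 * (1 + z.2 ^ 2)⁻¹ := by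
  have h1 : |w.1| ≤ M := (norm_fst_le w).trans hw
  have h2 : |w.2| ≤ M := (norm_snd_le w).trans hw
  by_cases hz : z.1 ∈ Icc 0 w.1
  · have hz' : z.1 ∈ Icc 0 M := ⟨hz.1, hz.2.trans ((le_abs_self _).trans h1)⟩
    rw [rectFourier, indicator_of_mem hz, indicator_of_mem hz']
    refine (norm_fourierInterval_sq_le _ _).trans ?_
    refine mul_le_mul_of_nonneg_right ?_ (by positivity)
    have : w.2 ^ 2 ≤ M ^ 2 := by rw [← sq_abs]; exact pow_le_pow_left₀ (abs_nonneg _) h2 2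
    linarith
  · rw [rectFourier, indicator_of_notMem hz, norm_zero, zero_pow two_ne_zero]
    refine mul_nonneg (indicator_nonneg (fun _ _ => by positivity) _) (by positivity)

theorem memLp_rectFourier (H : Ioo (0 : ℝ) 1) (w : ℝ × ℝ) : MemLp (rectFourier w) 2 (nuH H) := by
  refine (memLp_two_iff_integrable_sq_norm (measurable_rectFourier w).aestronglyMeasurable).2 ?_
  refine (integrable_nuH_bound H 0 ‖w‖ (‖w‖ ^ 2 + 4)).mono'
    ((measurable_rectFourier w).norm.pow_const 2).aestronglyMeasurable
    (Filter.Eventually.of_forall fun z => ?_)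
  rw [Real.norm_of_nonneg (by positivity)]
  exact norm_rectFourier_sq_le le_rfl z

/-- An element of `L²(dt μ_H)` which is a dominated pointwise limit of Fourier transforms of test
functions is the Fourier transform of an element of `ℋ_H`. -/
theorem exists_fourierH_eq (H : Ioo (0 : ℝ) 1) {g : ℝ × ℝ → ℂ} (hg : MemLp g 2 (nuH H))
    (φ : ℕ → ℝ × ℝ → ℝ) (hφ : ∀ k, φ k ∈ testSubmodule) {K : ℝ × ℝ → ℝ} (hK : Integrable K (nuH H))
    (hb : ∀ k, ∀ z, ‖spaceFourier (φ k) z‖ ^ 2 ≤ K z)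
    (hlim : ∀ᵐ z ∂(nuH H), Filter.Tendsto (fun k => spaceFourier (φ k) z) Filter.atTop
      (nhds (g z))) :
    ∃ h : HilbertH H, fourierH H h =ᵐ[nuH H] g := by
  let φ' : ℕ → TestFunction H := fun k => ⟨φ k, hφ k⟩
  have hiso : Isometry (fourierH H) :=
    AddMonoidHomClass.isometry_of_norm _ (norm_fourierH H)
  have hclosed : IsClosed (range (fourierH H)) := hiso.isClosedEmbedding.isClosed_range
  have htend : Filter.Tendsto (fun k => testFourier H (φ' k)) Filter.atTop (nhds (hg.toLp g)) := by
    rw [tendsto_iff_norm_sub_tendsto_zero]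
    have hsq : ∀ k, ‖testFourier H (φ' k) - hg.toLp g‖ ^ 2 =
        ∫ z, ‖spaceFourier (φ k) z - g z‖ ^ 2 ∂(nuH H) := by
      intro k
      have h1 : ‖testFourier H (φ' k) - hg.toLp g‖ ^ 2 =
          RCLike.re (inner ℂ (testFourier H (φ' k) - hg.toLp g)
            (testFourier H (φ' k) - hg.toLp g)) :=
        (inner_self_eq_norm_sq (𝕜 := ℂ) _).symm
      rw [h1, L2.inner_def, ← integral_re (L2.integrable_inner _ _)]
      refine integral_congr_ae ?_
      filter_upwards [Lp.coeFn_sub (testFourier H (φ' k)) (hg.toLp g),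
        (memLp_spaceFourier H (hφ k)).coeFn_toLp, hg.coeFn_toLp] with z h2 h3 h4
      have h3' : testFourier H (φ' k) z = spaceFourier (φ k) z := h3
      rw [h2, Pi.sub_apply, h3', h4]
      exact inner_self_eq_norm_sq (𝕜 := ℂ) _
    have hgK : ∀ᵐ z ∂(nuH H), ‖g z‖ ^ 2 ≤ K z := by
      filter_upwards [hlim] with z hz
      exact le_of_tendsto (hz.norm.pow 2) (Filter.Eventually.of_forall fun k => hb k z)
    have hint : Filter.Tendsto (fun k => ∫ z, ‖spaceFourier (φ k) z - g z‖ ^ 2 ∂(nuH H))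
        Filter.atTop (nhds (∫ _, (0 : ℝ) ∂(nuH H))) := by
      refine tendsto_integral_of_dominated_convergence (fun z => 4 * K z) (fun k => ?_)
        (hK.const_mul 4) (fun k => ?_) ?_
      · exact ((memLp_spaceFourier H (hφ k)).1.sub hg.1).norm.pow 2
      · filter_upwards [hgK] with z hz
        rw [Real.norm_of_nonneg (by positivity)]
        have h1 := hb k z
        have h2 := norm_sub_le (spaceFourier (φ k) z) (g z)
        have h3 : ‖spaceFourier (φ k) z - g z‖ ^ 2 ≤ (‖spaceFourier (φ k) z‖ + ‖g z‖) ^ 2 :=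
          pow_le_pow_left₀ (norm_nonneg _) h2 2
        nlinarith [sq_nonneg (‖spaceFourier (φ k) z‖ - ‖g z‖)]
      · filter_upwards [hlim] with z hz
        have := ((hz.sub_const (g z)).norm.pow 2)
        simpa using this
    rw [integral_zero] at hint
    simp_rw [← hsq] at hint
    have h2 := hint.sqrt
    simpa [Real.sqrt_sq] using h2
  have hmem : hg.toLp g ∈ range (fourierH H) :=
    hclosed.mem_of_tendsto htend (Filter.Eventually.of_forall fun k =>
      ⟨(φ' k : HilbertH H), fourierH_coe H (φ' k)⟩)
  obtain ⟨h, hh⟩ := hmem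
  exact ⟨h, by rw [hh]; exact hg.coeFn_toLp⟩

/-! #### Mollification -/

/-- A smooth approximation of the indicator function of `[0,t]` on the half-line. -/
def timeCutoff (t : ℝ) (k : ℕ) (s : ℝ) : ℝ :=
  Real.smoothTransition (s + 1) * Real.smoothTransition ((t - s) * (k + 1) + 1)

theorem contDiff_timeCutoff (t : ℝ) (k : ℕ) : ContDiff ℝ (⊤ : ℕ∞) (timeCutoff t k) := by
  unfold timeCutoff
  exact (Real.smoothTransition.contDiff.comp (by fun_prop)).mul
    (Real.smoothTransition.contDiff.comp (by fun_prop))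

theorem timeCutoff_nonneg (t : ℝ) (k : ℕ) (s : ℝ) : 0 ≤ timeCutoff t k s :=
  mul_nonneg (Real.smoothTransition.nonneg _) (Real.smoothTransition.nonneg _)

theorem timeCutoff_le_indicator (t : ℝ) (k : ℕ) (s : ℝ) :
    timeCutoff t k s ≤ (Icc (-1) (t + 1)).indicator (fun _ => 1) s := by
  by_cases hs : s ∈ Icc (-1) (t + 1)
  · rw [indicator_of_mem hs]
    exact mul_le_one₀ (Real.smoothTransition.le_one _) (Real.smoothTransition.nonneg _)
      (Real.smoothTransition.le_one _)
  · rw [indicator_of_notMem hs, timeCutoff]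
    rw [mem_Icc, not_and_or, not_le, not_le] at hs
    rcases hs with hs | hs
    · rw [Real.smoothTransition.zero_of_nonpos (by linarith), zero_mul]
    · have hk : (0 : ℝ) ≤ k := Nat.cast_nonneg k
      rw [Real.smoothTransition.zero_of_nonpos (x := (t - s) * (k + 1) + 1) (by nlinarith),
        mul_zero]

theorem hasCompactSupport_timeCutoff (t : ℝ) (k : ℕ) : HasCompactSupport (timeCutoff t k) :=
  HasCompactSupport.intro (isCompact_Icc (a := (-1 : ℝ)) (b := t + 1)) fun s hs => by
    have := timeCutoff_le_indicator t k s
    rw [indicator_of_notMem hs] at this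
    exact le_antisymm this (timeCutoff_nonneg t k s)

theorem tendsto_timeCutoff (t : ℝ) {s : ℝ} (hs : 0 ≤ s) :
    Filter.Tendsto (fun k => timeCutoff t k s) Filter.atTop
      (nhds ((Icc 0 t).indicator (fun _ => 1) s)) := by
  have h1 : Real.smoothTransition (s + 1) = 1 := Real.smoothTransition.one_of_one_le (by linarith)
  simp only [timeCutoff, h1, one_mul]
  rcases le_or_gt s t with h | h
  · rw [indicator_of_mem (show s ∈ Icc 0 t from ⟨hs, h⟩)]
    refine tendsto_const_nhds.congr fun k => (Real.smoothTransition.one_of_one_le ?_).symm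
    have hk : (0 : ℝ) ≤ k := Nat.cast_nonneg k
    nlinarith
  · rw [indicator_of_notMem (fun h' : s ∈ Icc 0 t => absurd h'.2 (not_le.2 h))]
    obtain ⟨N, hN⟩ := exists_nat_gt (1 / (s - t))
    have hst : 0 < s - t := sub_pos.2 h
    refine tendsto_const_nhds.congr' ?_
    filter_upwards [Filter.eventually_ge_atTop N] with k hk
    refine (Real.smoothTransition.zero_of_nonpos ?_).symm
    rw [div_lt_iff₀ hst] at hN
    have : (N : ℝ) ≤ k := by exact_mod_cast hk
    nlinarith

/-- A mollifier supported in the ball of radius `1/(k+1)`. -/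
def mollifierBump (k : ℕ) : ContDiffBump (0 : ℝ) where
  rIn := 1 / (2 * ((k : ℝ) + 1))
  rOut := 1 / ((k : ℝ) + 1)
  rIn_pos := by positivity
  rIn_lt_rOut := by
    refine one_div_lt_one_div_of_lt (by positivity) ?_
    have : (0 : ℝ) ≤ k := Nat.cast_nonneg k
    linarith

theorem tendsto_mollifierBump : Filter.Tendsto (fun k => (mollifierBump k).rOut) Filter.atTop
    (nhds 0) := tendsto_one_div_add_atTop_nhds_zero_nat

/-- The Fourier transform of the mollifier. -/
def mollifierFourier (k : ℕ) (ξ : ℝ) : ℂ :=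
  ∫ y : ℝ, Complex.exp (-(Complex.I * (ξ : ℂ) * (y : ℂ))) *
    (((mollifierBump k).normed volume y : ℝ) : ℂ)

theorem norm_mollifierFourier_le (k : ℕ) (ξ : ℝ) : ‖mollifierFourier k ξ‖ ≤ 1 := by
  rw [← (mollifierBump k).integral_normed (μ := volume)]
  refine norm_integral_le_of_norm_le (mollifierBump k).integrable_normed
    (Filter.Eventually.of_forall fun y => ?_)
  rw [norm_mul, norm_cexp_neg_I_mul, one_mul, Complex.norm_real,
    Real.norm_of_nonneg ((mollifierBump k).nonneg_normed y)]

theorem tendsto_mollifierFourier (ξ : ℝ) :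
    Filter.Tendsto (fun k => mollifierFourier k ξ) Filter.atTop (nhds 1) := by
  have h := ContDiffBump.convolution_tendsto_right_of_continuous (μ := (volume : Measure ℝ))
    tendsto_mollifierBump (g := fun y : ℝ => Complex.exp (Complex.I * (ξ : ℂ) * (y : ℂ)))
    (by fun_prop) 0
  simp only [Complex.ofReal_zero, mul_zero, Complex.exp_zero] at h
  refine h.congr fun k => ?_
  rw [mollifierFourier, MeasureTheory.convolution]
  refine integral_congr_ae (Filter.Eventually.of_forall fun y => ?_)
  simp [mul_comm]

/-- The oriented indicator function of `[0,x]`. -/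
def orientedIndicator (x y : ℝ) : ℝ :=
  (Ioc 0 x).indicator (fun _ => 1) y - (Ioc x 0).indicator (fun _ => 1) y

theorem integrable_orientedIndicator (x : ℝ) : Integrable (orientedIndicator x) :=
  ((integrable_indicator_iff measurableSet_Ioc).2 (by simp)).sub
    ((integrable_indicator_iff measurableSet_Ioc).2 (by simp))

theorem hasCompactSupport_orientedIndicator (x : ℝ) : HasCompactSupport (orientedIndicator x) :=
  HasCompactSupport.intro (isCompact_Icc (a := -|x|) (b := |x|)) fun y hy => by
    have h1 : y ∉ Ioc 0 x := fun h => hy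
      ⟨by have := abs_nonneg x; linarith [h.1], h.2.trans (le_abs_self x)⟩
    have h2 : y ∉ Ioc x 0 := fun h => hy
      ⟨by have := neg_abs_le x; linarith [h.1], h.2.trans (abs_nonneg x)⟩
    simp [orientedIndicator, h1, h2]

theorem integral_cexp_mul_orientedIndicator (x ξ : ℝ) :
    ∫ y : ℝ, Complex.exp (-(Complex.I * (ξ : ℂ) * (y : ℂ))) * (orientedIndicator x y : ℂ) =
      fourierInterval x ξ := by
  have hc : Continuous fun y : ℝ => Complex.exp (-(Complex.I * (ξ : ℂ) * (y : ℂ))) := by fun_prop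
  have hi : ∀ a b : ℝ, Integrable ((Ioc a b).indicator fun y : ℝ =>
      Complex.exp (-(Complex.I * (ξ : ℂ) * (y : ℂ)))) := fun a b =>
    (integrable_indicator_iff measurableSet_Ioc).2
      ((hc.integrableOn_Icc (a := a) (b := b)).mono_set Ioc_subset_Icc_self)
  rw [fourierInterval, intervalIntegral, ← integral_indicator measurableSet_Ioc,
    ← integral_indicator measurableSet_Ioc, ← integral_sub (hi _ _) (hi _ _)]
  refine integral_congr_ae (Filter.Eventually.of_forall fun y => ?_)
  simp only [orientedIndicator, indicator]
  split_ifs <;> simp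

/-- A mollification of the oriented indicator function of `[0,x]`. -/
def mollifiedIndicator (x : ℝ) (k : ℕ) : ℝ → ℝ :=
  MeasureTheory.convolution ((mollifierBump k).normed volume) (orientedIndicator x)
    (ContinuousLinearMap.lsmul ℝ ℝ) volume

theorem contDiff_mollifiedIndicator (x : ℝ) (k : ℕ) :
    ContDiff ℝ (⊤ : ℕ∞) (mollifiedIndicator x k) :=
  (mollifierBump k).hasCompactSupport_normed.contDiff_convolution_left _
    (mollifierBump k).contDiff_normed (integrable_orientedIndicator x).locallyIntegrable

theorem hasCompactSupport_mollifiedIndicator (x : ℝ) (k : ℕ) :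
    HasCompactSupport (mollifiedIndicator x k) :=
  (mollifierBump k).hasCompactSupport_normed.convolution _ (hasCompactSupport_orientedIndicator x)

theorem integral_cexp_mul_mollifiedIndicator (x ξ : ℝ) (k : ℕ) :
    ∫ y : ℝ, Complex.exp (-(Complex.I * (ξ : ℂ) * (y : ℂ))) * (mollifiedIndicator x k y : ℂ) =
      mollifierFourier k ξ * fourierInterval x ξ := by
  have hbd : ∀ f : ℝ → ℝ, Integrable f → Integrable fun y : ℝ =>
      Complex.exp (-(Complex.I * (ξ : ℂ) * (y : ℂ))) * (f y : ℂ) := fun f hf =>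
    hf.ofReal.bdd_mul (c := 1)
      (by have : Continuous fun y : ℝ => Complex.exp (-(Complex.I * (ξ : ℂ) * (y : ℂ))) := by
            fun_prop
          exact this.aestronglyMeasurable)
      (Filter.Eventually.of_forall fun y => (norm_cexp_neg_I_mul ξ y).le)
  have h := integral_convolution (ContinuousLinearMap.mul ℝ ℂ) (μ := (volume : Measure ℝ))
    (ν := (volume : Measure ℝ)) (hbd _ (mollifierBump k).integrable_normed)
    (hbd _ (integrable_orientedIndicator x))
  rw [integral_cexp_mul_orientedIndicator] at h
  refine Eq.trans ?_ h
  refine integral_congr_ae (Filter.Eventually.of_forall fun y => ?_)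
  simp only [mollifiedIndicator, MeasureTheory.convolution]
  rw [← integral_complex_ofReal, ← integral_const_mul]
  refine integral_congr_ae (Filter.Eventually.of_forall fun u => ?_)
  simp only [ContinuousLinearMap.lsmul_apply, smul_eq_mul, ContinuousLinearMap.mul_apply']
  have : Complex.exp (-(Complex.I * (ξ : ℂ) * (y : ℂ))) =
      Complex.exp (-(Complex.I * (ξ : ℂ) * (u : ℂ))) *
        Complex.exp (-(Complex.I * (ξ : ℂ) * ((y - u : ℝ) : ℂ))) := by
    rw [← Complex.exp_add]; push_cast; ring_nf
  rw [this]
  push_cast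
  ring

/-- The indicator functions of rectangles belong to `ℋ_H`. -/
theorem exists_isRectangle (H : Ioo (0 : ℝ) 1) (t x : ℝ) :
    ∃ h : HilbertH H, IsRectangle t x h := by
  have hsF : ∀ k z, spaceFourier (fun w : ℝ × ℝ => timeCutoff t k w.1 * mollifiedIndicator x k w.2)
      z = (timeCutoff t k z.1 : ℂ) * (mollifierFourier k z.2 * fourierInterval x z.2) := by
    intro k z
    rw [← integral_cexp_mul_mollifiedIndicator, ← integral_const_mul, spaceFourier]
    refine integral_congr_ae (Filter.Eventually.of_forall fun y => ?_)
    simp only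
    push_cast
    ring
  refine exists_fourierH_eq H (memLp_rectFourier H (t, x))
    (fun k w => timeCutoff t k w.1 * mollifiedIndicator x k w.2) (fun k => ⟨?_, ?_⟩)
    (integrable_nuH_bound H (-1) (t + 1) (x ^ 2 + 4)) (fun k z => ?_) ?_
  · exact ((contDiff_timeCutoff t k).comp contDiff_fst).mul
      ((contDiff_mollifiedIndicator x k).comp contDiff_snd)
  · refine HasCompactSupport.intro ((hasCompactSupport_timeCutoff t k).isCompact.prod
      (hasCompactSupport_mollifiedIndicator x k).isCompact) fun w hw => ?_
    rw [mem_prod, not_and_or] at hw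
    rcases hw with hw | hw
    · simp [image_eq_zero_of_notMem_tsupport hw]
    · simp [image_eq_zero_of_notMem_tsupport hw]
  · have h1 := timeCutoff_le_indicator t k z.1
    have h0 := timeCutoff_nonneg t k z.1
    have h2 : ‖mollifierFourier k z.2‖ ^ 2 ≤ 1 :=
      pow_le_one₀ (norm_nonneg _) (norm_mollifierFourier_le k z.2)
    have h3 := norm_fourierInterval_sq_le x z.2
    rw [hsF, norm_mul, norm_mul, mul_pow, mul_pow, Complex.norm_real, Real.norm_of_nonneg h0]
    have h4 : timeCutoff t k z.1 ^ 2 ≤ (Icc (-1) (t + 1)).indicator (fun _ => 1) z.1 := by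
      by_cases hz : z.1 ∈ Icc (-1) (t + 1)
      · rw [indicator_of_mem hz] at h1 ⊢
        exact pow_le_one₀ h0 h1
      · rw [indicator_of_notMem hz] at h1 ⊢
        rw [le_antisymm h1 h0]; norm_num
    have h5 : (Icc (-1) (t + 1)).indicator (fun _ => x ^ 2 + 4) z.1 * (1 + z.2 ^ 2)⁻¹ =
        (Icc (-1) (t + 1)).indicator (fun _ => (1 : ℝ)) z.1 *
          (1 * ((x ^ 2 + 4) * (1 + z.2 ^ 2)⁻¹)) := by
      simp only [indicator]
      split_ifs <;> ring
    rw [h5]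
    exact mul_le_mul h4 (mul_le_mul h2 h3 (by positivity) zero_le_one) (by positivity)
      (indicator_nonneg (fun _ _ => zero_le_one) _)
  · have hpos : ∀ᵐ z ∂(nuH H), 0 ≤ z.1 :=
      Measure.quasiMeasurePreserving_fst.ae (ae_restrict_mem measurableSet_Ici)
    filter_upwards [hpos] with z hz
    simp_rw [hsF]
    have h1 := (Complex.continuous_ofReal.tendsto _).comp (tendsto_timeCutoff t hz)
    have h2 := h1.mul ((tendsto_mollifierFourier z.2).mul_const (fourierInterval x z.2))
    have h3 : rectFourier (t, x) z = (((Icc 0 t).indicator (fun _ => (1 : ℝ)) z.1 : ℝ) : ℂ) *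
        (1 * fourierInterval x z.2) := by
      simp only [rectFourier, indicator]
      split_ifs <;> simp
    rw [← h3] at h2
    exact h2

end Rectangles

/-! ### Rectangles are total in `ℋ_H` -/

section Total

theorem fderiv_mem_testSubmodule {φ : ℝ × ℝ → ℝ} (h : φ ∈ testSubmodule) (v : ℝ × ℝ) :
    (fun w => fderiv ℝ φ w v) ∈ testSubmodule :=
  ⟨(h.1.fderiv_right (m := (⊤ : ℕ∞)) (by exact le_rfl)).clm_apply contDiff_const,
    (h.2.fderiv ℝ).comp_left (g := fun L : ℝ × ℝ →L[ℝ] ℝ => L v) (by simp)⟩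

theorem hasCompactSupport_slice_left {φ : ℝ × ℝ → ℝ} (h : HasCompactSupport φ) (t : ℝ) :
    HasCompactSupport fun y => φ (t, y) :=
  h.comp_isClosedEmbedding (Topology.IsClosedEmbedding.of_continuous_injective_isClosedMap
    (by fun_prop) (fun a b hab => by simpa using hab) (isClosedMap_prodMk_left t))

theorem hasCompactSupport_slice_right {φ : ℝ × ℝ → ℝ} (h : HasCompactSupport φ) (y : ℝ) :
    HasCompactSupport fun s => φ (s, y) :=
  h.comp_isClosedEmbedding (Topology.IsClosedEmbedding.of_continuous_injective_isClosedMap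
    (by fun_prop) (fun a b hab => by simpa using hab) (isClosedMap_prodMk_right y))

theorem integral_Ioi_fderiv_fst {φ : ℝ × ℝ → ℝ} (h : φ ∈ testSubmodule) (t y : ℝ) :
    ∫ s in Ioi t, fderiv ℝ φ (s, y) (1, 0) = -φ (t, y) := by
  have hd : Differentiable ℝ φ := h.1.differentiable (by simp)
  have hs := hasCompactSupport_slice_right h.2 y
  have hs' := hasCompactSupport_slice_right (fderiv_mem_testSubmodule h (1, 0)).2 y
  have hc' := (fderiv_mem_testSubmodule h (1, 0)).1.continuous
  have hder : ∀ s ∈ Ici t, HasDerivAt (fun s => φ (s, y)) (fderiv ℝ φ (s, y) (1, 0)) s := by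
    intro s _
    have h1 : HasDerivAt (fun s : ℝ => (s, y)) ((1 : ℝ), (0 : ℝ)) s :=
      (hasDerivAt_id s).prodMk (hasDerivAt_const s y)
    exact (hd (s, y)).hasFDerivAt.comp_hasDerivAt s h1
  have hlim : Filter.Tendsto (fun s => φ (s, y)) Filter.atTop (nhds 0) :=
    (hs.is_zero_at_infty).mono_left atTop_le_cocompact
  have hint : Integrable fun s => fderiv ℝ φ (s, y) (1, 0) :=
    Continuous.integrable_of_hasCompactSupport (hc'.comp (by fun_prop)) hs'
  have := integral_Ioi_of_hasDerivAt_of_tendsto' hder hint.integrableOn hlim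
  rw [this, zero_sub]

theorem integral_fderiv_snd_mul_fourierInterval {φ : ℝ × ℝ → ℝ} (h : φ ∈ testSubmodule)
    (z : ℝ × ℝ) : ∫ y, (fderiv ℝ φ (z.1, y) (0, 1) : ℂ) * fourierInterval y z.2 =
      -spaceFourier φ z := by
  have hd : Differentiable ℝ φ := h.1.differentiable (by simp)
  have hφc := h.1.continuous
  have hc' := (fderiv_mem_testSubmodule h (0, 1)).1.continuous
  have hs : HasCompactSupport fun y => ((φ (z.1, y) : ℝ) : ℂ) :=
    (hasCompactSupport_slice_left h.2 z.1).comp_left (g := fun r : ℝ => (r : ℂ)) (by simp)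
  have hs' : HasCompactSupport fun y => ((fderiv ℝ φ (z.1, y) (0, 1) : ℝ) : ℂ) :=
    (hasCompactSupport_slice_left (fderiv_mem_testSubmodule h (0, 1)).2 z.1).comp_left
      (g := fun r : ℝ => (r : ℂ)) (by simp)
  have hu : ∀ y : ℝ, HasDerivAt (fun y : ℝ => ((φ (z.1, y) : ℝ) : ℂ))
      ((fderiv ℝ φ (z.1, y) (0, 1) : ℝ) : ℂ) y := by
    intro y
    have h1 : HasDerivAt (fun y : ℝ => (z.1, y)) ((0 : ℝ), (1 : ℝ)) y :=
      (hasDerivAt_const y z.1).prodMk (hasDerivAt_id y)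
    exact ((hd (z.1, y)).hasFDerivAt.comp_hasDerivAt y h1).ofReal_comp
  have hF : Continuous fun y => fourierInterval y z.2 :=
    continuous_fourierInterval.comp (continuous_id.prodMk continuous_const)
  have c1 : Continuous fun y => ((φ (z.1, y) : ℝ) : ℂ) := by fun_prop
  have c2 : Continuous fun y => ((fderiv ℝ φ (z.1, y) (0, 1) : ℝ) : ℂ) :=
    Complex.continuous_ofReal.comp (hc'.comp (by fun_prop))
  have key := integral_mul_deriv_eq_deriv_mul_of_integrable
    (u := fun y : ℝ => ((φ (z.1, y) : ℝ) : ℂ)) (v := fun y : ℝ => fourierInterval y z.2)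
    (fun y _ => hu y) (fun y _ => hasDerivAt_fourierInterval z.2 y)
    ((c1.mul (by fun_prop)).integrable_of_hasCompactSupport hs.mul_right)
    ((c2.mul hF).integrable_of_hasCompactSupport hs'.mul_right)
    ((c1.mul hF).integrable_of_hasCompactSupport hs.mul_right)
  rw [eq_comm, neg_eq_iff_eq_neg, ← key, spaceFourier]
  refine integral_congr_ae (Filter.Eventually.of_forall fun y => ?_)
  simp only
  ring

/-- The mixed second derivative `∂_t ∂_x φ`. -/
def mixedDeriv (φ : ℝ × ℝ → ℝ) (w : ℝ × ℝ) : ℝ :=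
  fderiv ℝ (fun w' => fderiv ℝ φ w' (0, 1)) w (1, 0)

theorem mixedDeriv_mem {φ : ℝ × ℝ → ℝ} (h : φ ∈ testSubmodule) : mixedDeriv φ ∈ testSubmodule :=
  fderiv_mem_testSubmodule (fderiv_mem_testSubmodule h (0, 1)) (1, 0)

theorem measurable_uncurry_rectFourier :
    Measurable fun p : (ℝ × ℝ) × (ℝ × ℝ) => rectFourier p.2 p.1 := by
  have hF : Measurable fun p : (ℝ × ℝ) × (ℝ × ℝ) => fourierInterval p.2.2 p.1.2 :=
    (continuous_fourierInterval.comp (g := fun p : ℝ × ℝ => fourierInterval p.1 p.2)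
      (f := fun p : (ℝ × ℝ) × (ℝ × ℝ) => (p.2.2, p.1.2)) (by fun_prop)).measurable
  have hS : MeasurableSet {p : (ℝ × ℝ) × (ℝ × ℝ) | p.1.1 ∈ Icc 0 p.2.1} :=
    (measurableSet_le (f := fun _ => (0 : ℝ)) (g := fun p : (ℝ × ℝ) × (ℝ × ℝ) => p.1.1)
        measurable_const (by fun_prop)).inter
      (measurableSet_le (f := fun p : (ℝ × ℝ) × (ℝ × ℝ) => p.1.1)
        (g := fun p : (ℝ × ℝ) × (ℝ × ℝ) => p.2.1) (by fun_prop) (by fun_prop))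
  have : (fun p : (ℝ × ℝ) × (ℝ × ℝ) => rectFourier p.2 p.1) =
      {p : (ℝ × ℝ) × (ℝ × ℝ) | p.1.1 ∈ Icc 0 p.2.1}.indicator
        fun p => fourierInterval p.2.2 p.1.2 := by
    funext p
    simp only [rectFourier, indicator, mem_ofPred_eq]
  rw [this]
  exact hF.indicator hS

theorem exists_norm_le_of_ne_zero {ψ : ℝ × ℝ → ℝ} (h : HasCompactSupport ψ) :
    ∃ M, ∀ w, ψ w ≠ 0 → ‖w‖ ≤ M := by
  obtain ⟨R, hR⟩ := h.isCompact.isBounded.subset_closedBall (0 : ℝ × ℝ)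
  exact ⟨R, fun w hw => mem_closedBall_zero_iff.1 (hR (subset_tsupport ψ hw))⟩

theorem integrable_lebHalf {ψ : ℝ × ℝ → ℝ} (h : ψ ∈ testSubmodule) : Integrable ψ lebHalf := by
  rw [lebHalf_eq_restrict]
  exact (h.1.continuous.integrable_of_hasCompactSupport h.2).restrict

/-- A test function is a superposition of indicator functions of rectangles, with density its
mixed second derivative. -/
theorem spaceFourier_eq_integral_rectFourier {φ : ℝ × ℝ → ℝ} (h : φ ∈ testSubmodule)
    {z : ℝ × ℝ} (hz : 0 ≤ z.1) :
    spaceFourier φ z = ∫ w, (mixedDeriv φ w : ℂ) * rectFourier w z ∂lebHalf := by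
  have hψ := mixedDeriv_mem h
  obtain ⟨M, hM⟩ := exists_norm_le_of_ne_zero hψ.2
  have hint : Integrable (fun w => (mixedDeriv φ w : ℂ) * rectFourier w z) lebHalf := by
    have hb : ∀ w, ‖(mixedDeriv φ w : ℂ) * rectFourier w z‖ ≤ ‖mixedDeriv φ w‖ *
        Real.sqrt ((Icc 0 M).indicator (fun _ => M ^ 2 + 4) z.1 * (1 + z.2 ^ 2)⁻¹) := by
      intro w
      rw [norm_mul, Complex.norm_real]
      by_cases hw : mixedDeriv φ w = 0
      · simp [hw]
      · exact mul_le_mul_of_nonneg_left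
          (Real.le_sqrt_of_sq_le (norm_rectFourier_sq_le (hM w hw) z)) (norm_nonneg _)
    refine ((integrable_lebHalf hψ).norm.mul_const _).mono' ?_ (Filter.Eventually.of_forall hb)
    exact ((Complex.measurable_ofReal.comp hψ.1.continuous.measurable).mul
      (measurable_uncurry_rectFourier.comp (measurable_const.prodMk measurable_id))
      ).aestronglyMeasurable
  rw [lebHalf] at hint ⊢
  rw [integral_prod_symm _ hint]
  have hinner : ∀ y, ∫ s in Ici (0 : ℝ), (mixedDeriv φ (s, y) : ℂ) * rectFourier (s, y) z =
      -((fderiv ℝ φ (z.1, y) (0, 1) : ℂ) * fourierInterval y z.2) := by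
    intro y
    have h1 : ∀ s, (Ici (0 : ℝ)).indicator (fun s => (mixedDeriv φ (s, y) : ℂ) *
        rectFourier (s, y) z) s = (Ici z.1).indicator
          (fun s => (mixedDeriv φ (s, y) : ℂ) * fourierInterval y z.2) s := by
      intro s
      by_cases hs : z.1 ≤ s
      · rw [indicator_of_mem (show s ∈ Ici (0 : ℝ) from hz.trans hs),
          indicator_of_mem (show s ∈ Ici z.1 from hs), rectFourier,
          indicator_of_mem (show z.1 ∈ Icc 0 (s, y).1 from ⟨hz, hs⟩)]
      · rw [indicator_of_notMem (show s ∉ Ici z.1 from hs)]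
        have : rectFourier (s, y) z = 0 := indicator_of_notMem (fun h' => hs h'.2) _
        simp [this, indicator]
    rw [← integral_indicator measurableSet_Ici]
    simp_rw [h1]
    rw [integral_indicator measurableSet_Ici, integral_mul_const, integral_complex_ofReal,
      integral_Ici_eq_integral_Ioi]
    have := integral_Ioi_fderiv_fst (fderiv_mem_testSubmodule h (0, 1)) z.1 y
    rw [show ∫ s in Ioi z.1, mixedDeriv φ (s, y) = _ from this]
    push_cast
    ring
  simp_rw [hinner]
  rw [integral_neg, integral_fderiv_snd_mul_fourierInterval h, neg_neg]

/-- A vector orthogonal to all rectangles vanishes: by Fubini it is orthogonal to the test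
functions, which are superpositions of rectangles. -/
theorem eq_zero_of_inner_rectangles {H : Ioo (0 : ℝ) 1} (u : HilbertH H)
    (hu : ∀ t x : ℝ, 0 ≤ t → ∀ h : HilbertH H, IsRectangle t x h → inner ℝ u h = 0) : u = 0 := by
  set g : ℝ × ℝ → ℂ := fun z => fourierH H u z with hg
  have hgL : MemLp g 2 (nuH H) := Lp.memLp _
  have hrect : ∀ w : ℝ × ℝ, 0 ≤ w.1 →
      ∫ z, (starRingEnd ℂ) (g z) * rectFourier w z ∂(nuH H) = 0 := by
    intro w hw
    obtain ⟨h, hh⟩ := exists_isRectangle H w.1 w.2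
    have h1 := inner_fourierH H u h
    rw [hu w.1 w.2 hw h hh, L2.inner_def] at h1
    rw [Complex.ofReal_zero] at h1
    rw [← h1]
    refine integral_congr_ae ?_
    filter_upwards [hh] with z hz
    rw [RCLike.inner_apply, hz, mul_comm]
    rfl
  have htest : ∀ φ : TestFunction H, inner ℝ u (φ : HilbertH H) = 0 := by
    intro φ
    have hφ := φ.mem
    have hψ := mixedDeriv_mem hφ
    obtain ⟨M, hM⟩ := exists_norm_le_of_ne_zero hψ.2
    have h1 := inner_fourierH H u (φ : HilbertH H)
    rw [fourierH_coe, L2.inner_def] at h1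
    have hpos : ∀ᵐ z ∂(nuH H), 0 ≤ z.1 :=
      Measure.quasiMeasurePreserving_fst.ae (ae_restrict_mem measurableSet_Ici)
    have h2 : ∫ z, inner ℂ (fourierH H u z) (testFourier H φ z) ∂(nuH H) =
        ∫ z, ∫ w, (starRingEnd ℂ) (g z) * ((mixedDeriv φ.fn w : ℂ) * rectFourier w z) ∂lebHalf
          ∂(nuH H) := by
      refine integral_congr_ae ?_
      filter_upwards [hpos, (memLp_spaceFourier H hφ).coeFn_toLp] with z hz hz2
      have hz2' : testFourier H φ z = spaceFourier φ.fn z := hz2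
      rw [hz2', spaceFourier_eq_integral_rectFourier hφ hz, RCLike.inner_apply, mul_comm,
        ← integral_const_mul]
    -- A square integrable bound for the rectangles that occur in the superposition.
    let K : ℝ × ℝ → ℝ := fun z => Real.sqrt
      ((Icc 0 M).indicator (fun _ => M ^ 2 + 4) z.1 * (1 + z.2 ^ 2)⁻¹)
    have hK0 : ∀ z : ℝ × ℝ, 0 ≤ (Icc 0 M).indicator (fun _ => M ^ 2 + 4) z.1 * (1 + z.2 ^ 2)⁻¹ :=
      fun z => mul_nonneg (indicator_nonneg (fun _ _ => by positivity) _) (by positivity)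
    have hKm : Measurable K := by
      refine Real.continuous_sqrt.measurable.comp (Measurable.mul ?_ (by fun_prop))
      exact (measurable_const.indicator measurableSet_Icc).comp measurable_fst
    have hKL : MemLp K 2 (nuH H) := by
      refine (memLp_two_iff_integrable_sq hKm.aestronglyMeasurable).2 ?_
      refine (integrable_nuH_bound H 0 M (M ^ 2 + 4)).congr
        (Filter.Eventually.of_forall fun z => ?_)
      exact (Real.sq_sqrt (hK0 z)).symm
    have hgm : Measurable g := (Lp.stronglyMeasurable (fourierH H u)).measurable
    have hint : Integrable (fun p : (ℝ × ℝ) × (ℝ × ℝ) =>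
        (starRingEnd ℂ) (g p.1) * ((mixedDeriv φ.fn p.2 : ℂ) * rectFourier p.2 p.1))
        ((nuH H).prod lebHalf) := by
      have hb := (hgL.norm.integrable_mul hKL).mul_prod (integrable_lebHalf hψ).norm
      refine hb.mono' ?_ (Filter.Eventually.of_forall fun p => ?_)
      · refine Measurable.aestronglyMeasurable ?_
        refine Measurable.mul ?_ (Measurable.mul ?_ measurable_uncurry_rectFourier)
        · exact Complex.continuous_conj.measurable.comp (hgm.comp measurable_fst)
        · exact Complex.measurable_ofReal.comp (hψ.1.continuous.measurable.comp measurable_snd)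
      · rw [norm_mul, norm_mul, RCLike.norm_conj, Complex.norm_real]
        simp only [Pi.mul_apply]
        rw [mul_assoc, mul_comm (K p.1)]
        refine mul_le_mul_of_nonneg_left ?_ (norm_nonneg _)
        by_cases hw : mixedDeriv φ.fn p.2 = 0
        · simp [hw]
        · exact mul_le_mul_of_nonneg_left
            (Real.le_sqrt_of_sq_le (norm_rectFourier_sq_le (hM _ hw) p.1)) (norm_nonneg _)
    rw [h2, integral_integral_swap hint] at h1
    have h3 : ∫ w, ∫ z, (starRingEnd ℂ) (g z) * ((mixedDeriv φ.fn w : ℂ) * rectFourier w z)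
        ∂(nuH H) ∂lebHalf = 0 := by
      refine integral_eq_zero_of_ae ?_
      filter_upwards [ae_lebHalf_nonneg] with w hw
      simp_rw [mul_left_comm ((starRingEnd ℂ) _)]
      rw [integral_const_mul, hrect w hw, mul_zero]
      rfl
    rw [h3] at h1
    exact_mod_cast h1.symm
  have hall : ∀ x : HilbertH H, inner ℝ u x = 0 := by
    intro x
    induction x using UniformSpace.Completion.induction_on with
    | hp => exact isClosed_eq (continuous_const.inner continuous_id) continuous_const
    | ih φ => exact htest φ
  exact inner_self_eq_zero.1 (hall u)

/-- The indicator functions of rectangles are total in `ℋ_H`. -/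
theorem topologicalClosure_span_rectangles (H : Ioo (0 : ℝ) 1) :
    (Submodule.span ℝ {h : HilbertH H | ∃ t x : ℝ, 0 ≤ t ∧ IsRectangle t x h}
      ).topologicalClosure = ⊤ := by
  rw [Submodule.topologicalClosure_eq_top_iff, Submodule.eq_bot_iff]
  intro u hu
  refine eq_zero_of_inner_rectangles u fun t x ht h hh => ?_
  rw [real_inner_comm]
  exact (Submodule.mem_orthogonal _ _).1 hu _ (Submodule.subset_span ⟨t, x, ht, hh⟩)

end Total

/-! ### Inner products of Wick products -/

section ComplexForms

variable {Ω : Type*} [MeasurableSpace Ω] {P : Measure Ω}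

/-- The inclusion of real into complex square integrable functions. -/
def ofRealLp (P : Measure Ω) : Lp ℝ 2 P →L[ℝ] Lp ℂ 2 P := Complex.ofRealCLM.compLpL 2 P

/-- The real part of a complex square integrable function. -/
def reLp (P : Measure Ω) : Lp ℂ 2 P →L[ℝ] Lp ℝ 2 P := Complex.reCLM.compLpL 2 P

/-- The imaginary part of a complex square integrable function. -/
def imLp (P : Measure Ω) : Lp ℂ 2 P →L[ℝ] Lp ℝ 2 P := Complex.imCLM.compLpL 2 P

theorem coeFn_ofRealLp (X : Lp ℝ 2 P) : ofRealLp P X =ᵐ[P] fun ω => (X ω : ℂ) :=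
  Complex.ofRealCLM.coeFn_compLpL X

theorem coeFn_reLp (Z : Lp ℂ 2 P) : reLp P Z =ᵐ[P] fun ω => (Z ω).re :=
  Complex.reCLM.coeFn_compLpL Z

theorem coeFn_imLp (Z : Lp ℂ 2 P) : imLp P Z =ᵐ[P] fun ω => (Z ω).im :=
  Complex.imCLM.coeFn_compLpL Z

theorem inner_ofRealLp (X Y : Lp ℝ 2 P) :
    inner ℂ (ofRealLp P X) (ofRealLp P Y) = ((inner ℝ X Y : ℝ) : ℂ) := by
  rw [L2.inner_def, L2.inner_def, ← integral_complex_ofReal]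
  refine integral_congr_ae ?_
  filter_upwards [coeFn_ofRealLp X, coeFn_ofRealLp Y] with ω h1 h2
  rw [h1, h2]
  simp

theorem norm_ofRealLp (X : Lp ℝ 2 P) : ‖ofRealLp P X‖ = ‖X‖ := by
  have h := inner_ofRealLp X X
  rw [inner_self_eq_norm_sq_to_K, real_inner_self_eq_norm_sq] at h
  have h' : ‖ofRealLp P X‖ ^ 2 = ‖X‖ ^ 2 := Complex.ofReal_injective (by push_cast; simpa using h)
  exact (pow_left_inj₀ (norm_nonneg _) (norm_nonneg _) two_ne_zero).1 h'

theorem reLp_ofRealLp (X : Lp ℝ 2 P) : reLp P (ofRealLp P X) = X := by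
  refine Lp.ext ?_
  filter_upwards [coeFn_reLp (ofRealLp P X), coeFn_ofRealLp X] with ω h1 h2
  rw [h1, h2, Complex.ofReal_re]

theorem reLp_smul (c : ℂ) (Z : Lp ℂ 2 P) :
    reLp P (c • Z) = c.re • reLp P Z - c.im • imLp P Z := by
  refine Lp.ext ?_
  filter_upwards [coeFn_reLp (c • Z), coeFn_reLp Z, coeFn_imLp Z, Lp.coeFn_smul c Z,
    Lp.coeFn_sub (c.re • reLp P Z) (c.im • imLp P Z), Lp.coeFn_smul c.re (reLp P Z),
    Lp.coeFn_smul c.im (imLp P Z)] with ω h1 h2 h3 h4 h5 h6 h7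
  rw [h1, h4, h5, Pi.sub_apply, h6, h7]
  simp [h2, h3]

theorem imLp_smul (c : ℂ) (Z : Lp ℂ 2 P) :
    imLp P (c • Z) = c.re • imLp P Z + c.im • reLp P Z := by
  refine Lp.ext ?_
  filter_upwards [coeFn_imLp (c • Z), coeFn_reLp Z, coeFn_imLp Z, Lp.coeFn_smul c Z,
    Lp.coeFn_add (c.re • imLp P Z) (c.im • reLp P Z), Lp.coeFn_smul c.re (imLp P Z),
    Lp.coeFn_smul c.im (reLp P Z)] with ω h1 h2 h3 h4 h5 h6 h7
  rw [h1, h4, h5, Pi.add_apply, h6, h7]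
  simp [h2, h3]

variable {G : Submodule ℝ (Lp ℝ 2 P)}

/-- The random variable `X + cY` in `L²(P; ℂ)`. -/
def formLp (y : G × G × ℂ) : Lp ℂ 2 P :=
  ofRealLp P (y.1 : Lp ℝ 2 P) + y.2.2 • ofRealLp P (y.2.1 : Lp ℝ 2 P)

/-- The triple describing the complex conjugate of `X + cY`. -/
def conjForm (y : G × G × ℂ) : G × G × ℂ := (y.1, y.2.1, starRingEnd ℂ y.2.2)

theorem formCov_conjForm (y z : G × G × ℂ) :
    formCov (conjForm y) z = inner ℂ (formLp y) (formLp z) := by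
  simp only [formLp, inner_add_left, inner_add_right, inner_smul_left, inner_smul_right,
    inner_ofRealLp, formCov, conjForm, Submodule.coe_inner]
  ring

theorem map_conj_gaussDeriv (X : G) (p : MvPolynomial G ℂ) :
    MvPolynomial.map (starRingEnd ℂ) (gaussDeriv X p) =
      gaussDeriv X (MvPolynomial.map (starRingEnd ℂ) p) := by
  induction p using MvPolynomial.induction_on with
  | C c => simp
  | add p q hp hq => simp only [map_add, hp, hq]
  | mul_X p Y hp =>
    simp only [Derivation.leibniz, map_add, map_mul, smul_eq_mul, hp, gaussDeriv_X,
      MvPolynomial.map_X, MvPolynomial.map_C, Complex.conj_ofReal]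

/-- Conjugating the coefficients of a Wick product amounts to conjugating its factors. -/
theorem map_conj_wick : ∀ (n : ℕ) (y : Fin n → G × G × ℂ),
    MvPolynomial.map (starRingEnd ℂ) (wick gaussForm formDeriv n y) =
      wick gaussForm formDeriv n fun l => conjForm (y l)
  | 0, y => by simp [wick]
  | n + 1, y => by
    have hder : ∀ p : MvPolynomial G ℂ, MvPolynomial.map (starRingEnd ℂ) (formDeriv (y 0) p) =
        formDeriv (conjForm (y 0)) (MvPolynomial.map (starRingEnd ℂ) p) := fun p => by
      simp only [formDeriv, conjForm, Derivation.add_apply, Derivation.smul_apply, map_add,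
        MvPolynomial.smul_eq_C_mul, map_mul, MvPolynomial.map_C, map_conj_gaussDeriv]
    have hform : MvPolynomial.map (starRingEnd ℂ) (gaussForm (y 0)) =
        gaussForm (conjForm (y 0)) := by
      simp only [gaussForm, conjForm, map_add, map_mul, MvPolynomial.map_C, MvPolynomial.map_X]
    have ih := map_conj_wick n (Fin.tail y)
    rw [wick, wick, map_sub, map_mul, hder, hform, ih]
    rfl

theorem conj_gaussWick {n : ℕ} (y : Fin n → G × G × ℂ) (ω : Ω) :
    starRingEnd ℂ (gaussWick y ω) = gaussWick (fun l => conjForm (y l)) ω := by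
  rw [gaussWick, gaussWick, ← map_conj_wick, evalGauss, evalGauss, MvPolynomial.eval_map,
    MvPolynomial.eval, MvPolynomial.coe_eval₂Hom, MvPolynomial.eval₂_comp_left, RingHom.comp_id]
  congr 1
  funext X
  exact Complex.conj_ofReal _

variable [IsProbabilityMeasure P]

/-- The Wick product `:y₀⋯y_{n-1}:` as an element of `L²(P; ℂ)`. -/
def IsGaussianSpace.wickLp (hG : IsGaussianSpace G) {n : ℕ} (y : Fin n → G × G × ℂ) : Lp ℂ 2 P :=
  (hG.memLp_gaussWick y).toLp _

theorem IsGaussianSpace.inner_wickLp (hG : IsGaussianSpace G) {n : ℕ}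
    (y z : Fin n → G × G × ℂ) : inner ℂ (hG.wickLp y) (hG.wickLp z) =
      ∑ σ : Equiv.Perm (Fin n), ∏ l, inner ℂ (formLp (y l)) (formLp (z (σ l))) := by
  simp_rw [← formCov_conjForm]
  rw [← hG.integral_gaussWick_mul_gaussWick, L2.inner_def]
  refine integral_congr_ae ?_
  filter_upwards [(hG.memLp_gaussWick y).coeFn_toLp, (hG.memLp_gaussWick z).coeFn_toLp]
    with ω h1 h2
  rw [IsGaussianSpace.wickLp, IsGaussianSpace.wickLp, h1, h2, RCLike.inner_apply, conj_gaussWick,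
    mul_comm]

end ComplexForms

/-! ### The isometry formula for multiple integrals -/

section SesquilinearExtension

variable {E F κ : Type*} [NormedAddCommGroup E] [InnerProductSpace ℂ E]
  [NormedAddCommGroup F] [InnerProductSpace ℂ F] [Fintype κ]

/-- An identity between sesquilinear expressions extends from a set to its closed span. -/
theorem inner_eq_sum_of_mem_topologicalClosure_span (T : κ → E →ₗᵢ[ℂ] E) {S : Set (E × F)}
    (h : ∀ p ∈ S, ∀ q ∈ S, inner ℂ q.2 p.2 = ∑ k, inner ℂ q.1 (T k p.1)) {p q : E × F}
    (hp : p ∈ (Submodule.span ℂ S).topologicalClosure)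
    (hq : q ∈ (Submodule.span ℂ S).topologicalClosure) :
    inner ℂ p.2 q.2 = ∑ k, inner ℂ (T k p.1) q.1 := by
  have h1 : ∀ q ∈ S, inner ℂ q.2 p.2 = ∑ k, inner ℂ q.1 (T k p.1) := by
    intro q hq
    have := eq_of_mem_topologicalClosure_span (𝕜 := ℂ)
      ((innerSL ℂ q.2).comp (ContinuousLinearMap.snd ℂ E F))
      (∑ k, (innerSL ℂ q.1).comp
        ((T k).toContinuousLinearMap.comp (ContinuousLinearMap.fst ℂ E F)))
      (fun p hp => by simpa using h p hp q hq) hp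
    simpa using this
  have := eq_of_mem_topologicalClosure_span (𝕜 := ℂ)
    ((innerSL ℂ p.2).comp (ContinuousLinearMap.snd ℂ E F))
    (∑ k, (innerSL ℂ (T k p.1)).comp (ContinuousLinearMap.fst ℂ E F))
    (fun q hq => by
      have h := congrArg (starRingEnd ℂ) (h1 q hq)
      rw [map_sum, inner_conj_symm] at h
      simp_rw [inner_conj_symm] at h
      simpa using h) hq
  simpa using this

end SesquilinearExtension

section Isometry

variable {Ω : Type*} [MeasurableSpace Ω] {P : Measure Ω} {G : Submodule ℝ (Lp ℝ 2 P)}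
  [IsProbabilityMeasure P]

/-- The pairs `(g_1 ⊗ ⋯ ⊗ g_n, :y_1⋯y_n:)`, where each `(g_i, y_i)` belongs to a given relation
between kernels and Gaussian variables. -/
def IsGaussianSpace.wickPairs (hG : IsGaussianSpace G) (Θ : Set (Lp ℂ 2 lebHalf × (G × G × ℂ)))
    (n : ℕ) : Set (Lp ℂ 2 (Measure.pi fun _ : Fin n => lebHalf) × Lp ℂ 2 P) :=
  {p | ∃ (g : Fin n → Lp ℂ 2 lebHalf) (y : Fin n → G × G × ℂ), (∀ i, (g i, y i) ∈ Θ) ∧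
    p.1 = prodLp g ∧ p.2 = hG.wickLp y}

variable {Θ : Set (Lp ℂ 2 lebHalf × (G × G × ℂ))} {n : ℕ}

theorem IsGaussianSpace.inner_of_mem_wickPairs (hG : IsGaussianSpace G)
    (hΘ : ∀ a ∈ Θ, ∀ b ∈ Θ, inner ℂ (formLp a.2) (formLp b.2) = inner ℂ a.1 b.1)
    {p q : Lp ℂ 2 (Measure.pi fun _ : Fin n => lebHalf) × Lp ℂ 2 P}
    (hp : p ∈ hG.wickPairs Θ n) (hq : q ∈ hG.wickPairs Θ n) :
    inner ℂ q.2 p.2 = ∑ σ : Equiv.Perm (Fin n), inner ℂ q.1 (permLp lebHalf σ p.1) := by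
  obtain ⟨g, y, hgy, hp1, hp2⟩ := hp
  obtain ⟨h, z, hhz, hq1, hq2⟩ := hq
  rw [hp1, hp2, hq1, hq2, hG.inner_wickLp]
  refine Fintype.sum_equiv (Equiv.inv _) _ _ fun σ => ?_
  rw [permLp_prodLp, inner_prodLp]
  refine Finset.prod_congr rfl fun l _ => ?_
  have := hΘ _ (hhz l) _ (hgy (σ l))
  exact this

/-- If the relation `Θ` preserves inner products, then the multiple integral it generates satisfies
`⟨I(g), I(h)⟩ = ∑_σ ⟨g ∘ σ, h⟩`, the sum being over the permutations of the coordinates. -/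
theorem IsGaussianSpace.inner_of_mem_closure (hG : IsGaussianSpace G)
    (hΘ : ∀ a ∈ Θ, ∀ b ∈ Θ, inner ℂ (formLp a.2) (formLp b.2) = inner ℂ a.1 b.1)
    {p q : Lp ℂ 2 (Measure.pi fun _ : Fin n => lebHalf) × Lp ℂ 2 P}
    (hp : p ∈ (Submodule.span ℂ (hG.wickPairs Θ n)).topologicalClosure)
    (hq : q ∈ (Submodule.span ℂ (hG.wickPairs Θ n)).topologicalClosure) :
    inner ℂ p.2 q.2 = ∑ σ : Equiv.Perm (Fin n), inner ℂ (permLp lebHalf σ p.1) q.1 := by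
  have := inner_eq_sum_of_mem_topologicalClosure_span
    (fun σ : Equiv.Perm (Fin n) => permLp lebHalf σ) (S := hG.wickPairs Θ n)
    (fun p hp q hq => hG.inner_of_mem_wickPairs hΘ hp hq) hp hq
  exact this

/-- The multiple integral is bounded: the formula for the norm has `n!` terms, each at most
`‖g‖²`. -/
theorem IsGaussianSpace.norm_le_of_mem_closure (hG : IsGaussianSpace G)
    (hΘ : ∀ a ∈ Θ, ∀ b ∈ Θ, inner ℂ (formLp a.2) (formLp b.2) = inner ℂ a.1 b.1)
    {p : Lp ℂ 2 (Measure.pi fun _ : Fin n => lebHalf) × Lp ℂ 2 P}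
    (hp : p ∈ (Submodule.span ℂ (hG.wickPairs Θ n)).topologicalClosure) :
    ‖p.2‖ ≤ Real.sqrt (n.factorial) * ‖p.1‖ := by
  have h1 : ‖p.2‖ ^ 2 ≤ n.factorial * ‖p.1‖ ^ 2 := by
    have h2 : ‖p.2‖ ^ 2 = ‖(inner ℂ p.2 p.2 : ℂ)‖ := by
      rw [inner_self_eq_norm_sq_to_K]
      simp
    rw [h2, hG.inner_of_mem_closure hΘ hp hp]
    refine (norm_sum_le _ _).trans ?_
    calc ∑ σ : Equiv.Perm (Fin n), ‖inner ℂ (permLp lebHalf σ p.1) p.1‖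
        ≤ ∑ σ : Equiv.Perm (Fin n), ‖p.1‖ ^ 2 := Finset.sum_le_sum fun σ _ => by
          refine (norm_inner_le_norm _ _).trans (le_of_eq ?_)
          rw [LinearIsometry.norm_map, sq]
      _ = n.factorial * ‖p.1‖ ^ 2 := by
          rw [Finset.sum_const, Finset.card_univ, Fintype.card_perm, Fintype.card_fin, nsmul_eq_mul]
  refine le_of_sq_le_sq ?_ (by positivity)
  rwa [mul_pow, Real.sq_sqrt (by positivity)]

theorem IsGaussianSpace.eq_of_mem_closure (hG : IsGaussianSpace G)
    (hΘ : ∀ a ∈ Θ, ∀ b ∈ Θ, inner ℂ (formLp a.2) (formLp b.2) = inner ℂ a.1 b.1)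
    {g : Lp ℂ 2 (Measure.pi fun _ : Fin n => lebHalf)} {Y Z : Lp ℂ 2 P}
    (hY : (g, Y) ∈ (Submodule.span ℂ (hG.wickPairs Θ n)).topologicalClosure)
    (hZ : (g, Z) ∈ (Submodule.span ℂ (hG.wickPairs Θ n)).topologicalClosure) : Y = Z := by
  have h := hG.norm_le_of_mem_closure hΘ (Submodule.sub_mem _ hY hZ)
  simp only [Prod.mk_sub_mk, sub_self, norm_zero, mul_zero] at h
  exact sub_eq_zero.1 (norm_le_zero_iff.1 h)

end Isometry

/-! ### The Gaussian space of the spectral measure -/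

section SpectralSpace

variable {Ω : Type*} [MeasurableSpace Ω] {P : Measure Ω} {Wt : BoundedBorel → Ω → ℂ}

theorem memLp_two_of_isGaussianProcess {T : Type*} {X : T → Ω → ℝ} (hX : IsGaussianProcess X P)
    (t : T) : MemLp (X t) 2 P :=
  (hX.hasGaussianLaw_eval t).memLp_two

/-- The indicator function `1_A` in `L²(dt dξ)`. -/
def indLp (A : BoundedBorel) : Lp ℂ 2 lebHalf :=
  indicatorConstLp 2 A.2.1 (measure_lebHalf_lt_top A.2.2.1).ne 1

theorem coeFn_rectLp {n : ℕ} (A : Fin n → BoundedBorel) :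
    rectLp A =ᵐ[Measure.pi fun _ : Fin n => lebHalf]
      (univ.pi fun i => (A i).1).indicator (fun _ => (1 : ℂ)) :=
  indicatorConstLp_coeFn

theorem rectLp_eq_prodLp {n : ℕ} (A : Fin n → BoundedBorel) :
    rectLp A = prodLp fun i => indLp (A i) := by
  refine Lp.ext ?_
  have h3 : ∀ᵐ z ∂(Measure.pi fun _ : Fin n => lebHalf), ∀ j, ∀ i,
      indLp (A j) (z i) = (A j).1.indicator (fun _ => (1 : ℂ)) (z i) :=
    ae_all_iff.2 fun j => ae_pi_of_ae indicatorConstLp_coeFn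
  filter_upwards [coeFn_prodLp fun i => indLp (A i), h3, coeFn_rectLp A] with z h1 h2 h3
  rw [h1, h3]
  simp_rw [h2]
  by_cases hz : z ∈ univ.pi fun i => (A i).1
  · rw [indicator_of_mem hz]
    exact (Finset.prod_eq_one fun i _ => indicator_of_mem (hz i (mem_univ i)) _).symm
  · rw [indicator_of_notMem hz]
    simp only [mem_univ_pi, not_forall] at hz
    obtain ⟨i, hi⟩ := hz
    exact (Finset.prod_eq_zero (Finset.mem_univ i) (indicator_of_notMem hi _)).symm

theorem inner_indLp (A B : BoundedBorel) :
    inner ℂ (indLp A) (indLp B) = ((volume.real (A.1 ∩ B.1) : ℝ) : ℂ) := by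
  rw [indLp, indLp, L2.inner_indicatorConstLp_one_indicatorConstLp_one A.2.1 B.2.1
    (measure_lebHalf_lt_top A.2.2.1).ne (measure_lebHalf_lt_top B.2.2.1).ne]
  rw [lebHalf_eq_restrict, measureReal_restrict_apply (A.2.1.inter B.2.1),
    inter_eq_self_of_subset_left (inter_subset_left.trans A.2.2.2)]
  rfl

theorem IsComplexGaussianMeasure.memLp_re (hWt : IsComplexGaussianMeasure P Wt)
    (A : BoundedBorel) : MemLp (fun ω => (Wt A ω).re) 2 P :=
  memLp_two_of_isGaussianProcess hWt.gaussian_re A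

theorem IsComplexGaussianMeasure.memLp_im (hWt : IsComplexGaussianMeasure P Wt)
    (A : BoundedBorel) : MemLp (fun ω => (Wt A ω).im) 2 P :=
  memLp_two_of_isGaussianProcess hWt.gaussian_im A

/-- The real and imaginary parts `W̃₁(A)`, `W̃₂(A)` of the spectral measure, in `L²(P)`. -/
def IsComplexGaussianMeasure.parts (hWt : IsComplexGaussianMeasure P Wt) :
    BoundedBorel ⊕ BoundedBorel → Lp ℝ 2 P :=
  Sum.elim (fun A => (hWt.memLp_re A).toLp _) (fun A => (hWt.memLp_im A).toLp _)

/-- The Gaussian space of the spectral measure: the closed real linear span of its real and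
imaginary parts. -/
def IsComplexGaussianMeasure.space (hWt : IsComplexGaussianMeasure P Wt) :
    Submodule ℝ (Lp ℝ 2 P) :=
  (Submodule.span ℝ (range hWt.parts)).topologicalClosure

theorem IsComplexGaussianMeasure.parts_mem (hWt : IsComplexGaussianMeasure P Wt)
    (s : BoundedBorel ⊕ BoundedBorel) : hWt.parts s ∈ hWt.space :=
  Submodule.le_topologicalClosure _ (Submodule.subset_span ⟨s, rfl⟩)

theorem IsComplexGaussianMeasure.isGaussianSpace [IsProbabilityMeasure P]
    (hWt : IsComplexGaussianMeasure P Wt) : IsGaussianSpace hWt.space := by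
  refine (isGaussianSpace_span (isGaussianProcess_sumElim hWt.gaussian_re hWt.gaussian_im
    hWt.indep) ?_ hWt.parts ?_).topologicalClosure
  · rintro (A | A)
    · exact hWt.mean_re A
    · exact hWt.mean_im A
  · rintro (A | A)
    · exact (hWt.memLp_re A).coeFn_toLp
    · exact (hWt.memLp_im A).coeFn_toLp

/-- The triple describing `W̃(A) = W̃₁(A) + i W̃₂(A)`. -/
def IsComplexGaussianMeasure.form (hWt : IsComplexGaussianMeasure P Wt) (A : BoundedBorel) :
    hWt.space × hWt.space × ℂ :=
  (⟨_, hWt.parts_mem (Sum.inl A)⟩, ⟨_, hWt.parts_mem (Sum.inr A)⟩, Complex.I)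

theorem inner_toLp {f g : Ω → ℝ} (hf : MemLp f 2 P) (hg : MemLp g 2 P) :
    inner ℝ (hf.toLp f) (hg.toLp g) = ∫ ω, f ω * g ω ∂P := by
  rw [L2.inner_def]
  refine integral_congr_ae ?_
  filter_upwards [hf.coeFn_toLp, hg.coeFn_toLp] with ω h1 h2
  rw [h1, h2, RCLike.inner_apply, mul_comm]
  rfl

theorem IsComplexGaussianMeasure.integral_re_mul_im (hWt : IsComplexGaussianMeasure P Wt)
    (A B : BoundedBorel) : ∫ ω, (Wt A ω).re * (Wt B ω).im ∂P = 0 := by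
  have h : IndepFun (fun ω => (Wt A ω).re) (fun ω => (Wt B ω).im) P :=
    hWt.indep.comp (measurable_pi_apply A) (measurable_pi_apply B)
  have := h.integral_fun_mul_eq_mul_integral (hWt.memLp_re A).1 (hWt.memLp_im B).1
  rw [this, hWt.mean_re, zero_mul]

theorem IsComplexGaussianMeasure.inner_re_im (hWt : IsComplexGaussianMeasure P Wt)
    (A B : BoundedBorel) : inner ℝ (hWt.parts (Sum.inl A)) (hWt.parts (Sum.inr B)) = 0 :=
  (inner_toLp (hWt.memLp_re A) (hWt.memLp_im B)).trans (hWt.integral_re_mul_im A B)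

theorem IsComplexGaussianMeasure.inner_im_re (hWt : IsComplexGaussianMeasure P Wt)
    (A B : BoundedBorel) : inner ℝ (hWt.parts (Sum.inr A)) (hWt.parts (Sum.inl B)) = 0 := by
  rw [real_inner_comm, hWt.inner_re_im]

theorem IsComplexGaussianMeasure.inner_re_re (hWt : IsComplexGaussianMeasure P Wt)
    (A B : BoundedBorel) : inner ℝ (hWt.parts (Sum.inl A)) (hWt.parts (Sum.inl B)) =
      (volume.real (A.1 ∩ B.1) + volume.real (A.1 ∩ reflectSet B.1)) / 2 :=
  (inner_toLp (hWt.memLp_re A) (hWt.memLp_re B)).trans (hWt.cov_re A B)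

theorem IsComplexGaussianMeasure.inner_im_im (hWt : IsComplexGaussianMeasure P Wt)
    (A B : BoundedBorel) : inner ℝ (hWt.parts (Sum.inr A)) (hWt.parts (Sum.inr B)) =
      (volume.real (A.1 ∩ B.1) - volume.real (A.1 ∩ reflectSet B.1)) / 2 :=
  (inner_toLp (hWt.memLp_im A) (hWt.memLp_im B)).trans (hWt.cov_im A B)

/-- `E[W̃(A) W̃(B)] = |A ∩ B⁻|`. -/
theorem IsComplexGaussianMeasure.formCov_form (hWt : IsComplexGaussianMeasure P Wt)
    (A B : BoundedBorel) : formCov (hWt.form A) (hWt.form B) =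
      ((volume.real (A.1 ∩ reflectSet B.1) : ℝ) : ℂ) := by
  simp only [formCov, IsComplexGaussianMeasure.form, Submodule.coe_inner, hWt.inner_re_im,
    hWt.inner_im_re, hWt.inner_re_re, hWt.inner_im_im]
  push_cast
  rw [Complex.I_mul_I]
  ring

/-- `E[W̃(B) conj W̃(A)] = |A ∩ B|`. -/
theorem IsComplexGaussianMeasure.inner_formLp_form (hWt : IsComplexGaussianMeasure P Wt)
    (A B : BoundedBorel) : inner ℂ (formLp (hWt.form A)) (formLp (hWt.form B)) =
      inner ℂ (indLp A) (indLp B) := by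
  rw [← formCov_conjForm, inner_indLp]
  simp only [formCov, conjForm, IsComplexGaussianMeasure.form, Submodule.coe_inner,
    hWt.inner_re_im, hWt.inner_im_re, hWt.inner_re_re, hWt.inner_im_im, Complex.conj_I]
  push_cast
  linear_combination ((volume.real (A.1 ∩ reflectSet B.1) : ℂ) -
    (volume.real (A.1 ∩ B.1) : ℂ)) / 2 * Complex.I_mul_I

theorem IsComplexGaussianMeasure.coeFn_formLp_form (hWt : IsComplexGaussianMeasure P Wt)
    (A : BoundedBorel) : formLp (hWt.form A) =ᵐ[P] Wt A := by
  have h1 : (hWt.parts (Sum.inl A) : Ω → ℝ) =ᵐ[P] fun ω => (Wt A ω).re :=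
    (hWt.memLp_re A).coeFn_toLp
  have h2 : (hWt.parts (Sum.inr A) : Ω → ℝ) =ᵐ[P] fun ω => (Wt A ω).im :=
    (hWt.memLp_im A).coeFn_toLp
  filter_upwards [h1, h2, Lp.coeFn_add (ofRealLp P (hWt.parts (Sum.inl A)))
    (Complex.I • ofRealLp P (hWt.parts (Sum.inr A))),
    Lp.coeFn_smul Complex.I (ofRealLp P (hWt.parts (Sum.inr A))),
    coeFn_ofRealLp (hWt.parts (Sum.inl A)), coeFn_ofRealLp (hWt.parts (Sum.inr A))]
    with ω h1 h2 h3 h4 h5 h6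
  refine h3.trans ?_
  rw [Pi.add_apply, h4, Pi.smul_apply, h5, h6, h1, h2, smul_eq_mul, mul_comm]
  exact Complex.re_add_im _

/-- The relation between the indicator functions `1_A` and the variables `W̃(A)`. -/
def IsComplexGaussianMeasure.indPairs (hWt : IsComplexGaussianMeasure P Wt) :
    Set (Lp ℂ 2 lebHalf × (hWt.space × hWt.space × ℂ)) :=
  range fun A => (indLp A, hWt.form A)

/-- First order spectral integrals of `L²` functions, as a relation between kernels and Gaussian
variables. -/
def IsComplexGaussianMeasure.firstOrder (hWt : IsComplexGaussianMeasure P Wt) :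
    Set (Lp ℂ 2 lebHalf × (hWt.space × hWt.space × ℂ)) :=
  {a | (prodLp (fun _ : Fin 1 => a.1), formLp a.2) ∈
    (Submodule.span ℂ (spectralGenerators P Wt 1)).topologicalClosure}

theorem IsComplexGaussianMeasure.indPairs_subset (hWt : IsComplexGaussianMeasure P Wt) :
    hWt.indPairs ⊆ hWt.firstOrder := by
  rintro _ ⟨A, rfl⟩
  refine Submodule.le_topologicalClosure _ (Submodule.subset_span ⟨fun _ => A, ?_, ?_, ?_⟩)
  · exact fun i j hij => absurd (Subsingleton.elim i j) hij
  · change prodLp (fun _ : Fin 1 => indLp A) =ᵐ[_] _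
    rw [← rectLp_eq_prodLp fun _ => A]
    exact coeFn_rectLp _
  · refine (hWt.coeFn_formLp_form A).trans (Filter.Eventually.of_forall fun ω => ?_)
    simp

/-- First order spectral integrals belong to the complexified Gaussian space of the spectral
measure. -/
theorem IsComplexGaussianMeasure.reLp_mem (hWt : IsComplexGaussianMeasure P Wt)
    {p : Lp ℂ 2 (Measure.pi fun _ : Fin 1 => lebHalf) × Lp ℂ 2 P}
    (hp : p ∈ (Submodule.span ℂ (spectralGenerators P Wt 1)).topologicalClosure) :
    reLp P p.2 ∈ hWt.space := by
  let S : Submodule ℂ (Lp ℂ 2 (Measure.pi fun _ : Fin 1 => lebHalf) × Lp ℂ 2 P) :=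
    { carrier := {p | reLp P p.2 ∈ hWt.space ∧ imLp P p.2 ∈ hWt.space}
      add_mem' := fun ha hb => by
        simp only [mem_ofPred_eq, Prod.snd_add, map_add]
        exact ⟨add_mem ha.1 hb.1, add_mem ha.2 hb.2⟩
      zero_mem' := by
        simp only [mem_ofPred_eq, Prod.snd_zero, map_zero]
        exact ⟨zero_mem _, zero_mem _⟩
      smul_mem' := fun c a ha => by
        simp only [mem_ofPred_eq, Prod.smul_snd, reLp_smul, imLp_smul]
        exact ⟨sub_mem (hWt.space.smul_mem _ ha.1) (hWt.space.smul_mem _ ha.2),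
          add_mem (hWt.space.smul_mem _ ha.2) (hWt.space.smul_mem _ ha.1)⟩ }
  have hcl : IsClosed (hWt.space : Set (Lp ℝ 2 P)) := Submodule.isClosed_topologicalClosure _
  have hS : IsClosed (S : Set (Lp ℂ 2 (Measure.pi fun _ : Fin 1 => lebHalf) × Lp ℂ 2 P)) :=
    (hcl.preimage ((reLp P).continuous.comp continuous_snd)).inter
      (hcl.preimage ((imLp P).continuous.comp continuous_snd))
  refine (Submodule.topologicalClosure_minimal _ (Submodule.span_le.2 ?_) hS hp).1
  rintro q ⟨A, -, -, h2⟩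
  have hre : reLp P q.2 = hWt.parts (Sum.inl (A 0)) := by
    refine Lp.ext ?_
    filter_upwards [coeFn_reLp q.2, h2, (hWt.memLp_re (A 0)).coeFn_toLp] with ω h1 h2 h3
    rw [h1, h2, Fin.prod_univ_one]
    exact h3.symm
  have him : imLp P q.2 = hWt.parts (Sum.inr (A 0)) := by
    refine Lp.ext ?_
    filter_upwards [coeFn_imLp q.2, h2, (hWt.memLp_im (A 0)).coeFn_toLp] with ω h1 h2 h3
    rw [h1, h2, Fin.prod_univ_one]
    exact h3.symm
  change reLp P q.2 ∈ hWt.space ∧ imLp P q.2 ∈ hWt.space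
  rw [hre, him]
  exact ⟨hWt.parts_mem _, hWt.parts_mem _⟩

variable [IsProbabilityMeasure P]

/-- Off the diagonal the Wick product of the `W̃(A_i)` is their ordinary product. -/
theorem IsComplexGaussianMeasure.coeFn_wickLp_form (hWt : IsComplexGaussianMeasure P Wt) {n : ℕ}
    {A : Fin n → BoundedBorel} (hA : OffDiagonal A) :
    hWt.isGaussianSpace.wickLp (fun i => hWt.form (A i)) =ᵐ[P] fun ω => ∏ i, Wt (A i) ω := by
  have h1 : ∀ᵐ ω ∂P, ∀ i, (hWt.parts (Sum.inl (A i)) : Ω → ℝ) ω = (Wt (A i) ω).re :=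
    ae_all_iff.2 fun i => (hWt.memLp_re (A i)).coeFn_toLp
  have h2 : ∀ᵐ ω ∂P, ∀ i, (hWt.parts (Sum.inr (A i)) : Ω → ℝ) ω = (Wt (A i) ω).im :=
    ae_all_iff.2 fun i => (hWt.memLp_im (A i)).coeFn_toLp
  filter_upwards [h1, h2, (hWt.isGaussianSpace.memLp_gaussWick
    fun i => hWt.form (A i)).coeFn_toLp] with ω h1 h2 h3
  refine h3.trans ?_
  rw [gaussWick_eq_prod]
  · refine Finset.prod_congr rfl fun i _ => ?_
    simp only [IsComplexGaussianMeasure.form, h1, h2]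
    rw [mul_comm]
    exact Complex.re_add_im _
  · intro i j hij
    rw [hWt.formCov_form, (hA i j hij).2.inter_eq]
    simp

theorem IsComplexGaussianMeasure.spectralGenerators_subset (hWt : IsComplexGaussianMeasure P Wt)
    {Θ : Set (Lp ℂ 2 lebHalf × (hWt.space × hWt.space × ℂ))} (hΘ : hWt.indPairs ⊆ Θ) (n : ℕ) :
    spectralGenerators P Wt n ⊆ hWt.isGaussianSpace.wickPairs Θ n := by
  rintro p ⟨A, hA, h1, h2⟩
  refine ⟨fun i => indLp (A i), fun i => hWt.form (A i), fun i => hΘ ⟨A i, rfl⟩, ?_, ?_⟩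
  · rw [← rectLp_eq_prodLp]
    exact Lp.ext (h1.trans (coeFn_rectLp A).symm)
  · exact Lp.ext (h2.trans (hWt.coeFn_wickLp_form hA).symm)

/-- The spectral integral `Ĩ_n(g)` exists for every square integrable `g`. -/
theorem IsComplexGaussianMeasure.exists_spectral (hWt : IsComplexGaussianMeasure P Wt) {n : ℕ}
    (g : Lp ℂ 2 (Measure.pi fun _ : Fin n => lebHalf)) :
    ∃ Y, (g, Y) ∈ (Submodule.span ℂ (spectralGenerators P Wt n)).topologicalClosure := by
  have hΘ : ∀ a ∈ hWt.indPairs, ∀ b ∈ hWt.indPairs,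
      inner ℂ (formLp a.2) (formLp b.2) = inner ℂ a.1 b.1 := by
    rintro _ ⟨A, rfl⟩ _ ⟨B, rfl⟩
    exact hWt.inner_formLp_form A B
  refine exists_mem_topologicalClosure_span (C := Real.sqrt n.factorial) (fun p hp => ?_) ?_ g
  · exact hWt.isGaussianSpace.norm_le_of_mem_closure hΘ (Submodule.le_topologicalClosure _
      (Submodule.span_mono (hWt.spectralGenerators_subset subset_rfl n) hp))
  · rw [eq_top_iff, ← topologicalClosure_span_rectLp]
    refine Submodule.topologicalClosure_mono (Submodule.span_mono ?_)
    rintro _ ⟨A, hA, rfl⟩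
    exact ⟨(rectLp A, hWt.isGaussianSpace.wickLp fun i => hWt.form (A i)),
      ⟨A, hA, coeFn_rectLp A, hWt.coeFn_wickLp_form hA⟩, rfl⟩

/-- The first order integral is an isometry. -/
theorem IsComplexGaussianMeasure.inner_firstOrder (hWt : IsComplexGaussianMeasure P Wt) :
    ∀ a ∈ hWt.firstOrder, ∀ b ∈ hWt.firstOrder,
      inner ℂ (formLp a.2) (formLp b.2) = inner ℂ a.1 b.1 := by
  have hΘ : ∀ a ∈ hWt.indPairs, ∀ b ∈ hWt.indPairs,
      inner ℂ (formLp a.2) (formLp b.2) = inner ℂ a.1 b.1 := by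
    rintro _ ⟨A, rfl⟩ _ ⟨B, rfl⟩
    exact hWt.inner_formLp_form A B
  intro a ha b hb
  have hsub := Submodule.topologicalClosure_mono
    (Submodule.span_mono (R := ℂ) (hWt.spectralGenerators_subset subset_rfl 1))
  have h := hWt.isGaussianSpace.inner_of_mem_closure hΘ (hsub ha) (hsub hb)
  rw [Fintype.sum_unique] at h
  refine h.trans ?_
  rw [permLp_prodLp, inner_prodLp, Fin.prod_univ_one]

end SpectralSpace

/-! ### Elementary tensors of an orthonormal basis are total -/

section Tensor

variable {H : Ioo (0 : ℝ) 1} {n : ℕ}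

theorem norm_tensorH (x : Fin n → HilbertH H) : ‖tensorH x‖ = ∏ i, ‖x i‖ := by
  refine (pow_left_inj₀ (norm_nonneg _) (Finset.prod_nonneg fun i _ => norm_nonneg _)
    two_ne_zero).1 ?_
  rw [← real_inner_self_eq_norm_sq, inner_tensorH, ← Finset.prod_pow]
  exact Finset.prod_congr rfl fun i _ => real_inner_self_eq_norm_sq _

/-- The elementary tensor as a continuous linear function of its `a`-th factor. -/
def tensorUpdate (x : Fin n → HilbertH H) (a : Fin n) : HilbertH H →L[ℝ] TensorH H n :=
  LinearMap.mkContinuous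
    { toFun := fun v => tensorH (Function.update x a v)
      map_add' := fun v w => by
        simp only [tensorH, algTensor]
        rw [MultilinearMap.map_update_add]
        exact UniformSpace.Completion.coe_add _ _
      map_smul' := fun c v => by
        simp only [tensorH, algTensor]
        rw [MultilinearMap.map_update_smul]
        exact (UniformSpace.Completion.toComplL (𝕜 := ℝ) (E := AlgTensorH H n)).map_smul c _ }
    (∏ i ∈ Finset.univ.erase a, ‖x i‖) fun v => by
      refine le_of_eq ?_
      change ‖tensorH (Function.update x a v)‖ = _
      rw [norm_tensorH, ← Finset.prod_erase_mul _ _ (Finset.mem_univ a), Function.update_self]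
      congr 1
      exact Finset.prod_congr rfl fun i hi => by
        rw [Function.update_of_ne (Finset.ne_of_mem_erase hi)]

theorem tensorUpdate_apply (x : Fin n → HilbertH H) (a : Fin n) (v : HilbertH H) :
    tensorUpdate x a v = tensorH (Function.update x a v) := rfl

theorem topologicalClosure_span_tensorH {ι : Type*} (e : HilbertBasis ι ℝ (HilbertH H)) :
    (Submodule.span ℝ (range fun i : Fin n → ι => tensorH fun l => e (i l))
      ).topologicalClosure = ⊤ := by
  set T := (Submodule.span ℝ (range fun i : Fin n → ι => tensorH fun l => e (i l))
    ).topologicalClosure with hT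
  have hTc : IsClosed (T : Set (TensorH H n)) := Submodule.isClosed_topologicalClosure _
  -- The basis vectors are replaced by arbitrary vectors one factor at a time.
  have key : ∀ s : Finset (Fin n), ∀ x : Fin n → HilbertH H,
      (∀ l ∉ s, x l ∈ range e) → tensorH x ∈ T := by
    intro s
    induction s using Finset.induction_on with
    | empty =>
      intro x hx
      choose i hi using fun l => hx l (Finset.notMem_empty l)
      refine Submodule.le_topologicalClosure _ (Submodule.subset_span ⟨i, ?_⟩)
      simp only [hi]
    | insert a s ha ih =>
      intro x hx
      have h1 : (⊤ : Submodule ℝ (HilbertH H)) ≤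
          T.comap (tensorUpdate x a : HilbertH H →ₗ[ℝ] TensorH H n) := by
        rw [← e.dense_span]
        refine Submodule.topologicalClosure_minimal _ (Submodule.span_le.2 ?_)
          (hTc.preimage (tensorUpdate x a).continuous)
        rintro _ ⟨j, rfl⟩
        refine ih _ fun l hl => ?_
        rcases eq_or_ne l a with rfl | hla
        · rw [Function.update_self]; exact ⟨j, rfl⟩
        · rw [Function.update_of_ne hla]
          exact hx l (by simp [hla, hl])
      have h2 : tensorUpdate x a (x a) ∈ T := h1 (Submodule.mem_top (x := x a))
      rwa [tensorUpdate_apply, Function.update_eq_self] at h2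
  rw [eq_top_iff]
  rintro f -
  induction f using UniformSpace.Completion.induction_on with
  | hp => exact hTc
  | ih f =>
    have h1 : (⊤ : Submodule ℝ (AlgTensorH H n)) ≤ T.comap
        ((UniformSpace.Completion.toComplL (𝕜 := ℝ) (E := AlgTensorH H n) :
          AlgTensorH H n →L[ℝ] TensorH H n) : AlgTensorH H n →ₗ[ℝ] TensorH H n) := by
      have hspan : Submodule.span ℝ (range fun x : Fin n → HilbertH H => algTensor x) = ⊤ :=
        PiTensorProduct.span_tprod_eq_top
      rw [← hspan, Submodule.span_le]
      rintro _ ⟨x, rfl⟩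
      exact key Finset.univ x fun l hl => absurd (Finset.mem_univ l) hl
    exact h1 (Submodule.mem_top (x := f))

end Tensor

/-! ### The isonormal process as a first order spectral integral -/

section Isonormal

variable {Ω : Type*} [MeasurableSpace Ω] {P : Measure Ω} {H : Ioo (0 : ℝ) 1}
  {Wt : BoundedBorel → Ω → ℂ} {W : HilbertH H → Ω → ℝ}

theorem IsIsonormal.memLp (hW : IsIsonormal P W) (φ : HilbertH H) : MemLp (W φ) 2 P :=
  memLp_two_of_isGaussianProcess hW.gaussian φ

/-- The variables `W(φ)` as elements of `L²(P)`. -/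
def IsIsonormal.toLp (hW : IsIsonormal P W) (φ : HilbertH H) : Lp ℝ 2 P := (hW.memLp φ).toLp _

theorem IsIsonormal.inner_toLp (hW : IsIsonormal P W) (φ ψ : HilbertH H) :
    inner ℝ (hW.toLp φ) (hW.toLp ψ) = inner ℝ φ ψ :=
  (SpectralWiener.inner_toLp (hW.memLp φ) (hW.memLp ψ)).trans (hW.cov φ ψ)

/-- `φ ↦ W(φ)` is linear, because it preserves inner products. -/
def IsIsonormal.toLpCLM (hW : IsIsonormal P W) : HilbertH H →L[ℝ] Lp ℝ 2 P :=
  LinearMap.mkContinuous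
    { toFun := hW.toLp
      map_add' := fun φ ψ => by
        rw [← sub_eq_zero, ← inner_self_eq_zero (𝕜 := ℝ)]
        simp only [inner_sub_left, inner_sub_right, inner_add_left, inner_add_right,
          hW.inner_toLp]
        ring
      map_smul' := fun c φ => by
        rw [← sub_eq_zero, ← inner_self_eq_zero (𝕜 := ℝ), RingHom.id_apply]
        simp only [inner_sub_left, inner_sub_right, inner_smul_left, inner_smul_right,
          hW.inner_toLp]
        simp }
    1 fun φ => by
      rw [one_mul]
      refine le_of_eq ((pow_left_inj₀ (norm_nonneg _) (norm_nonneg _) two_ne_zero).1 ?_)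
      rw [← real_inner_self_eq_norm_sq, ← real_inner_self_eq_norm_sq]
      exact hW.inner_toLp φ φ

variable [IsProbabilityMeasure P]

/-- The representation of `W` on a rectangle, in terms of the kernel of the rectangle. -/
theorem IsSpectrallyRepresented.mem_closure_of_isRectangle (hWt : IsComplexGaussianMeasure P Wt)
    (hW : IsIsonormal P W) (hrep : IsSpectrallyRepresented P Wt W) {t x : ℝ} (ht : 0 ≤ t)
    {h : HilbertH H} (hh : IsRectangle t x h) :
    (hatLp (tensorH fun _ : Fin 1 => h), ofRealLp P (hW.toLp h)) ∈
      (Submodule.span ℂ (spectralGenerators P Wt 1)).topologicalClosure := by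
  obtain ⟨Y, hY⟩ := hWt.exists_spectral (hatLp (tensorH fun _ : Fin 1 => h))
  -- The kernel of the hypothesis on `W` is `ĥ`, almost everywhere.
  have hker : hatKernel (tensorH fun _ : Fin 1 => h) =ᵐ[Measure.pi fun _ : Fin 1 => lebHalf]
      fun z => (Icc 0 t).indicator
        (fun _ => ((Real.sqrt (cH H) : ℝ) : ℂ) * fourierInterval x (z 0).2 *
          ((|(z 0).2| ^ (1 / 2 - (H : ℝ)) : ℝ) : ℂ)) (z 0).1 := by
    have h1 : fourierTensor H 1 (tensorH fun _ : Fin 1 => h) =ᵐ[Measure.pi fun _ : Fin 1 => nuH H]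
        fun z => (Icc 0 t).indicator (fun _ => fourierInterval x (z 0).2) (z 0).1 := by
      filter_upwards [fourierTensor_tensorH fun _ : Fin 1 => h, ae_pi_of_ae (n := 1) hh]
        with z h1 h2
      rw [h1, Fin.prod_univ_one, h2]
    filter_upwards [ae_mul_eq_of_ae_withDensity (measurable_prod_sqrtWeight H 1)
      (pi_nuH_eq_withDensity H 1) h1] with z hz
    rw [hatKernel_eq, hz, Fin.prod_univ_one, sqrtWeight]
    by_cases hz0 : (z 0).1 ∈ Icc 0 t
    · rw [indicator_of_mem hz0, indicator_of_mem hz0]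
      push_cast
      ring
    · rw [indicator_of_notMem hz0, indicator_of_notMem hz0, mul_zero]
  have hspec : IsSpectralIntegral P Wt 1 (fun z => (Icc 0 t).indicator
        (fun _ => ((Real.sqrt (cH H) : ℝ) : ℂ) * fourierInterval x (z 0).2 *
          ((|(z 0).2| ^ (1 / 2 - (H : ℝ)) : ℝ) : ℂ)) (z 0).1) Y := by
    refine ⟨(memLp_hatKernel (tensorH fun _ : Fin 1 => h)).ae_eq hker, ?_⟩
    rwa [← MemLp.toLp_congr (memLp_hatKernel _) _ hker, toLp_hatKernel]
  have hYW : ofRealLp P (hW.toLp h) = Y := by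
    refine Lp.ext ?_
    filter_upwards [coeFn_ofRealLp (hW.toLp h), (hW.memLp h).coeFn_toLp,
      hrep t x ht h hh Y hspec] with ω h1 h2 h3
    rw [h1, ← h3]
    exact congrArg _ h2
  rwa [hYW]

/-- `W(φ)` is the first order spectral integral of `φ̂`, for every `φ ∈ ℋ_H`. -/
theorem IsSpectrallyRepresented.mem_closure (hWt : IsComplexGaussianMeasure P Wt)
    (hW : IsIsonormal P W) (hrep : IsSpectrallyRepresented P Wt W) (φ : HilbertH H) :
    (hatLp (tensorH fun _ : Fin 1 => φ), ofRealLp P (hW.toLp φ)) ∈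
      (Submodule.span ℂ (spectralGenerators P Wt 1)).topologicalClosure := by
  let L : HilbertH H →L[ℝ] Lp ℂ 2 (Measure.pi fun _ : Fin 1 => lebHalf) × Lp ℂ 2 P :=
    ((hatCLM H 1).comp (tensorUpdate (fun _ => 0) 0)).prod ((ofRealLp P).comp hW.toLpCLM)
  have hL : ∀ φ, L φ = (hatLp (tensorH fun _ : Fin 1 => φ), ofRealLp P (hW.toLp φ)) := by
    intro φ
    have : Function.update (fun _ : Fin 1 => (0 : HilbertH H)) 0 φ = fun _ => φ := by
      funext i
      rw [Subsingleton.elim i 0, Function.update_self]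
    change (hatLp (tensorH (Function.update (fun _ : Fin 1 => (0 : HilbertH H)) 0 φ)), _) = _
    rw [this]
    rfl
  have h1 : (⊤ : Submodule ℝ (HilbertH H)) ≤ (((Submodule.span ℂ (spectralGenerators P Wt 1)
      ).topologicalClosure).restrictScalars ℝ).comap (L : HilbertH H →ₗ[ℝ] _) := by
    rw [← topologicalClosure_span_rectangles]
    refine Submodule.topologicalClosure_minimal _ (Submodule.span_le.2 ?_)
      ((Submodule.isClosed_topologicalClosure _).preimage L.continuous)
    rintro h ⟨t, x, ht, hh⟩
    change L h ∈ (Submodule.span ℂ (spectralGenerators P Wt 1)).topologicalClosure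
    rw [hL]
    exact IsSpectrallyRepresented.mem_closure_of_isRectangle hWt hW hrep ht hh
  rw [← hL]
  exact h1 (Submodule.mem_top (x := φ))

theorem IsSpectrallyRepresented.toLp_mem (hWt : IsComplexGaussianMeasure P Wt)
    (hW : IsIsonormal P W) (hrep : IsSpectrallyRepresented P Wt W) (φ : HilbertH H) :
    hW.toLp φ ∈ hWt.space := by
  rw [← reLp_ofRealLp (hW.toLp φ)]
  exact hWt.reLp_mem (hrep.mem_closure hWt hW φ)

/-- The triple describing the real variable `W(φ)`; its coefficient is `0`. -/
def IsSpectrallyRepresented.form (hWt : IsComplexGaussianMeasure P Wt)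
    (hW : IsIsonormal P W) (hrep : IsSpectrallyRepresented P Wt W) (φ : HilbertH H) :
    hWt.space × hWt.space × ℂ :=
  (⟨hW.toLp φ, hrep.toLp_mem hWt hW φ⟩, 0, 0)

/-- In terms of triples, `W(φ) = Ĩ_1(φ̂)`. -/
theorem IsSpectrallyRepresented.form_mem (hWt : IsComplexGaussianMeasure P Wt)
    (hW : IsIsonormal P W) (hrep : IsSpectrallyRepresented P Wt W) (φ : HilbertH H) :
    (hatOne H (fourierH H φ), hrep.form hWt hW φ) ∈ hWt.firstOrder := by
  have h := hrep.mem_closure hWt hW φ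
  rw [hatLp_tensorH] at h
  have h2 : formLp (hrep.form hWt hW φ) = ofRealLp P (hW.toLp φ) := by
    simp [formLp, IsSpectrallyRepresented.form]
  rw [← h2] at h
  exact h

open Classical in
/-- A Wick product of variables `W(e_i)` is a product of Hermite polynomials. -/
theorem IsSpectrallyRepresented.coeFn_wickLp_form (hWt : IsComplexGaussianMeasure P Wt)
    (hW : IsIsonormal P W) (hrep : IsSpectrallyRepresented P Wt W) {ι : Type*}
    (e : HilbertBasis ι ℝ (HilbertH H)) {n : ℕ} (i : Fin n → ι) :
    hWt.isGaussianSpace.wickLp (fun l => hrep.form hWt hW (e (i l))) =ᵐ[P] fun ω =>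
      ((∏ j ∈ Finset.univ.image i, Polynomial.aeval (W (e j) ω)
        (Polynomial.hermite (Finset.univ.filter fun l => i l = j).card) : ℝ) : ℂ) := by
  have h1 : ∀ᵐ ω ∂P, ∀ l, hW.toLp (e (i l)) ω = W (e (i l)) ω :=
    ae_all_iff.2 fun l => (hW.memLp (e (i l))).coeFn_toLp
  filter_upwards [h1, (hWt.isGaussianSpace.memLp_gaussWick
    fun l => hrep.form hWt hW (e (i l))).coeFn_toLp] with ω h1 h2
  refine h2.trans ?_
  rw [gaussWick, wick_eq_prod_hermite formDeriv_gaussForm (fun j => hrep.form hWt hW (e j)),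
    evalGauss, map_prod, Complex.ofReal_prod]
  · refine Finset.prod_congr rfl fun j hj => ?_
    obtain ⟨l, -, rfl⟩ := Finset.mem_image.1 hj
    rw [Polynomial.aeval_def, Polynomial.aeval_def, Polynomial.hom_eval₂,
      ← Complex.ofRealHom_eq_coe, Polynomial.hom_eval₂]
    congr 1
    · exact RingHom.ext_int _ _
    · simp [gaussForm, IsSpectrallyRepresented.form, h1]
  · intro j j'
    simp only [formCov, IsSpectrallyRepresented.form, Submodule.coe_inner, hW.inner_toLp]
    rw [orthonormal_iff_ite.1 e.orthonormal]
    split_ifs <;> simp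

end Isonormal

/-! ### Comparison of the two multiple integrals -/

section Comparison

variable {Ω : Type*} [MeasurableSpace Ω] {P : Measure Ω} {H : Ioo (0 : ℝ) 1}
  {Wt : BoundedBorel → Ω → ℂ} {W : HilbertH H → Ω → ℝ} [IsProbabilityMeasure P]

theorem IsComplexGaussianMeasure.eq_of_mem_closure (hWt : IsComplexGaussianMeasure P Wt) {n : ℕ}
    {g : Lp ℂ 2 (Measure.pi fun _ : Fin n => lebHalf)} {Y Z : Lp ℂ 2 P}
    (hY : (g, Y) ∈ (Submodule.span ℂ
      (hWt.isGaussianSpace.wickPairs hWt.firstOrder n)).topologicalClosure)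
    (hZ : (g, Z) ∈ (Submodule.span ℂ
      (hWt.isGaussianSpace.wickPairs hWt.firstOrder n)).topologicalClosure) : Y = Z :=
  hWt.isGaussianSpace.eq_of_mem_closure hWt.inner_firstOrder hY hZ

theorem IsSpectralIntegral.mem_closure (hWt : IsComplexGaussianMeasure P Wt) {n : ℕ}
    {f : TensorH H n} {Y : Lp ℂ 2 P} (h : IsSpectralIntegral P Wt n (hatKernel f) Y) :
    (hatLp f, Y) ∈ (Submodule.span ℂ
      (hWt.isGaussianSpace.wickPairs hWt.firstOrder n)).topologicalClosure := by
  obtain ⟨hg, h⟩ := h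
  rw [toLp_hatKernel] at h
  exact Submodule.topologicalClosure_mono (Submodule.span_mono
    (hWt.spectralGenerators_subset hWt.indPairs_subset n)) h

/-- A Wiener integral `I_n^H(f)` is also a value of the common extension of both integrals at
`f̂`. -/
theorem IsSpectrallyRepresented.wiener_mem_closure (hWt : IsComplexGaussianMeasure P Wt)
    (hW : IsIsonormal P W) (hrep : IsSpectrallyRepresented P Wt W) {ι : Type*}
    (e : HilbertBasis ι ℝ (HilbertH H)) {n : ℕ} {p : TensorH H n × Lp ℝ 2 P}
    (h : p ∈ (Submodule.span ℝ (wienerGenerators P W e n)).topologicalClosure) :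
    (hatLp p.1, ofRealLp P p.2) ∈ (Submodule.span ℂ
      (hWt.isGaussianSpace.wickPairs hWt.firstOrder n)).topologicalClosure := by
  let L := (hatCLM H n).prodMap (ofRealLp P)
  have hle : (Submodule.span ℝ (wienerGenerators P W e n)).topologicalClosure ≤
      (((Submodule.span ℂ (hWt.isGaussianSpace.wickPairs hWt.firstOrder n)
        ).topologicalClosure).restrictScalars ℝ).comap
        (L : TensorH H n × Lp ℝ 2 P →ₗ[ℝ] _) := by
    refine Submodule.topologicalClosure_minimal _ (Submodule.span_le.2 ?_)
      ((Submodule.isClosed_topologicalClosure _).preimage L.continuous)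
    rintro q ⟨i, h1, h2⟩
    refine Submodule.le_topologicalClosure _ (Submodule.subset_span
      ⟨fun l => hatOne H (fourierH H (e (i l))), fun l => hrep.form hWt hW (e (i l)),
        fun l => hrep.form_mem hWt hW _, ?_, ?_⟩)
    · change hatLp q.1 = _
      rw [h1, hatLp_tensorH]
    · refine Lp.ext ?_
      filter_upwards [coeFn_ofRealLp q.2, h2, hrep.coeFn_wickLp_form hWt hW e i] with ω h3 h4 h5
      exact h3.trans ((congrArg _ h4).trans h5.symm)
  exact hle h

theorem IsWienerIntegral.mem_closure (hWt : IsComplexGaussianMeasure P Wt) (hW : IsIsonormal P W)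
    (hrep : IsSpectrallyRepresented P Wt W) {ι : Type*} {e : HilbertBasis ι ℝ (HilbertH H)} {n : ℕ}
    {f : TensorH H n} {X : Lp ℝ 2 P} (h : IsWienerIntegral P W e n f X) :
    (hatLp f, ofRealLp P X) ∈ (Submodule.span ℂ
      (hWt.isGaussianSpace.wickPairs hWt.firstOrder n)).topologicalClosure :=
  hrep.wiener_mem_closure hWt hW e (p := (f, X)) h

theorem IsSpectrallyRepresented.norm_wiener_le (hWt : IsComplexGaussianMeasure P Wt)
    (hW : IsIsonormal P W) (hrep : IsSpectrallyRepresented P Wt W) {ι : Type*}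
    (e : HilbertBasis ι ℝ (HilbertH H)) {n : ℕ} {p : TensorH H n × Lp ℝ 2 P}
    (h : p ∈ (Submodule.span ℝ (wienerGenerators P W e n)).topologicalClosure) :
    ‖p.2‖ ≤ Real.sqrt n.factorial * ‖p.1‖ := by
  have := hWt.isGaussianSpace.norm_le_of_mem_closure hWt.inner_firstOrder
    (hrep.wiener_mem_closure hWt hW e h)
  rwa [norm_ofRealLp, norm_hatLp] at this

/-- The Wiener integral `I_n^H(f)` exists for every `f ∈ ℋ_H^{⊗n}`. -/
theorem IsSpectrallyRepresented.exists_wiener (hWt : IsComplexGaussianMeasure P Wt)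
    (hW : IsIsonormal P W) (hrep : IsSpectrallyRepresented P Wt W) {ι : Type*}
    (e : HilbertBasis ι ℝ (HilbertH H)) {n : ℕ} (f : TensorH H n) :
    ∃ X, IsWienerIntegral P W e n f X := by
  classical
  refine exists_mem_topologicalClosure_span (C := Real.sqrt n.factorial) (fun p hp =>
    hrep.norm_wiener_le hWt hW e (Submodule.le_topologicalClosure _ hp)) ?_ f
  rw [eq_top_iff, ← topologicalClosure_span_tensorH e]
  refine Submodule.topologicalClosure_mono (Submodule.span_mono ?_)
  rintro _ ⟨i, rfl⟩
  refine ⟨(tensorH fun l => e (i l), reLp P (hWt.isGaussianSpace.wickLp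
    fun l => hrep.form hWt hW (e (i l)))), ⟨i, rfl, ?_⟩, rfl⟩
  filter_upwards [coeFn_reLp (hWt.isGaussianSpace.wickLp fun l => hrep.form hWt hW (e (i l))),
    hrep.coeFn_wickLp_form hWt hW e i] with ω h1 h2
  refine h1.trans ?_
  rw [h2, Complex.ofReal_re]

end Comparison

end SpectralWiener

end

theorem mainTheorem5 {Ω : Type*} [MeasurableSpace Ω] (P : MeasureTheory.Measure Ω)
    [MeasureTheory.IsProbabilityMeasure P] (H : Set.Ioo (0 : ℝ) 1)
    (Wt : SpectralWiener.BoundedBorel → Ω → ℂ)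
    (hWt : SpectralWiener.IsComplexGaussianMeasure P Wt)
    (W : SpectralWiener.HilbertH H → Ω → ℝ)
    (hW : SpectralWiener.IsIsonormal P W)
    (hrep : SpectralWiener.IsSpectrallyRepresented P Wt W)
    {ι : Type*} (e : HilbertBasis ι ℝ (SpectralWiener.HilbertH H))
    (n : ℕ) (hn : 1 ≤ n) (f : SpectralWiener.TensorH H n) :
    (∃! X : MeasureTheory.Lp ℝ 2 P, SpectralWiener.IsWienerIntegral P W e n f X) ∧
    (∃! Y : MeasureTheory.Lp ℂ 2 P,
      SpectralWiener.IsSpectralIntegral P Wt n (SpectralWiener.hatKernel f) Y) ∧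
    ∀ (X : MeasureTheory.Lp ℝ 2 P) (Y : MeasureTheory.Lp ℂ 2 P),
      SpectralWiener.IsWienerIntegral P W e n f X →
      SpectralWiener.IsSpectralIntegral P Wt n (SpectralWiener.hatKernel f) Y →
      ∀ᵐ ω ∂P, ((X ω : ℝ) : ℂ) = Y ω := by
  refine ⟨?_, ?_, ?_⟩
  · obtain ⟨X, hX⟩ := hrep.exists_wiener hWt hW e f
    refine ⟨X, hX, fun X' hX' => ?_⟩
    have h := congrArg (SpectralWiener.reLp P)
      (hWt.eq_of_mem_closure (SpectralWiener.IsWienerIntegral.mem_closure hWt hW hrep hX')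
        (hX.mem_closure hWt hW hrep))
    rwa [SpectralWiener.reLp_ofRealLp, SpectralWiener.reLp_ofRealLp] at h
  · obtain ⟨Y, hY⟩ := hWt.exists_spectral (SpectralWiener.hatLp f)
    refine ⟨Y, ?_, fun Y' hY' => hWt.eq_of_mem_closure (hY'.mem_closure hWt) ?_⟩
    · exact ⟨SpectralWiener.memLp_hatKernel f, by rwa [SpectralWiener.toLp_hatKernel]⟩
    · exact SpectralWiener.IsSpectralIntegral.mem_closure hWt
        ⟨SpectralWiener.memLp_hatKernel f, by rwa [SpectralWiener.toLp_hatKernel]⟩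
  · intro X Y hX hY
    rw [← hWt.eq_of_mem_closure (hX.mem_closure hWt hW hrep) (hY.mem_closure hWt)]
    filter_upwards [SpectralWiener.coeFn_ofRealLp X] with ω hω
    exact hω.symm
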